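/- Let $\Theta=((0,\infty)\times(0,\infty))^{\mathbb Z}$, with the product $\sigma$-algebra, be the space of environments $\xi=((r_x^-,r_x^+))_{x\in\mathbb Z}$, and let $\mathbb P$ be a probability measure on $\Theta$ that is stationary and ergodic with respect to the shift $(\theta\xi)_x=\xi_{x+1}$ and for which $\mathbb E[\log\rho_0]$, $\rho_0=r_0^- /r_0^+$, is well defined, with $\pm\infty$ as possible values. For $\lambda\in\mathbb R$ and $\xi\in\Theta$ let $(Y_t^{\xi,\lambda})_{t\ge 0}$ be the continuous-time nearest-neighbour random walk on $\mathbb Z$ started at $0$ that jumps from $x$ to $x\pm1$ at rate $r_x^{\pm}(\lambda)=r_x^{\pm}e^{\pm\lambda}$, and let $P_0^{\xi,\lambda}$ be its law. Then for every $\lambda\in\mathbb R$, $\mathbb P\otimes P_0^{\xi,\lambda}$-almost surely the walk does not explode and the limit $v_Y(\lambda)=\lim_{t\to\infty}Y_t^{\xi,\lambda}/t$ exists, is finite and is not random. Put $$\lambda_-:=\sup\{\lambda\in\mathbb R: v_Y(\lambda)<0\},\qquad \lambda_+:=\inf\{\lambda\in\mathbb R: v_Y(\lambda)>0\}$$ in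 $[-\infty,\infty]$, with $\sup\emptyset=-\infty$ and $\inf\emptyset=+\infty$. The function $v_Y:\mathbb R\to\mathbb R$ is nondecreasing and $\lambda_-\le\lambda_+$. Moreover, $v_Y$ is strictly increasing and real analytic on $(-\infty,\lambda_-)$ and on $(\lambda_+,+\infty)$, and $v_Y(\lambda)=0$ for every real $\lambda\in(\lambda_-,\lambda_+)$. -/

import Mathlib

open MeasureTheory ProbabilityTheory Filter Topology

noncomputable section

namespace BiasedWalk

/-- The space `Θ = ((0,∞) × (0,∞))^ℤ` of environments, with the product σ-algebra.
A point is `ξ = ((r_x^-, r_x^+))_{x ∈ ℤ}`. -/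
abbrev Environment : Type := ℤ → Set.Ioi (0 : ℝ) × Set.Ioi (0 : ℝ)

/-- The unbiased jump rate `r_x^-` from `x` to `x - 1`. -/
def rateMinus (ξ : Environment) (x : ℤ) : ℝ := ((ξ x).1 : ℝ)

/-- The unbiased jump rate `r_x^+` from `x` to `x + 1`. -/
def ratePlus (ξ : Environment) (x : ℤ) : ℝ := ((ξ x).2 : ℝ)

/-- The biased rate `r_x^-(λ) = r_x^- e^{-λ}`. -/
def biasedRateMinus (lam : ℝ) (ξ : Environment) (x : ℤ) : ℝ := rateMinus ξ x * Real.exp (-lam)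

/-- The biased rate `r_x^+(λ) = r_x^+ e^{λ}`. -/
def biasedRatePlus (lam : ℝ) (ξ : Environment) (x : ℤ) : ℝ := ratePlus ξ x * Real.exp lam

/-- `ρ_x = r_x^- / r_x^+`. -/
def ratio (ξ : Environment) (x : ℤ) : ℝ := rateMinus ξ x / ratePlus ξ x

/-- The spatial shift `(θξ)_x = ξ_{x+1}`. -/
def shift (ξ : Environment) : Environment := fun x => ξ (x + 1)

/-- `E[log ρ_0]` is well defined in `[-∞, ∞]`: the positive part or the negative part of `log ρ_0`
has finite expectation. -/
def LogRatioMeanWellDefined (P : Measure Environment) : Prop :=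
  ∫⁻ ξ, ENNReal.ofReal (Real.log (ratio ξ 0)) ∂P < ⊤ ∨
    ∫⁻ ξ, ENNReal.ofReal (-Real.log (ratio ξ 0)) ∂P < ⊤

instance isProbabilityMeasure_exp_one : IsProbabilityMeasure (expMeasure 1) :=
  isProbabilityMeasure_expMeasure one_pos

/-- The randomness driving the walk in a given environment: a sequence of pairs `(γ_n, W_n)`. -/
abbrev Noise : Type := ℕ → unitInterval × ℝ

/-- The law of the noise: all `γ_n` and `W_n` are independent, `γ_n` is uniform on `[0,1]` and
`W_n` is exponential with mean `1`. -/
def noiseLaw : Measure Noise :=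
  Measure.infinitePi fun _ : ℕ => (volume : Measure unitInterval).prod (expMeasure 1)

instance isProbabilityMeasure_noiseLaw : IsProbabilityMeasure noiseLaw := by
  unfold noiseLaw; infer_instance

/-- The probability `ω_x^+(λ) = r_x^+(λ) / (r_x^-(λ) + r_x^+(λ))` that a jump from `x` goes to
`x + 1`. -/
def jumpProbPlus (lam : ℝ) (ξ : Environment) (x : ℤ) : ℝ :=
  biasedRatePlus lam ξ x / (biasedRateMinus lam ξ x + biasedRatePlus lam ξ x)

/-- The jump process: `X_0 = 0`, and from `X_n` the walk jumps to `X_n + 1` with probability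
`ω_{X_n}^+(λ)` and to `X_n - 1` otherwise. -/
def jumpChain (lam : ℝ) (ξ : Environment) (η : Noise) : ℕ → ℤ
  | 0 => 0
  | n + 1 =>
    if ((η n).1 : ℝ) ≤ jumpProbPlus lam ξ (jumpChain lam ξ η n) then jumpChain lam ξ η n + 1
    else jumpChain lam ξ η n - 1

/-- The time spent at `X_n` before the next jump, exponential of parameter
`r_{X_n}^-(λ) + r_{X_n}^+(λ)` given the environment and the jump process. -/
def holdingTime (lam : ℝ) (ξ : Environment) (η : Noise) (n : ℕ) : ℝ :=
  (η n).2 / (biasedRateMinus lam ξ (jumpChain lam ξ η n) +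
    biasedRatePlus lam ξ (jumpChain lam ξ η n))

/-- The time `U_n` of the `n`-th jump (`U_0 = 0`). -/
def jumpTime (lam : ℝ) (ξ : Environment) (η : Noise) (n : ℕ) : ℝ :=
  ∑ k ∈ Finset.range n, holdingTime lam ξ η k

/-- The continuous time walk started at the origin: `Y_t = X_n` when `U_n ≤ t < U_{n+1}`.
The index is written as the largest `n` with `U_n ≤ t`; it is meaningful for all `t ≥ 0` on the
event that no explosion takes place, i.e. `U_n → ∞`. -/
def walk (lam : ℝ) (ξ : Environment) (η : Noise) (t : ℝ) : ℤ :=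
  jumpChain lam ξ η (sSup {n : ℕ | jumpTime lam ξ η n ≤ t})

/-- The number `v` is the asymptotic velocity under bias `λ`: almost surely with respect to the
joint law of the environment and the walk, the walk does not explode and `Y_t / t → v`. -/
def IsAsymptoticVelocity (P : Measure Environment) (lam v : ℝ) : Prop :=
  ∀ᵐ p ∂(P.prod noiseLaw),
    Tendsto (fun n : ℕ => jumpTime lam p.1 p.2 n) atTop atTop ∧
    Tendsto (fun t : ℝ => (walk lam p.1 p.2 t : ℝ) / t) atTop (𝓝 v)

/-- There is at most one asymptotic velocity. -/
theorem IsAsymptoticVelocity.unique {P : Measure Environment} [IsProbabilityMeasure P]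
    {lam v w : ℝ} (hv : IsAsymptoticVelocity P lam v) (hw : IsAsymptoticVelocity P lam w) :
    v = w := by
  obtain ⟨p, h1, h2⟩ := (hv.and hw).exists
  exact tendsto_nhds_unique h1.2 h2.2

open Classical in
/-- The asymptotic velocity `v_Y(λ)`, the deterministic almost sure limit of `Y_t / t`
(and `0` should there be no such limit). -/
def velocity (P : Measure Environment) (lam : ℝ) : ℝ :=
  if h : ∃ v : ℝ, IsAsymptoticVelocity P lam v then h.choose else 0

/-- `λ_- = sup {λ : v_Y(λ) < 0}` in `[-∞, ∞]`, with `sup ∅ = -∞`. -/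
def lambdaMinus (P : Measure Environment) : EReal :=
  sSup ((fun lam : ℝ => (lam : EReal)) '' {lam : ℝ | velocity P lam < 0})

/-- `λ_+ = inf {λ : v_Y(λ) > 0}` in `[-∞, ∞]`, with `inf ∅ = +∞`. -/
def lambdaPlus (P : Measure Environment) : EReal :=
  sInf ((fun lam : ℝ => (lam : EReal)) '' {lam : ℝ | 0 < velocity P lam})

end BiasedWalk

end

/-! Let `T(λ)` be the mean time the walk needs to go from `0` to `1`, averaged over the environment,
and let `T*` be the same quantity for the reflected environment. The velocity is `1/T(λ) - 1/T*(-λ)`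
with `1/∞ = 0`, and at most one of the two terms is nonzero (`velocity_eq_sub`,
`meanPassage_eq_top_or`). Unfolding the recursion for the mean gives `T(λ) = ∑ e^{-(2k+1)λ} α_k`
with `α_k ≥ 0` and `α_0 > 0` (`meanPassage_eq`). Hence `1/T` is nondecreasing, is strictly
increasing where `T` is finite, and is analytic to the right of any point of finiteness, because
`e^λ T(λ)` is a power series in `e^{-2λ}`. Everything claimed about `v_Y` follows from this formula.

The velocity formula needs bounds on passage times. Passages are not too fast: the Laplace transform
of a passage time obeys a one-step recursion. Each finite iterate of it gives a Chernoff bound with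
an exponent that is additive over sites. The ergodic theorem for the environment evaluates this
exponent and Borel–Cantelli concludes (`ae_eventually_lt_envClock`). This also covers `T = ∞`, and
applied in both directions it rules out explosion and gives velocity `0` when `T` and `T*` are both
infinite. Passages are not too slow when `T < ∞`: restarting at the first visit to `1` preserves the
joint law of environment and noise, and the passage time has mean at most `T`. Since its averages
are already known to be asymptotically at least `T`, a maximal inequality forces them to converge to
`T` (`ae_notMem_upperSet_of_lowerSet`), without any ergodicity of the restart map. To go from
passage times to the position at time `t`, backtracking of linear size has to be excluded: the
return from it would take linear time, whereas consecutive passage times are `o(n)` apart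
(`exists_ae_eventually_not_recross`, `eventually_le_apply_jumpCount`). -/

noncomputable section
namespace BiasedWalk

open scoped ENNReal

/-! ### The noise -/

/-- The law of one step of the noise. -/
def stepLaw : Measure (unitInterval × ℝ) :=
  (volume : Measure unitInterval).prod (expMeasure 1)

instance isProbabilityMeasure_stepLaw : IsProbabilityMeasure stepLaw := by
  unfold stepLaw; infer_instance

/-- Prepend one step to the noise. -/
def consNoise (e : unitInterval × ℝ) (η : Noise) : Noise
  | 0 => e
  | n + 1 => η n

/-- Forget the first `j` steps of the noise. -/
def shiftNoise (j : ℕ) (η : Noise) : Noise := fun n => η (j + n)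

@[simp] lemma consNoise_zero (e η) : consNoise e η 0 = e := rfl
@[simp] lemma consNoise_succ (e η n) : consNoise e η (n + 1) = η n := rfl

@[simp] lemma shiftNoise_zero (η : Noise) : shiftNoise 0 η = η := by
  funext n; simp [shiftNoise]

lemma shiftNoise_shiftNoise (i j : ℕ) (η : Noise) :
    shiftNoise i (shiftNoise j η) = shiftNoise (j + i) η := by
  funext n; simp [shiftNoise, add_assoc]

lemma shiftNoise_succ_consNoise (j : ℕ) (e η) :
    shiftNoise (j + 1) (consNoise e η) = shiftNoise j η := by
  funext n
  simp only [shiftNoise, show j + 1 + n = (j + n) + 1 by omega, consNoise_succ]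

lemma measurable_shiftNoise (j : ℕ) : Measurable (shiftNoise j) :=
  measurable_pi_lambda _ fun n => measurable_pi_apply (j + n)

lemma measurable_consNoise : Measurable fun p : (unitInterval × ℝ) × Noise =>
    consNoise p.1 p.2 := by
  refine measurable_pi_lambda _ fun n => ?_
  cases n with
  | zero => exact measurable_fst
  | succ n => exact (measurable_pi_apply n).comp measurable_snd

-- Both laws give the same mass to finite-dimensional boxes: the coordinate `0` splits off and the
-- remaining ones are reindexed. All first-step analysis of the walk rests on this decomposition.
open Classical in
lemma map_consNoise :
    (stepLaw.prod noiseLaw).map (fun p => consNoise p.1 p.2) = noiseLaw := by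
  unfold noiseLaw
  refine Measure.eq_infinitePi _ fun s t ht => ?_
  rw [Measure.map_apply measurable_consNoise
    (MeasurableSet.pi s.countable_toSet fun i _ => ht i)]
  set s' : Finset ℕ := s.preimage Nat.succ (Nat.succ_injective.injOn)
  have hpre : (fun p : (unitInterval × ℝ) × Noise => consNoise p.1 p.2) ⁻¹' (Set.pi s t) =
      (if 0 ∈ s then t 0 else Set.univ) ×ˢ Set.pi s' (fun i => t (i + 1)) := by
    ext ⟨e, η⟩
    simp only [Set.mem_preimage, Set.mem_pi, Finset.mem_coe, Set.mem_prod, s',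
      Finset.mem_preimage]
    constructor
    · intro h
      refine ⟨?_, fun i hi => h _ hi⟩
      split_ifs with h0
      · exact h 0 h0
      · trivial
    · rintro ⟨h0, h1⟩ i hi
      cases i with
      | zero => simpa [hi] using h0
      | succ i => exact h1 i hi
  rw [hpre, Measure.prod_prod, Measure.infinitePi_pi _ (fun i _ => ht _)]
  have hprod := Finset.prod_preimage' Nat.succ s Nat.succ_injective.injOn
    (fun i => stepLaw (t i))
  have hr : (Finset.filter (fun x => x ∈ Set.range Nat.succ) s) = s.erase 0 := by
    ext i
    cases i <;> simp
  rw [hr] at hprod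
  change _ * ∏ i ∈ s', stepLaw (t (Nat.succ i)) = ∏ i ∈ s, stepLaw (t i)
  rw [hprod]
  split_ifs with h0
  · exact Finset.mul_prod_erase s (fun i => stepLaw (t i)) h0
  · simp [Finset.erase_eq_of_notMem h0]

lemma lintegral_noiseLaw {F : Noise → ℝ≥0∞} (hF : Measurable F) :
    ∫⁻ η, F η ∂noiseLaw = ∫⁻ e, ∫⁻ η, F (consNoise e η) ∂noiseLaw ∂stepLaw := by
  conv_lhs => rw [← map_consNoise]
  rw [lintegral_map hF measurable_consNoise]
  exact lintegral_prod _ (hF.comp measurable_consNoise).aemeasurable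

lemma measurable_consNoise_left (e) : Measurable (consNoise e) :=
  measurable_consNoise.comp measurable_prodMk_left

lemma noiseLaw_apply {A : Set Noise} (hA : MeasurableSet A) :
    noiseLaw A = ∫⁻ e, noiseLaw (consNoise e ⁻¹' A) ∂stepLaw := by
  conv_lhs => rw [← map_consNoise]
  rw [Measure.map_apply measurable_consNoise hA,
    Measure.prod_apply (measurable_consNoise hA)]
  rfl

/-- The first `j` steps of the noise are independent of the later ones. -/
lemma noiseLaw_inter_shiftNoise (j : ℕ) {A B : Set Noise} (hA : MeasurableSet A)
    (hdep : ∀ η η' : Noise, (∀ i < j, η i = η' i) → η ∈ A → η' ∈ A) (hB : MeasurableSet B) :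
    noiseLaw (A ∩ shiftNoise j ⁻¹' B) = noiseLaw A * noiseLaw B := by
  induction j generalizing A with
  | zero =>
    have hid : shiftNoise 0 ⁻¹' B = B := by ext η; simp
    rw [hid]
    rcases A.eq_empty_or_nonempty with rfl | ⟨η, hη⟩
    · simp
    · have : A = Set.univ := Set.eq_univ_of_forall fun η' => hdep η η' (by simp) hη
      simp [this]
  | succ j ih =>
    rw [noiseLaw_apply (hA.inter (measurable_shiftNoise _ hB)), noiseLaw_apply hA]
    have hset : ∀ e, noiseLaw (consNoise e ⁻¹' (A ∩ shiftNoise (j + 1) ⁻¹' B)) =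
        noiseLaw (consNoise e ⁻¹' A) * noiseLaw B := by
      intro e
      rw [← ih (measurable_consNoise_left e hA)]
      · congr 1
        ext η
        simp [shiftNoise_succ_consNoise]
      · intro η η' h hη
        refine hdep _ _ ?_ hη
        intro i hi
        cases i with
        | zero => rfl
        | succ i => exact h i (by omega)
    simp_rw [hset]
    exact lintegral_mul_const _ (measurable_measure_prodMk_left (measurable_consNoise hA))

/-- A form of the strong Markov property. -/
lemma noiseLaw_iUnion_inter_shiftNoise {A : ℕ → Set Noise} {B : Set Noise}
    (hA : ∀ j, MeasurableSet (A j)) (hdisj : Pairwise (Function.onFun Disjoint A))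
    (hdep : ∀ j, ∀ η η' : Noise, (∀ i < j, η i = η' i) → η ∈ A j → η' ∈ A j)
    (hB : MeasurableSet B) :
    noiseLaw (⋃ j, A j ∩ shiftNoise j ⁻¹' B) = noiseLaw (⋃ j, A j) * noiseLaw B := by
  rw [measure_iUnion, measure_iUnion hdisj hA, ← ENNReal.tsum_mul_right]
  · exact tsum_congr fun j => noiseLaw_inter_shiftNoise j (hA j) (hdep j) hB
  · exact fun i j hij => (hdisj hij).mono Set.inter_subset_left Set.inter_subset_left
  · exact fun j => (hA j).inter (measurable_shiftNoise j hB)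

/-! ### The exponential distribution -/

lemma lintegral_expMeasure {f : ℝ → ℝ≥0∞} (hf : Measurable f) :
    ∫⁻ w, f w ∂expMeasure 1 = ∫⁻ w, exponentialPDF 1 w * f w := by
  have hm : Measurable (exponentialPDF 1) := (measurable_exponentialPDFReal 1).ennreal_ofReal
  change ∫⁻ w, f w ∂(volume.withDensity (exponentialPDF 1)) = _
  rw [lintegral_withDensity_eq_lintegral_mul _ hm hf]
  rfl

lemma lintegral_exp_neg_expMeasure {c : ℝ} (hc : 0 ≤ c) :
    ∫⁻ w, ENNReal.ofReal (Real.exp (-(c * w))) ∂expMeasure 1 = ENNReal.ofReal (1 / (1 + c)) := by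
  rw [lintegral_expMeasure (by fun_prop)]
  have h : ∀ w : ℝ, exponentialPDF 1 w * ENNReal.ofReal (Real.exp (-(c * w))) =
      ENNReal.ofReal (1 / (1 + c)) * exponentialPDF (1 + c) w := by
    intro w
    rw [exponentialPDF_eq, exponentialPDF_eq]
    split_ifs
    · rw [← ENNReal.ofReal_mul (by positivity), ← ENNReal.ofReal_mul (by positivity)]
      congr 1
      rw [one_mul, one_mul, ← Real.exp_add, ← mul_assoc, one_div, inv_mul_cancel₀ (by positivity),
        one_mul]
      congr 1; ring
    · simp
  simp_rw [h]
  have hm : Measurable (exponentialPDF (1 + c)) :=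
    (measurable_exponentialPDFReal (1 + c)).ennreal_ofReal
  rw [lintegral_const_mul _ hm, lintegral_exponentialPDF_eq_one (by positivity), mul_one]

lemma lintegral_id_expMeasure : ∫⁻ w, ENNReal.ofReal w ∂expMeasure 1 = 1 := by
  rw [lintegral_expMeasure (by fun_prop)]
  -- The integrand `w e^{-w}` is the Gamma density with shape `2` and rate `1`, so the mean is its
  -- total mass.
  rw [← lintegral_gammaPDF_eq_one (a := 2) (r := 1) (by norm_num) (by norm_num)]
  refine lintegral_congr fun w => ?_
  rw [exponentialPDF_eq, gammaPDF_eq]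
  split_ifs with h
  · rw [← ENNReal.ofReal_mul (by positivity)]
    congr 1
    norm_num
    ring
  · simp

lemma ae_expMeasure_nonneg : ∀ᵐ w ∂expMeasure 1, 0 ≤ w := by
  have h0 : expMeasure 1 (Set.Iio 0) = 0 := by
    change (volume.withDensity (exponentialPDF 1)) (Set.Iio 0) = 0
    rw [withDensity_apply _ measurableSet_Iio]
    exact lintegral_exponentialPDF_of_nonpos le_rfl
  rw [ae_iff]
  simpa [Set.Iio] using h0

lemma ae_noiseLaw_nonneg : ∀ᵐ η ∂noiseLaw, ∀ k, 0 ≤ (η k).2 := by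
  refine ae_all_iff.2 fun k => ?_
  have h1 : MeasurePreserving (fun η : Noise => η k) noiseLaw stepLaw :=
    measurePreserving_eval_infinitePi (fun _ : ℕ => stepLaw) k
  have h2 : MeasurePreserving (Prod.snd : unitInterval × ℝ → ℝ) stepLaw (expMeasure 1) :=
    measurePreserving_snd
  exact (h2.comp h1).quasiMeasurePreserving.ae ae_expMeasure_nonneg

/-- The holding time and the direction of a jump are independent, so one step of the recursion
factors; `c` and `d` are the values after a jump to the right and to the left. -/
lemma lintegral_stepLaw_mul {p : ℝ} (h0 : 0 ≤ p) (h1 : p ≤ 1) {h : ℝ → ℝ≥0∞}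
    (hm : Measurable h) (c d : ℝ≥0∞) :
    ∫⁻ e, h e.2 * (if (e.1 : ℝ) ≤ p then c else d) ∂stepLaw =
      (∫⁻ w, h w ∂expMeasure 1) * (ENNReal.ofReal p * c + ENNReal.ofReal (1 - p) * d) := by
  have hS : MeasurableSet {γ : unitInterval | (γ : ℝ) ≤ p} :=
    measurableSet_le measurable_subtype_coe measurable_const
  have hite : Measurable fun γ : unitInterval => if (γ : ℝ) ≤ p then c else d :=
    Measurable.ite hS measurable_const measurable_const
  have := lintegral_prod_mul (μ := (volume : Measure unitInterval)) (ν := expMeasure 1)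
    (f := fun γ : unitInterval => if (γ : ℝ) ≤ p then c else d) (g := h)
    hite.aemeasurable hm.aemeasurable
  simp_rw [mul_comm (h _)]
  unfold stepLaw
  rw [this, mul_comm]
  congr 1
  have hsplit : ∀ γ : unitInterval, (if (γ : ℝ) ≤ p then c else d) =
      ({γ : unitInterval | (γ : ℝ) ≤ p}.indicator (fun _ => c) γ +
        {γ : unitInterval | (γ : ℝ) ≤ p}ᶜ.indicator (fun _ => d) γ) := by
    intro γ
    by_cases hγ : (γ : ℝ) ≤ p <;> simp [hγ]
  simp_rw [hsplit]
  rw [lintegral_add_left (measurable_const.indicator hS), lintegral_indicator hS,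
    lintegral_indicator hS.compl]
  have hv : volume {γ : unitInterval | (γ : ℝ) ≤ p} = ENNReal.ofReal p := by
    have := unitInterval.volume_Iic ⟨p, h0, h1⟩
    exact this
  simp only [lintegral_const, Measure.restrict_apply MeasurableSet.univ, Set.univ_inter]
  rw [prob_compl_eq_one_sub hS, hv, ENNReal.ofReal_sub _ h0, ENNReal.ofReal_one, mul_comm c,
    mul_comm d]

/-! ### The walk with arbitrary rates and starting point -/

/-- The jump chain started at `x`, with rates `a y` to the left and `b y` to the right. -/
def chain (a b : ℤ → ℝ) (x : ℤ) (η : Noise) : ℕ → ℤ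
  | 0 => x
  | n + 1 =>
    if ((η n).1 : ℝ) ≤ b (chain a b x η n) / (a (chain a b x η n) + b (chain a b x η n))
    then chain a b x η n + 1 else chain a b x η n - 1

/-- The time of the `n`-th jump of the walk started at `x`. -/
def clock (a b : ℤ → ℝ) (x : ℤ) (η : Noise) (n : ℕ) : ℝ :=
  ∑ k ∈ Finset.range n, (η k).2 / (a (chain a b x η k) + b (chain a b x η k))

variable {a b : ℤ → ℝ}

lemma chain_succ (x η n) : chain a b x η (n + 1) =
    if ((η n).1 : ℝ) ≤ b (chain a b x η n) / (a (chain a b x η n) + b (chain a b x η n))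
    then chain a b x η n + 1 else chain a b x η n - 1 := rfl

lemma chain_succ_cases (x η n) : chain a b x η (n + 1) = chain a b x η n + 1 ∨
    chain a b x η (n + 1) = chain a b x η n - 1 := by
  rw [chain_succ]; split_ifs <;> simp

@[simp] lemma chain_zero (x η) : chain a b x η 0 = x := rfl
@[simp] lemma clock_zero (x η) : clock a b x η 0 = 0 := by simp [clock]

lemma clock_succ (x η n) : clock a b x η (n + 1) = clock a b x η n +
    (η n).2 / (a (chain a b x η n) + b (chain a b x η n)) := Finset.sum_range_succ _ _

lemma chain_add (x η j k) :
    chain a b x η (j + k) = chain a b (chain a b x η j) (shiftNoise j η) k := by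
  induction k with
  | zero => rfl
  | succ k ih => rw [← add_assoc, chain_succ, chain_succ, ih]; rfl

lemma clock_add (x η j k) : clock a b x η (j + k) =
    clock a b x η j + clock a b (chain a b x η j) (shiftNoise j η) k := by
  induction k with
  | zero => simp
  | succ k ih => rw [← add_assoc, clock_succ, clock_succ, ih, chain_add, add_assoc]; rfl

lemma chain_consNoise (x e η k) : chain a b x (consNoise e η) (k + 1) =
    chain a b (if (e.1 : ℝ) ≤ b x / (a x + b x) then x + 1 else x - 1) η k := by
  rw [add_comm, chain_add]
  have : shiftNoise 1 (consNoise e η) = η := by simpa using shiftNoise_succ_consNoise 0 e η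
  rw [this]; rfl

lemma clock_consNoise (x e η k) : clock a b x (consNoise e η) (k + 1) = e.2 / (a x + b x) +
    clock a b (if (e.1 : ℝ) ≤ b x / (a x + b x) then x + 1 else x - 1) η k := by
  rw [add_comm, clock_add]
  have : shiftNoise 1 (consNoise e η) = η := by simpa using shiftNoise_succ_consNoise 0 e η
  rw [this, clock_succ, clock_zero, zero_add]; rfl

/-- Adaptedness of the chain, which supplies the dependence hypothesis in the strong Markov
property. -/
lemma chain_congr {x : ℤ} {η η' : Noise} {j : ℕ} (h : ∀ i < j, η i = η' i) {k : ℕ} (hk : k ≤ j) :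
    chain a b x η k = chain a b x η' k := by
  induction k with
  | zero => rfl
  | succ k ih => rw [chain_succ, chain_succ, ih (by omega), h k (by omega)]

lemma chain_translate (x y : ℤ) (η k) : chain a b (x + y) η k =
    y + chain (fun i => a (i + y)) (fun i => b (i + y)) x η k := by
  induction k with
  | zero => simp [add_comm]
  | succ k ih =>
    rw [chain_succ, chain_succ, ih, add_comm y]
    split_ifs <;> ring

lemma clock_translate (x y : ℤ) (η k) : clock a b (x + y) η k =
    clock (fun i => a (i + y)) (fun i => b (i + y)) x η k := by
  unfold clock
  simp_rw [chain_translate, add_comm y]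

/-- The chain visits all the states between two states it visits. -/
lemma exists_chain_eq {x : ℤ} {η : Noise} {i j : ℕ} (hij : i ≤ j) {m : ℤ}
    (h : chain a b x η i ≤ m ∧ m ≤ chain a b x η j ∨
      chain a b x η j ≤ m ∧ m ≤ chain a b x η i) :
    ∃ k, i ≤ k ∧ k ≤ j ∧ chain a b x η k = m := by
  induction j, hij using Nat.le_induction with
  | base => exact ⟨i, le_rfl, le_rfl, by omega⟩
  | succ j hij ih =>
    by_cases hm : chain a b x η (j + 1) = m
    · exact ⟨j + 1, by omega, le_rfl, hm⟩
    · obtain ⟨k, hk⟩ := ih (by rcases chain_succ_cases (a := a) (b := b) x η j with h' | h' <;> omega)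
      exact ⟨k, hk.1, by omega, hk.2.2⟩

lemma clock_mono {x : ℤ} {η : Noise} (hab : ∀ y, 0 < a y + b y) (hη : ∀ k, 0 ≤ (η k).2) :
    Monotone (clock a b x η) := by
  refine monotone_nat_of_le_succ fun n => ?_
  rw [clock_succ]
  have := div_nonneg (hη n) (hab (chain a b x η n)).le
  linarith

lemma clock_nonneg {x : ℤ} {η : Noise} (hab : ∀ y, 0 < a y + b y) (hη : ∀ k, 0 ≤ (η k).2) (n) :
    0 ≤ clock a b x η n := by
  simpa using clock_mono (x := x) hab hη (Nat.zero_le n)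

section Measurability

variable {Ω : Type*} [MeasurableSpace Ω]

lemma measurable_apply_int {F : Ω → ℤ → ℝ} {X : Ω → ℤ} (hF : ∀ x, Measurable fun ω => F ω x)
    (hX : Measurable X) : Measurable fun ω => F ω (X ω) := by
  have : Measurable fun p : Ω × ℤ => F p.1 p.2 :=
    measurable_from_prod_countable_left fun x => hF x
  exact this.comp (measurable_id.prodMk hX)

variable {α β : Ω → ℤ → ℝ} {ζ : Ω → Noise}

lemma measurable_chain (hα : ∀ x, Measurable fun ω => α ω x) (hβ : ∀ x, Measurable fun ω => β ω x)
    (hζ : Measurable ζ) (x : ℤ) (n : ℕ) :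
    Measurable fun ω => chain (α ω) (β ω) x (ζ ω) n := by
  induction n with
  | zero => exact measurable_const
  | succ n ih =>
    simp only [chain_succ]
    have hz : Measurable fun ω => (ζ ω n) := (measurable_pi_apply n).comp hζ
    have ha := measurable_apply_int hα ih
    have hb := measurable_apply_int hβ ih
    refine Measurable.ite (measurableSet_le ?_ ?_) ?_ ?_
    · exact measurable_subtype_coe.comp (measurable_fst.comp hz)
    · exact hb.div (ha.add hb)
    · exact ih.add_const 1
    · exact ih.sub_const 1

lemma measurable_clock (hα : ∀ x, Measurable fun ω => α ω x) (hβ : ∀ x, Measurable fun ω => β ω x)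
    (hζ : Measurable ζ) (x : ℤ) (n : ℕ) :
    Measurable fun ω => clock (α ω) (β ω) x (ζ ω) n := by
  refine Finset.measurable_sum _ fun k _ => ?_
  have hz : Measurable fun ω => (ζ ω k) := (measurable_pi_apply k).comp hζ
  have ih := measurable_chain hα hβ hζ x k
  exact (measurable_snd.comp hz).div
    ((measurable_apply_int hα ih).add (measurable_apply_int hβ ih))

lemma measurable_chain_noise (a b : ℤ → ℝ) (x : ℤ) (n : ℕ) :
    Measurable fun η : Noise => chain a b x η n :=
  measurable_chain (α := fun _ => a) (β := fun _ => b) (fun _ => measurable_const)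
    (fun _ => measurable_const) measurable_id x n

lemma measurable_clock_noise (a b : ℤ → ℝ) (x : ℤ) (n : ℕ) :
    Measurable fun η : Noise => clock a b x η n :=
  measurable_clock (α := fun _ => a) (β := fun _ => b) (fun _ => measurable_const)
    (fun _ => measurable_const) measurable_id x n

end Measurability

end BiasedWalk
end

noncomputable section
namespace BiasedWalk

open scoped ENNReal

/-! ### Quenched estimates for passage times -/

variable {a b : ℤ → ℝ}

lemma prod_Ico_succ_left {M : Type*} [CommMonoid M] (f : ℤ → M) {x n : ℤ} (h : x < n) :
    ∏ k ∈ Finset.Ico x n, f k = f x * ∏ k ∈ Finset.Ico (x + 1) n, f k := by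
  rw [← Finset.prod_insert (by simp)]
  congr 1
  ext k
  simp only [Finset.mem_Ico, Finset.mem_insert]
  omega

lemma sum_Ico_succ_left {M : Type*} [AddCommMonoid M] (f : ℤ → M) {x n : ℤ} (h : x < n) :
    ∑ k ∈ Finset.Ico x n, f k = f x + ∑ k ∈ Finset.Ico (x + 1) n, f k := by
  rw [← Finset.sum_insert (by simp)]
  congr 1
  ext k
  simp only [Finset.mem_Ico, Finset.mem_insert]
  omega

lemma measurableSet_visit_le (a b : ℤ → ℝ) (x n : ℤ) (k : ℕ) (t : ℝ) :
    MeasurableSet {η : Noise | chain a b x η k = n ∧ clock a b x η k ≤ t} :=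
  ((measurable_chain_noise a b x k) (measurableSet_singleton n)).inter
    (measurableSet_le (measurable_clock_noise a b x k) measurable_const)

lemma measurableSet_visit_before (a b : ℤ → ℝ) (x n : ℤ) (K : ℕ) (t : ℝ) :
    MeasurableSet {η : Noise | ∃ k ≤ K, chain a b x η k = n ∧ clock a b x η k ≤ t} := by
  have : {η : Noise | ∃ k ≤ K, chain a b x η k = n ∧ clock a b x η k ≤ t} =
      ⋃ k ∈ Finset.range (K + 1), {η : Noise | chain a b x η k = n ∧ clock a b x η k ≤ t} := by
    ext η
    simp only [Set.mem_ofPred_eq, Set.mem_iUnion, Finset.mem_range, Nat.lt_succ_iff, exists_prop]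
  rw [this]
  exact Finset.measurableSet_biUnion _ fun k _ => measurableSet_visit_le a b x n k t

lemma measurableSet_visit (a b : ℤ → ℝ) (x n : ℤ) (t : ℝ) :
    MeasurableSet {η : Noise | ∃ k, chain a b x η k = n ∧ clock a b x η k ≤ t} := by
  have : {η : Noise | ∃ k, chain a b x η k = n ∧ clock a b x η k ≤ t} =
      ⋃ k, {η : Noise | chain a b x η k = n ∧ clock a b x η k ≤ t} := by
    ext η
    simp
  rw [this]
  exact MeasurableSet.iUnion fun k => measurableSet_visit_le a b x n k t

/-- `1 - ψ` is a supersolution of the recursion satisfied by the Laplace transform at `s` of the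
passage time from a state to the next one. -/
structure IsLaplaceBound (a b : ℤ → ℝ) (s : ℝ) (ψ : ℤ → ℝ) : Prop where
  nonneg : ∀ x, 0 ≤ ψ x
  lt_one : ∀ x, ψ x < 1
  le : ∀ x, ψ x * (b x + s + a x * ψ (x - 1)) ≤ s + a x * ψ (x - 1)

/-- With `φ = 1 - ψ`, the bound on `ψ` says `b(x) + a(x) φ(x-1) φ(x) ≤ (a(x) + b(x) + s) φ(x)`, so
the right-hand side decreases on average over one jump. Capping the number of jumps at `K` allows an
induction on `K` with no boundary condition at `-∞`. -/
lemma noiseLaw_visit_before_le (ha : ∀ x, 0 < a x) (hb : ∀ x, 0 < b x) {s : ℝ} (hs : 0 ≤ s)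
    {ψ : ℤ → ℝ} (hψ : IsLaplaceBound a b s ψ) (n : ℤ) (K : ℕ) {x : ℤ} (hx : x ≤ n) (t : ℝ) :
    noiseLaw {η | ∃ k ≤ K, chain a b x η k = n ∧ clock a b x η k ≤ t} ≤
      ENNReal.ofReal (Real.exp (s * t) * ∏ k ∈ Finset.Ico x n, (1 - ψ k)) := by
  have hpos : ∀ y, 0 ≤ 1 - ψ y := fun y => by linarith [hψ.lt_one y]
  have htarget : ∀ (K : ℕ) (t : ℝ),
      noiseLaw {η | ∃ k ≤ K, chain a b n η k = n ∧ clock a b n η k ≤ t} ≤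
      ENNReal.ofReal (Real.exp (s * t) * ∏ k ∈ Finset.Ico n n, (1 - ψ k)) := by
    intro K t
    simp only [Finset.Ico_self, Finset.prod_empty, mul_one]
    rcases le_or_gt 0 t with ht | ht
    · refine prob_le_one.trans ?_
      rw [← ENNReal.ofReal_one]
      exact ENNReal.ofReal_le_ofReal (Real.one_le_exp (by positivity))
    -- For `t < 0` the event is null, since the clock is almost surely nonnegative.
    · refine le_of_eq_of_le ?_ zero_le
      rw [← compl_compl {η : Noise | _}]
      refine mem_ae_iff.1 ?_
      filter_upwards [ae_noiseLaw_nonneg] with η hη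
      rintro ⟨k, -, -, hk⟩
      have := clock_nonneg (x := n) (fun y => add_pos (ha y) (hb y)) hη k
      linarith
  induction K generalizing x t with
  | zero =>
    rcases hx.eq_or_lt with rfl | hx
    · exact htarget 0 t
    · refine le_of_eq_of_le ?_ zero_le
      convert measure_empty (μ := noiseLaw)
      ext η
      simp [hx.ne]
  | succ K ih =>
    rcases hx.eq_or_lt with rfl | hx
    · exact htarget _ t
    set R := a x + b x with hR
    have hR0 : 0 < R := add_pos (ha x) (hb x)
    set p := b x / R with hp
    have hp0 : 0 ≤ p := (div_pos (hb x) hR0).le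
    have hp1 : p ≤ 1 := by rw [hp, div_le_one hR0]; linarith [ha x]
    have hq : 1 - p = a x / R := by
      rw [hp, eq_div_iff hR0.ne', sub_mul, div_mul_cancel₀ _ hR0.ne']; linarith
    set F := ∏ k ∈ Finset.Ico (x + 1) n, (1 - ψ k) with hF
    have hF0 : 0 ≤ F := Finset.prod_nonneg fun k _ => hpos k
    have h1 : ∏ k ∈ Finset.Ico x n, (1 - ψ k) = (1 - ψ x) * F := prod_Ico_succ_left _ hx
    -- After a jump to the left both bonds `x - 1 → x` and `x → x + 1` must be crossed, which makes
    -- the recursion quadratic.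
    have h2 : ∏ k ∈ Finset.Ico (x - 1) n, (1 - ψ k) = (1 - ψ (x - 1)) * ((1 - ψ x) * F) := by
      rw [prod_Ico_succ_left _ (by omega), sub_add_cancel, h1]
    rw [noiseLaw_apply (measurableSet_visit_before a b x n (K + 1) t)]
    have hstep : ∀ e : unitInterval × ℝ,
        noiseLaw (consNoise e ⁻¹' {η | ∃ k ≤ K + 1, chain a b x η k = n ∧ clock a b x η k ≤ t}) ≤
        ENNReal.ofReal (Real.exp (s * t)) * (ENNReal.ofReal (Real.exp (-(s / R * e.2))) *
          (if (e.1 : ℝ) ≤ p then ENNReal.ofReal F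
            else ENNReal.ofReal ((1 - ψ (x - 1)) * ((1 - ψ x) * F)))) := by
      intro e
      have hset : consNoise e ⁻¹' {η | ∃ k ≤ K + 1, chain a b x η k = n ∧ clock a b x η k ≤ t} =
          {η | ∃ k ≤ K, chain a b (if (e.1 : ℝ) ≤ p then x + 1 else x - 1) η k = n ∧
            clock a b (if (e.1 : ℝ) ≤ p then x + 1 else x - 1) η k ≤ t - e.2 / R} := by
        ext η
        simp only [Set.mem_preimage, Set.mem_ofPred_eq]
        constructor
        · rintro ⟨k, hk, h3, h4⟩
          cases k with
          | zero => exact absurd h3 hx.ne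
          | succ k =>
            rw [chain_consNoise] at h3
            rw [clock_consNoise] at h4
            exact ⟨k, by omega, h3, by linarith⟩
        · rintro ⟨k, hk, h3, h4⟩
          refine ⟨k + 1, by omega, ?_, ?_⟩
          · rw [chain_consNoise]; exact h3
          · rw [clock_consNoise]; linarith
      rw [hset]
      have hexp : Real.exp (s * (t - e.2 / R)) = Real.exp (s * t) * Real.exp (-(s / R * e.2)) := by
        rw [← Real.exp_add]; congr 1; ring
      refine (ih (by split_ifs <;> omega) _).trans (le_of_eq ?_)
      rw [hexp, ENNReal.ofReal_mul (by positivity), ENNReal.ofReal_mul (by positivity), mul_assoc]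
      split_ifs
      · rfl
      · rw [h2]
    refine (lintegral_mono hstep).trans ?_
    have hmeas : Measurable fun e : unitInterval × ℝ =>
        (ENNReal.ofReal (Real.exp (-(s / R * e.2))) *
          (if (e.1 : ℝ) ≤ p then ENNReal.ofReal F
            else ENNReal.ofReal ((1 - ψ (x - 1)) * ((1 - ψ x) * F)))) := by
      refine Measurable.mul (by fun_prop) (Measurable.ite ?_ measurable_const measurable_const)
      exact measurableSet_le (measurable_subtype_coe.comp measurable_fst) measurable_const
    rw [lintegral_const_mul _ hmeas,
      lintegral_stepLaw_mul hp0 hp1 (h := fun w => ENNReal.ofReal (Real.exp (-(s / R * w))))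
        (by fun_prop),
      lintegral_exp_neg_expMeasure (by positivity)]
    have hneg : 0 ≤ (1 - ψ (x - 1)) * ((1 - ψ x) * F) :=
      mul_nonneg (hpos _) (mul_nonneg (hpos _) hF0)
    rw [← ENNReal.ofReal_mul hp0, ← ENNReal.ofReal_mul (by linarith),
      ← ENNReal.ofReal_add (by positivity) (mul_nonneg (by linarith) hneg),
      ← ENNReal.ofReal_mul (by positivity), ← ENNReal.ofReal_mul (by positivity), h1]
    refine ENNReal.ofReal_le_ofReal (mul_le_mul_of_nonneg_left ?_ (Real.exp_pos _).le)
    rw [hq, hp]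
    have key : b x + a x * ((1 - ψ (x - 1)) * (1 - ψ x)) ≤ (1 - ψ x) * (R + s) := by
      have := hψ.le x
      rw [hR]; nlinarith
    have e1 : 1 / (1 + s / R) * (b x / R * F + a x / R * ((1 - ψ (x - 1)) * ((1 - ψ x) * F))) =
        (b x + a x * ((1 - ψ (x - 1)) * (1 - ψ x))) / (R + s) * F := by
      field_simp
    rw [e1]
    refine mul_le_mul_of_nonneg_right ?_ hF0
    rw [div_le_iff₀ (by linarith)]
    exact key

/-- A Chernoff bound for the passage time from `x` to `n`. -/
lemma noiseLaw_visit_le (ha : ∀ x, 0 < a x) (hb : ∀ x, 0 < b x) {s : ℝ} (hs : 0 ≤ s)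
    {ψ : ℤ → ℝ} (hψ : IsLaplaceBound a b s ψ) {x n : ℤ} (hx : x ≤ n) (t : ℝ) :
    noiseLaw {η | ∃ k, chain a b x η k = n ∧ clock a b x η k ≤ t} ≤
      ENNReal.ofReal (Real.exp (s * t - ∑ k ∈ Finset.Ico x n, ψ k)) := by
  have hU : {η : Noise | ∃ k, chain a b x η k = n ∧ clock a b x η k ≤ t} =
      ⋃ K : ℕ, {η : Noise | ∃ k ≤ K, chain a b x η k = n ∧ clock a b x η k ≤ t} := by
    ext η
    simp only [Set.mem_ofPred_eq, Set.mem_iUnion]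
    exact ⟨fun ⟨k, h⟩ => ⟨k, k, le_rfl, h⟩, fun ⟨_, k, _, h⟩ => ⟨k, h⟩⟩
  have hmono : Monotone fun K : ℕ =>
      {η : Noise | ∃ k ≤ K, chain a b x η k = n ∧ clock a b x η k ≤ t} := by
    rintro K L hKL η ⟨k, hk, h⟩
    exact ⟨k, hk.trans hKL, h⟩
  rw [hU, hmono.measure_iUnion]
  refine iSup_le fun K => (noiseLaw_visit_before_le ha hb hs hψ n K hx t).trans ?_
  refine ENNReal.ofReal_le_ofReal ?_
  rw [sub_eq_add_neg, Real.exp_add]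
  refine mul_le_mul_of_nonneg_left ?_ (Real.exp_pos _).le
  rw [← Finset.sum_neg_distrib, Real.exp_sum]
  refine Finset.prod_le_prod (fun k _ => by linarith [hψ.lt_one k]) fun k _ => ?_
  have := Real.add_one_le_exp (-ψ k)
  linarith

/-! ### Iterates of the passage-time recursions -/

/-- Iterates of the recursion for the Laplace transform of the passage time from `x` to
`x + 1`, started at `1`; these are one minus the iterates. -/
def laplaceIter (a b : ℤ → ℝ) (s : ℝ) : ℕ → ℤ → ℝ
  | 0, _ => 0
  | j + 1, x => (s + a x * laplaceIter a b s j (x - 1)) /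
      (b x + s + a x * laplaceIter a b s j (x - 1))

/-- Iterates of the recursion for the mean passage time from `x` to `x + 1`, started at `0`. -/
def meanIter (a b : ℤ → ℝ) : ℕ → ℤ → ℝ
  | 0, _ => 0
  | j + 1, x => (1 + a x * meanIter a b j (x - 1)) / b x

lemma meanIter_nonneg (ha : ∀ x, 0 < a x) (hb : ∀ x, 0 < b x) (j : ℕ) (x : ℤ) :
    0 ≤ meanIter a b j x := by
  induction j generalizing x with
  | zero => exact le_rfl
  | succ j ih =>
    have := ih (x - 1); have := ha x; have := hb x
    simp only [meanIter]; positivity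

lemma meanIter_mono (ha : ∀ x, 0 < a x) (hb : ∀ x, 0 < b x) (j : ℕ) (x : ℤ) :
    meanIter a b j x ≤ meanIter a b (j + 1) x := by
  induction j generalizing x with
  | zero => exact meanIter_nonneg ha hb 1 x
  | succ j ih =>
    have := ha x; have := hb x; have := ih (x - 1)
    rw [meanIter, meanIter]
    gcongr

lemma laplaceIter_nonneg (ha : ∀ x, 0 < a x) (hb : ∀ x, 0 < b x) {s : ℝ} (hs : 0 ≤ s) (j : ℕ)
    (x : ℤ) : 0 ≤ laplaceIter a b s j x := by
  induction j generalizing x with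
  | zero => exact le_rfl
  | succ j ih =>
    have := ih (x - 1); have := ha x; have := hb x
    simp only [laplaceIter]; positivity

lemma laplaceIter_mono (ha : ∀ x, 0 < a x) (hb : ∀ x, 0 < b x) {s : ℝ} (hs : 0 ≤ s) (j : ℕ)
    (x : ℤ) : laplaceIter a b s j x ≤ laplaceIter a b s (j + 1) x := by
  induction j generalizing x with
  | zero => exact laplaceIter_nonneg ha hb hs 1 x
  | succ j ih =>
    have h1 := ha x; have h2 := hb x; have h3 := ih (x - 1)
    have h4 := laplaceIter_nonneg ha hb hs j (x - 1)
    have h5 := laplaceIter_nonneg ha hb hs (j + 1) (x - 1)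
    rw [laplaceIter, laplaceIter, div_le_div_iff₀ (by positivity) (by positivity)]
    have : a x * laplaceIter a b s j (x - 1) ≤ a x * laplaceIter a b s (j + 1) (x - 1) := by
      gcongr
    nlinarith

/-- The recursion is a monotone map started at its lower bound `0`, so each iterate is at most its
image, which is the inequality required. A finite iterate suffices; no fixed point is needed. -/
lemma isLaplaceBound_laplaceIter (ha : ∀ x, 0 < a x) (hb : ∀ x, 0 < b x) {s : ℝ} (hs : 0 ≤ s)
    (j : ℕ) : IsLaplaceBound a b s (laplaceIter a b s j) := by
  refine ⟨laplaceIter_nonneg ha hb hs j, fun x => ?_, fun x => ?_⟩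
  · cases j with
    | zero => exact zero_lt_one
    | succ j =>
      have h1 := ha x; have h2 := hb x; have h4 := laplaceIter_nonneg ha hb hs j (x - 1)
      rw [laplaceIter, div_lt_one (by positivity)]
      linarith
  · have h1 := ha x; have h2 := hb x; have h4 := laplaceIter_nonneg ha hb hs j (x - 1)
    rw [← le_div_iff₀ (by positivity)]
    exact laplaceIter_mono ha hb hs j x

/-- The derivative at `s = 0` of the Laplace recursion is the recursion for the mean: divide the
numerator by `s`, while the denominator tends to `b x`. -/
lemma tendsto_laplaceIter_div (ha : ∀ x, 0 < a x) (hb : ∀ x, 0 < b x) (j : ℕ) (x : ℤ) :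
    Tendsto (fun s => laplaceIter a b s j x) (𝓝[>] 0) (𝓝 0) ∧
    Tendsto (fun s => laplaceIter a b s j x / s) (𝓝[>] 0) (𝓝 (meanIter a b j x)) := by
  induction j generalizing x with
  | zero => simp [laplaceIter, meanIter]
  | succ j ih =>
    obtain ⟨h1, h2⟩ := ih (x - 1)
    have hid : Tendsto (fun s : ℝ => s) (𝓝[>] 0) (𝓝 0) := tendsto_nhdsWithin_of_tendsto_nhds tendsto_id
    have hden : Tendsto (fun s => b x + s + a x * laplaceIter a b s j (x - 1)) (𝓝[>] 0)
        (𝓝 (b x)) := by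
      simpa using ((tendsto_const_nhds (x := b x)).add hid).add (h1.const_mul (a x))
    have hnum : Tendsto (fun s => 1 + a x * (laplaceIter a b s j (x - 1) / s)) (𝓝[>] 0)
        (𝓝 (1 + a x * meanIter a b j (x - 1))) := (h2.const_mul (a x)).const_add 1
    have hdiv : Tendsto (fun s => laplaceIter a b s (j + 1) x / s) (𝓝[>] 0)
        (𝓝 (meanIter a b (j + 1) x)) := by
      refine (hnum.div hden (hb x).ne').congr' ?_
      filter_upwards [self_mem_nhdsWithin] with s (hs : 0 < s)
      have h3 := ha x; have h4 := hb x; have h5 := laplaceIter_nonneg ha hb hs.le j (x - 1)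
      rw [laplaceIter]
      simp only [Pi.div_apply]
      field_simp
    refine ⟨?_, hdiv⟩
    have := hdiv.mul hid
    rw [mul_zero] at this
    refine this.congr' ?_
    filter_upwards [self_mem_nhdsWithin] with s (hs : 0 < s)
    field_simp

/-! ### Truncated passage times and their means -/

/-- The time of the `K`-th jump or of the passage at `1`, whichever comes first. -/
def passageClock (a b : ℤ → ℝ) (x : ℤ) (η : Noise) (K : ℕ) : ℝ≥0∞ :=
  ∑ k ∈ Finset.range K, if ∀ i ≤ k, chain a b x η i ≠ 1 then
    ENNReal.ofReal ((η k).2 / (a (chain a b x η k) + b (chain a b x η k))) else 0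

lemma measurable_passageClock {Ω : Type*} [MeasurableSpace Ω] {α β : Ω → ℤ → ℝ} {ζ : Ω → Noise}
    (hα : ∀ x, Measurable fun ω => α ω x) (hβ : ∀ x, Measurable fun ω => β ω x)
    (hζ : Measurable ζ) (x : ℤ) (K : ℕ) :
    Measurable fun ω => passageClock (α ω) (β ω) x (ζ ω) K := by
  refine Finset.measurable_sum _ fun k _ => ?_
  have hz : Measurable fun ω => (ζ ω k) := (measurable_pi_apply k).comp hζ
  have ih := measurable_chain hα hβ hζ x k
  refine Measurable.ite ?_ ?_ measurable_const
  · have : {ω | ∀ i ≤ k, chain (α ω) (β ω) x (ζ ω) i ≠ 1} =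
        ⋂ i ∈ Finset.range (k + 1), {ω | chain (α ω) (β ω) x (ζ ω) i = 1}ᶜ := by
      ext ω
      simp
    rw [this]
    exact Finset.measurableSet_biInter _ fun i _ =>
      ((measurable_chain hα hβ hζ x i) (measurableSet_singleton 1)).compl
  · exact ((measurable_snd.comp hz).div
      ((measurable_apply_int hα ih).add (measurable_apply_int hβ ih))).ennreal_ofReal

lemma passageClock_consNoise {x : ℤ} (hx : x ≠ 1) (e η K) :
    passageClock a b x (consNoise e η) (K + 1) = ENNReal.ofReal (e.2 / (a x + b x)) +
      passageClock a b (if (e.1 : ℝ) ≤ b x / (a x + b x) then x + 1 else x - 1) η K := by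
  unfold passageClock
  rw [Finset.sum_range_succ', add_comm]
  congr 1
  · simp [hx]
  · refine Finset.sum_congr rfl fun k _ => ?_
    rw [chain_consNoise, consNoise_succ]
    congr 1
    refine propext ⟨fun h i hi => ?_, fun h i hi => ?_⟩
    · rw [← chain_consNoise]; exact h (i + 1) (by omega)
    · cases i with
      | zero => exact hx
      | succ i => rw [chain_consNoise]; exact h i (by omega)

/-- Induction on the number of jumps by first-step analysis. It yields only an inequality, because
`K` iterates of the recursion bound `K` jumps of the walk; the reverse bound comes later, from the
Chernoff estimate. -/
lemma lintegral_passageClock_le (ha : ∀ x, 0 < a x) (hb : ∀ x, 0 < b x) (K : ℕ) {x : ℤ}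
    (hx : x ≤ 1) :
    ∫⁻ η, passageClock a b x η K ∂noiseLaw ≤
      ENNReal.ofReal (∑ k ∈ Finset.Ico x 1, meanIter a b K k) := by
  induction K generalizing x with
  | zero => simp [passageClock]
  | succ K ih =>
    rcases hx.eq_or_lt with rfl | hx
    · have : ∀ η, passageClock a b 1 η (K + 1) = 0 := fun η =>
        Finset.sum_eq_zero fun k _ => if_neg fun h => h 0 (Nat.zero_le k) rfl
      simp [this]
    set R := a x + b x with hR
    have hR0 : 0 < R := add_pos (ha x) (hb x)
    set p := b x / R with hp
    have hp0 : 0 ≤ p := (div_pos (hb x) hR0).le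
    have hp1 : p ≤ 1 := by rw [hp, div_le_one hR0]; linarith [ha x]
    have hq : 1 - p = a x / R := by
      rw [hp, eq_div_iff hR0.ne', sub_mul, div_mul_cancel₀ _ hR0.ne']; linarith
    have hmp : ∀ y L, Measurable fun η => passageClock a b y η L := fun y L =>
      measurable_passageClock (α := fun _ => a) (β := fun _ => b) (fun _ => measurable_const)
        (fun _ => measurable_const) measurable_id y L
    rw [lintegral_noiseLaw (hmp x (K + 1))]
    set g : ℤ → ℝ := fun y => ∑ k ∈ Finset.Ico y 1, meanIter a b K k with hg
    have hg0 : ∀ y, 0 ≤ g y := fun y => Finset.sum_nonneg fun k _ => meanIter_nonneg ha hb K k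
    have hstep : ∀ e : unitInterval × ℝ,
        ∫⁻ η, passageClock a b x (consNoise e η) (K + 1) ∂noiseLaw ≤
        ENNReal.ofReal (1 / R) * (ENNReal.ofReal e.2 * (if (e.1 : ℝ) ≤ p then 1 else 1)) +
        1 * (if (e.1 : ℝ) ≤ p then ENNReal.ofReal (g (x + 1)) else ENNReal.ofReal (g (x - 1))) := by
      intro e
      simp_rw [passageClock_consNoise hx.ne]
      rw [lintegral_add_left measurable_const, lintegral_const, measure_univ, mul_one, one_mul]
      refine add_le_add (le_of_eq ?_) ((ih (by split_ifs <;> omega)).trans (le_of_eq ?_))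
      · rw [ite_self, mul_one, ← ENNReal.ofReal_mul (by positivity)]
        congr 1; ring
      · split_ifs <;> rfl
    refine (lintegral_mono hstep).trans ?_
    rw [lintegral_add_left (by simp only [ite_self]; fun_prop),
      lintegral_const_mul _ (by simp only [ite_self]; fun_prop),
      lintegral_stepLaw_mul hp0 hp1 (h := fun w => ENNReal.ofReal w) (by fun_prop),
      lintegral_stepLaw_mul hp0 hp1 (h := fun _ => 1) measurable_const,
      lintegral_id_expMeasure, lintegral_const, measure_univ]
    have hq0 : 0 ≤ 1 - p := by linarith
    have hsum : ENNReal.ofReal p + ENNReal.ofReal (1 - p) = 1 := by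
      rw [← ENNReal.ofReal_add hp0 hq0]; simp
    rw [mul_one, mul_one, hsum, mul_one, one_mul, mul_one, ← ENNReal.ofReal_mul hp0,
      ← ENNReal.ofReal_mul hq0,
      ← ENNReal.ofReal_add (mul_nonneg hp0 (hg0 _)) (mul_nonneg hq0 (hg0 _)),
      ← ENNReal.ofReal_add (by positivity)
        (add_nonneg (mul_nonneg hp0 (hg0 _)) (mul_nonneg hq0 (hg0 _)))]
    refine ENNReal.ofReal_le_ofReal ?_
    -- A jump to the left costs the means of the two bonds out of `x - 1` and `x`.
    have h2 : g (x - 1) = meanIter a b K (x - 1) + (meanIter a b K x + g (x + 1)) := by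
      rw [hg]; simp only
      rw [sum_Ico_succ_left _ (by omega), sub_add_cancel, sum_Ico_succ_left _ hx]
    have h3 : meanIter a b (K + 1) x + g (x + 1) ≤ ∑ k ∈ Finset.Ico x 1, meanIter a b (K + 1) k := by
      rw [sum_Ico_succ_left _ hx]
      exact add_le_add le_rfl (Finset.sum_le_sum fun k _ => meanIter_mono ha hb K k)
    refine le_trans ?_ h3
    have h4 : meanIter a b (K + 1) x * b x = 1 + a x * meanIter a b K (x - 1) := by
      rw [meanIter, div_mul_cancel₀ _ (hb x).ne']
    have h5 : meanIter a b K x ≤ meanIter a b (K + 1) x := meanIter_mono ha hb K x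
    have h6 : 1 / R + (p * g (x + 1) + (1 - p) * g (x - 1)) =
        g (x + 1) + (1 + a x * meanIter a b K (x - 1) + a x * meanIter a b K x) / R := by
      rw [h2, show p * g (x + 1) + (1 - p) * (meanIter a b K (x - 1) + (meanIter a b K x +
        g (x + 1))) = g (x + 1) + (1 - p) * (meanIter a b K (x - 1) + meanIter a b K x) by ring, hq]
      ring
    rw [h6, ← h4]
    have h7 : (meanIter a b (K + 1) x * b x + a x * meanIter a b K x) / R ≤
        meanIter a b (K + 1) x := by
      rw [div_le_iff₀ hR0, hR]
      nlinarith [ha x]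
    linarith

/-! ### Recrossing after backtracking -/

/-- The walk from `0` is unlikely to move fast from `m` to `n + 1` after it has
visited `n` and then `m`. -/
lemma noiseLaw_recross_le (ha : ∀ x, 0 < a x) (hb : ∀ x, 0 < b x) {s : ℝ} (hs : 0 ≤ s)
    {ψ : ℤ → ℝ} (hψ : IsLaplaceBound a b s ψ) {m n : ℤ} (hmn : m ≤ n) (t : ℝ) :
    noiseLaw {η | ∃ i j k, (∀ l < i, chain a b 0 η l ≠ n) ∧ chain a b 0 η i = n ∧
        i ≤ j ∧ (∀ l, i ≤ l → l < j → chain a b 0 η l ≠ m) ∧ chain a b 0 η j = m ∧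
        j ≤ k ∧ chain a b 0 η k = n + 1 ∧ clock a b 0 η k - clock a b 0 η j ≤ t} ≤
      ENNReal.ofReal (Real.exp (s * t - ∑ k ∈ Finset.Ico m (n + 1), ψ k)) := by
  -- `A j` says that `j` is the first visit to `m` after the first visit to `n`. Such a `j` is a
  -- stopping time, so these events are disjoint and determined by the past, and the strong Markov
  -- property restarts the walk at `m`.
  set A : ℕ → Set Noise := fun j => {η | ∃ i ≤ j, (∀ l < i, chain a b 0 η l ≠ n) ∧
    chain a b 0 η i = n ∧ (∀ l < j, i ≤ l → chain a b 0 η l ≠ m) ∧ chain a b 0 η j = m} with hAdef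
  set B : Set Noise := {η | ∃ k, chain a b m η k = n + 1 ∧ clock a b m η k ≤ t} with hBdef
  have hA : ∀ j, MeasurableSet (A j) := by
    intro j
    have hm : ∀ (y : ℤ) (l : ℕ), MeasurableSet {η : Noise | chain a b 0 η l = y} := fun y l =>
      measurable_chain_noise a b 0 l (measurableSet_singleton y)
    have : A j = ⋃ i ∈ Finset.range (j + 1),
        (⋂ l ∈ Finset.range i, {η : Noise | chain a b 0 η l = n}ᶜ) ∩
        {η : Noise | chain a b 0 η i = n} ∩
        (⋂ l ∈ (Finset.range j).filter (i ≤ ·), {η : Noise | chain a b 0 η l = m}ᶜ) ∩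
        {η : Noise | chain a b 0 η j = m} := by
      ext η
      simp only [hAdef, Set.mem_ofPred_eq, Set.mem_iUnion, Finset.mem_range, Nat.lt_succ_iff,
        exists_prop, Set.mem_inter_iff, Set.mem_iInter, Set.mem_compl_iff, Finset.mem_filter,
        and_assoc, and_imp, ne_eq]
    rw [this]
    refine Finset.measurableSet_biUnion _ fun i _ => ?_
    exact (((Finset.measurableSet_biInter _ fun l _ => (hm n l).compl).inter (hm n i)).inter
      (Finset.measurableSet_biInter _ fun l _ => (hm m l).compl)).inter (hm m j)
  have hdep : ∀ j, ∀ η η' : Noise, (∀ i < j, η i = η' i) → η ∈ A j → η' ∈ A j := by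
    rintro j η η' h ⟨i, hij, h1, h2, h3, h4⟩
    have hc : ∀ k ≤ j, chain a b 0 η k = chain a b 0 η' k := fun k hk => chain_congr h hk
    refine ⟨i, hij, fun l hl => ?_, ?_, fun l hl hil => ?_, ?_⟩
    · rw [← hc l (by omega)]; exact h1 l hl
    · rw [← hc i hij]; exact h2
    · rw [← hc l hl.le]; exact h3 l hl hil
    · rw [← hc j le_rfl]; exact h4
  have hdisj : Pairwise (Function.onFun Disjoint A) := by
    intro j j' hjj'
    refine Set.disjoint_left.2 ?_
    rintro η ⟨i, hij, h1, h2, h3, h4⟩ ⟨i', hij', h1', h2', h3', h4'⟩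
    have : i = i' := by
      rcases lt_trichotomy i i' with h | h | h
      · exact absurd h2 (h1' _ h)
      · exact h
      · exact absurd h2' (h1 _ h)
    subst this
    rcases lt_or_gt_of_ne hjj' with h | h
    · exact h3' j h hij h4
    · exact h3 j' h hij' h4'
  have hB : MeasurableSet B := measurableSet_visit a b m (n + 1) t
  have hsub : {η | ∃ i j k, (∀ l < i, chain a b 0 η l ≠ n) ∧ chain a b 0 η i = n ∧
        i ≤ j ∧ (∀ l, i ≤ l → l < j → chain a b 0 η l ≠ m) ∧ chain a b 0 η j = m ∧
        j ≤ k ∧ chain a b 0 η k = n + 1 ∧ clock a b 0 η k - clock a b 0 η j ≤ t} ⊆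
      ⋃ j, A j ∩ shiftNoise j ⁻¹' B := by
    rintro η ⟨i, j, k, h1, h2, hij, h3, h4, hjk, h5, h6⟩
    obtain ⟨k, rfl⟩ := Nat.exists_eq_add_of_le hjk
    refine Set.mem_iUnion.2 ⟨j, ⟨i, hij, h1, h2, fun l hl hil => h3 l hil hl, h4⟩, k, ?_, ?_⟩
    · rw [chain_add, h4] at h5; exact h5
    · rw [clock_add, h4] at h6; linarith
  refine (measure_mono hsub).trans ?_
  rw [noiseLaw_iUnion_inter_shiftNoise hA hdisj hdep hB]
  refine (mul_le_of_le_one_left' prob_le_one).trans ?_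
  exact noiseLaw_visit_le ha hb hs hψ (by omega) t

end BiasedWalk
end

noncomputable section
namespace BiasedWalk

open scoped ENNReal

/-! ### Ergodic theorems -/

section Orbits

variable {α : Type*} {T : α → α} {f : α → ℝ}

lemma birkhoffSum_nonneg (h0 : ∀ x, 0 ≤ f x) (n : ℕ) (x : α) : 0 ≤ birkhoffSum T f n x :=
  Finset.sum_nonneg fun _ _ => h0 _

lemma le_iterate_of_le {h : α → ℝ} (hinv : ∀ x, h x ≤ h (T x)) (n : ℕ) (x : α) :
    h x ≤ h (T^[n] x) := by
  induction n with
  | zero => exact le_rfl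
  | succ n ih => rw [Function.iterate_succ_apply']; exact ih.trans (hinv _)

/-- Splitting an orbit into blocks along which the averages of `f` are at least `h`. -/
lemma sub_mul_le_birkhoffSum (h0 : ∀ x, 0 ≤ f x) {h : α → ℝ} (hh0 : ∀ x, 0 ≤ h x)
    (hinv : ∀ x, h x ≤ h (T x)) {L : ℕ}
    (hex : ∀ x, ∃ n, 1 ≤ n ∧ n ≤ L ∧ n * h x ≤ birkhoffSum T f n x) (K : ℕ) (x : α) :
    ((K : ℝ) - L) * h x ≤ birkhoffSum T f K x := by
  induction K using Nat.strong_induction_on generalizing x with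
  | _ K ih =>
    rcases le_or_gt K L with hK | hK
    · refine (mul_nonpos_of_nonpos_of_nonneg ?_ (hh0 x)).trans (birkhoffSum_nonneg h0 K x)
      have : (K : ℝ) ≤ L := by exact_mod_cast hK
      linarith
    -- Cut off a first block of length at most `L` and continue from its end, where `h` has not
    -- decreased. The last incomplete block, of length at most `L`, is discarded using `f ≥ 0`.
    · obtain ⟨n, hn1, hnL, hn⟩ := hex x
      obtain ⟨m, rfl⟩ := Nat.exists_eq_add_of_le (hnL.trans hK.le)
      rw [birkhoffSum_add]
      have h1 := ih m (by omega) (T^[n] x)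
      have h2 := birkhoffSum_nonneg (T := T) h0 m (T^[n] x)
      have h3 := le_iterate_of_le hinv n x
      have h4 := hh0 x
      push_cast
      rcases le_total (m : ℝ) L with hm | hm
      · nlinarith
      · nlinarith

/-- The set where the upper limit of the averages is above `c`. -/
def upperSet (T : α → α) (f : α → ℝ) (c : ℝ) : Set α :=
  {x | ∃ q : ℚ, c < q ∧ ∃ᶠ n : ℕ in atTop, q * n ≤ birkhoffSum T f n x}

/-- The set where the lower limit of the averages is above `c`. -/
def lowerSet (T : α → α) (f : α → ℝ) (c : ℝ) : Set α :=
  {x | ∃ q : ℚ, c < q ∧ ∀ᶠ n : ℕ in atTop, q * n ≤ birkhoffSum T f n x}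

lemma birkhoffSum_map (n : ℕ) (x : α) :
    birkhoffSum T f n (T x) = birkhoffSum T f (n + 1) x - f x := by
  rw [birkhoffSum_succ']; ring

/-- Passing to `T x` loses the single term `f x`, which is absorbed for large `n` by lowering `q` to
some `r` still above `c`. The strict gap in `upperSet` and `lowerSet` thus makes them invariant. -/
lemma eventually_mul_le_birkhoffSum_map {c : ℝ} {q : ℚ} (hq : c < q) (x : α) :
    ∃ r : ℚ, c < r ∧ ∀ᶠ n : ℕ in atTop, (q * (n + 1 : ℕ) ≤ birkhoffSum T f (n + 1) x →
      r * n ≤ birkhoffSum T f n (T x)) := by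
  obtain ⟨r, hr1, hr2⟩ := exists_rat_btwn hq
  refine ⟨r, hr1, ?_⟩
  obtain ⟨N, hN⟩ := exists_nat_gt ((f x - q) / (q - r))
  filter_upwards [eventually_ge_atTop N] with n hn h
  rw [birkhoffSum_map]
  have hn' : (N : ℝ) ≤ n := by exact_mod_cast hn
  have := hN.trans_le hn'
  rw [div_lt_iff₀ (by linarith)] at this
  push_cast at h
  nlinarith

lemma map_mem_upperSet {c : ℝ} {x : α} (hx : x ∈ upperSet T f c) : T x ∈ upperSet T f c := by
  obtain ⟨q, hq, hfr⟩ := hx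
  obtain ⟨r, hr, hev⟩ := eventually_mul_le_birkhoffSum_map (T := T) (f := f) hq x
  refine ⟨r, hr, ?_⟩
  have hfr' : ∃ᶠ n : ℕ in atTop, q * (n + 1 : ℕ) ≤ birkhoffSum T f (n + 1) x := by
    rw [frequently_atTop] at hfr ⊢
    intro N
    obtain ⟨n, hn, h⟩ := hfr (N + 1)
    obtain ⟨m, rfl⟩ := Nat.exists_eq_add_of_le' (show 1 ≤ n by omega)
    exact ⟨m, by omega, h⟩
  exact (hfr'.and_eventually hev).mono fun n hn => hn.2 hn.1

lemma map_mem_lowerSet {c : ℝ} {x : α} (hx : x ∈ lowerSet T f c) : T x ∈ lowerSet T f c := by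
  obtain ⟨q, hq, hfr⟩ := hx
  obtain ⟨r, hr, hev⟩ := eventually_mul_le_birkhoffSum_map (T := T) (f := f) hq x
  refine ⟨r, hr, ?_⟩
  filter_upwards [hev, (tendsto_add_atTop_nat 1).eventually hfr] with n h1 h2 using h1 h2

lemma exists_of_mem_upperSet {c : ℝ} {x : α} (hx : x ∈ upperSet T f c) :
    ∃ n : ℕ, 1 ≤ n ∧ n * c ≤ birkhoffSum T f n x := by
  obtain ⟨q, hq, hfr⟩ := hx
  obtain ⟨n, h1, h2⟩ := (hfr.and_eventually (eventually_ge_atTop 1)).exists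
  refine ⟨n, h2, le_trans ?_ h1⟩
  have : (0 : ℝ) ≤ n := n.cast_nonneg
  nlinarith

lemma lowerSet_subset_upperSet (c : ℝ) : lowerSet T f c ⊆ upperSet T f c :=
  fun _ ⟨q, hq, h⟩ => ⟨q, hq, h.frequently⟩

end Orbits

section Ergodic

variable {α : Type*} [MeasurableSpace α] {μ : Measure α} {T : α → α} {f : α → ℝ}

lemma measurable_birkhoffSum (hT : Measurable T) (hf : Measurable f) (n : ℕ) :
    Measurable (birkhoffSum T f n) :=
  Finset.measurable_sum _ fun k _ => hf.comp (hT.iterate k)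

lemma integral_birkhoffSum (hT : MeasurePreserving T μ μ) (hf : Integrable f μ) (n : ℕ) :
    Integrable (birkhoffSum T f n) μ ∧ ∫ x, birkhoffSum T f n x ∂μ = n * ∫ x, f x ∂μ := by
  have hi : ∀ k, Integrable (fun x => f (T^[k] x)) μ := fun k =>
    (hT.iterate k).integrable_comp_of_integrable hf
  refine ⟨integrable_finsetSum _ fun k _ => hi k, ?_⟩
  unfold birkhoffSum
  rw [integral_finsetSum _ fun k _ => hi k]
  have : ∀ k ∈ Finset.range n, ∫ x, f (T^[k] x) ∂μ = ∫ x, f x ∂μ := by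
    intro k _
    have hk := (hT.iterate k)
    rw [← integral_map (φ := T^[k]) (f := f) hk.measurable.aemeasurable
      (by rw [hk.map_eq]; exact hf.1), hk.map_eq]
  rw [Finset.sum_congr rfl this]
  simp

/-! ### The maximal inequality and its consequences -/

variable [IsProbabilityMeasure μ]

/-- A form of the maximal ergodic theorem. -/
lemma integral_le_of_exists_mul_le_birkhoffSum (hT : MeasurePreserving T μ μ)
    (hfm : Measurable f) (hf : Integrable f μ) (h0 : ∀ x, 0 ≤ f x) {h : α → ℝ}
    (hh : Measurable h) (hh0 : ∀ x, 0 ≤ h x) {M : ℝ} (hM : ∀ x, h x ≤ M)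
    (hinv : ∀ x, h x ≤ h (T x))
    (hex : ∀ x, ∃ n, 1 ≤ n ∧ n * h x ≤ birkhoffSum T f n x) :
    ∫ x, h x ∂μ ≤ ∫ x, f x ∂μ := by
  have hM0 : ∀ x, 0 ≤ M := fun x => (hh0 x).trans (hM x)
  set E : ℕ → Set α := fun L => {x | ∃ n, 1 ≤ n ∧ n ≤ L + 1 ∧ n * h x ≤ birkhoffSum T f n x}
    with hE
  have hEm : ∀ L, MeasurableSet (E L) := by
    intro L
    have : E L = ⋃ n ∈ Finset.Icc 1 (L + 1), {x | n * h x ≤ birkhoffSum T f n x} := by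
      ext x
      simp only [hE, Set.mem_ofPred_eq, Set.mem_iUnion, Finset.mem_Icc, exists_prop, and_assoc]
    rw [this]
    exact Finset.measurableSet_biUnion _ fun n _ =>
      measurableSet_le (hh.const_mul _) (measurable_birkhoffSum hT.measurable hfm n)
  have hhi : Integrable h μ := by
    refine Integrable.of_bound hh.aestronglyMeasurable M (Eventually.of_forall fun x => ?_)
    rw [Real.norm_of_nonneg (hh0 x)]
    exact hM x
  have key : ∀ L, ∫ x, h x ∂μ ≤ ∫ x, f x ∂μ + M * μ.real (E L)ᶜ := by
    intro L
    -- Where no block of length at most `L + 1` is good, adding `M ≥ h` makes the block of length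
    -- one good. The blocks of `g` are then uniformly bounded.
    set g : α → ℝ := fun x => f x + (E L)ᶜ.indicator (fun _ => M) x with hg
    have hind : ∀ x, 0 ≤ (E L)ᶜ.indicator (fun _ => M) x := fun x =>
      Set.indicator_nonneg (fun x _ => hM0 x) x
    have hii : Integrable ((E L)ᶜ.indicator (fun _ => M)) μ :=
      (integrable_const M).indicator (hEm L).compl
    have hgi : Integrable g μ := hf.add hii
    have hgint : ∫ x, g x ∂μ = ∫ x, f x ∂μ + M * μ.real (E L)ᶜ := by
      rw [hg, integral_add hf hii, integral_indicator (hEm L).compl]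
      simp [mul_comm]
    have hg0 : ∀ x, 0 ≤ g x := fun x => add_nonneg (h0 x) (hind x)
    have hblock : ∀ x, ∃ n, 1 ≤ n ∧ n ≤ L + 1 ∧ n * h x ≤ birkhoffSum T g n x := by
      intro x
      by_cases hx : x ∈ E L
      · obtain ⟨n, h1, h2, h3⟩ := hx
        refine ⟨n, h1, h2, h3.trans (Finset.sum_le_sum fun k _ => ?_)⟩
        simp only [hg]
        linarith [hind (T^[k] x)]
      · refine ⟨1, le_rfl, by omega, ?_⟩
        rw [birkhoffSum_one]
        simp only [hg, Set.indicator_of_mem (show x ∈ (E L)ᶜ from hx), Nat.cast_one, one_mul]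
        linarith [h0 x, hM x]
    rw [← hgint]
    -- Integrating the block bound over an orbit of length `K` leaves a boundary error independent
    -- of `K`, so `K → ∞` gives `∫ h ≤ ∫ g`.
    have hbound : ∀ K : ℕ, ((K : ℝ) - (L + 1 : ℕ)) * ∫ x, h x ∂μ ≤ K * ∫ x, g x ∂μ := by
      intro K
      rw [← (integral_birkhoffSum hT hgi K).2, ← integral_const_mul]
      exact integral_mono (hhi.const_mul _) (integral_birkhoffSum hT hgi K).1
        (sub_mul_le_birkhoffSum hg0 hh0 hinv hblock K)
    by_contra hlt
    push Not at hlt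
    obtain ⟨K, hK⟩ := exists_nat_gt
      (((L + 1 : ℕ) * ∫ x, h x ∂μ) / (∫ x, h x ∂μ - ∫ x, g x ∂μ))
    rw [div_lt_iff₀ (by linarith)] at hK
    have := hbound K
    nlinarith
  have hlim : Tendsto (fun L => ∫ x, f x ∂μ + M * μ.real (E L)ᶜ) atTop
      (𝓝 (∫ x, f x ∂μ + M * 0)) := by
    refine Tendsto.const_add _ (Tendsto.const_mul _ ?_)
    have hanti : Antitone fun L => (E L)ᶜ := by
      intro K L hKL
      refine Set.compl_subset_compl.2 ?_
      rintro x ⟨n, h1, h2, h3⟩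
      exact ⟨n, h1, by omega, h3⟩
    have hemp : ⋂ L, (E L)ᶜ = ∅ := by
      rw [← Set.compl_iUnion, Set.compl_empty_iff]
      refine Set.eq_univ_of_forall fun x => ?_
      obtain ⟨n, h1, h3⟩ := hex x
      exact Set.mem_iUnion.2 ⟨n, n, h1, by omega, h3⟩
    have := tendsto_measure_iInter_atTop (μ := μ) (s := fun L => (E L)ᶜ)
      (fun L => (hEm L).compl.nullMeasurableSet) hanti ⟨0, measure_ne_top _ _⟩
    rw [hemp, measure_empty] at this
    exact (ENNReal.tendsto_toReal ENNReal.zero_ne_top).comp this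
  rw [mul_zero, add_zero] at hlim
  exact ge_of_tendsto' hlim key

lemma measurableSet_upperSet (hT : Measurable T) (hf : Measurable f) (c : ℝ) :
    MeasurableSet (upperSet T f c) := by
  have : upperSet T f c = ⋃ q : ℚ, ⋃ _ : c < q, ⋂ N : ℕ, ⋃ n : ℕ, ⋃ _ : N ≤ n,
      {x | q * n ≤ birkhoffSum T f n x} := by
    ext x
    simp [upperSet, frequently_atTop]
  rw [this]
  refine MeasurableSet.iUnion fun q => MeasurableSet.iUnion fun _ => MeasurableSet.iInter fun N =>
    MeasurableSet.iUnion fun n => MeasurableSet.iUnion fun _ => ?_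
  exact measurableSet_le measurable_const (measurable_birkhoffSum hT hf n)

lemma measurableSet_lowerSet (hT : Measurable T) (hf : Measurable f) (c : ℝ) :
    MeasurableSet (lowerSet T f c) := by
  have : lowerSet T f c = ⋃ q : ℚ, ⋃ _ : c < q, ⋃ N : ℕ, ⋂ n : ℕ, ⋂ _ : N ≤ n,
      {x | q * n ≤ birkhoffSum T f n x} := by
    ext x
    simp [lowerSet, eventually_atTop]
  rw [this]
  refine MeasurableSet.iUnion fun q => MeasurableSet.iUnion fun _ => MeasurableSet.iUnion fun N =>
    MeasurableSet.iInter fun n => MeasurableSet.iInter fun _ => ?_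
  exact measurableSet_le measurable_const (measurable_birkhoffSum hT hf n)

/-- The maximal inequality applied to `h = d` on the invariant set `upperSet T f d` and `0`
elsewhere. -/
lemma mul_measureReal_upperSet_le (hT : MeasurePreserving T μ μ) (hfm : Measurable f)
    (hf : Integrable f μ) (h0 : ∀ x, 0 ≤ f x) {d : ℝ} (hd0 : 0 ≤ d) :
    d * μ.real (upperSet T f d) ≤ ∫ x, f x ∂μ := by
  have hCm := measurableSet_upperSet hT.measurable hfm d
  have := integral_le_of_exists_mul_le_birkhoffSum hT hfm hf h0
    (h := (upperSet T f d).indicator fun _ => d) (measurable_const.indicator hCm)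
    (Set.indicator_nonneg fun _ _ => hd0) (M := d)
    (Set.indicator_le' (fun _ _ => le_rfl) (fun _ _ => hd0)) ?_ ?_
  · rw [integral_indicator hCm] at this
    simpa [mul_comm] using this
  · intro x
    by_cases h1 : x ∈ upperSet T f d
    · rw [Set.indicator_of_mem h1, Set.indicator_of_mem (map_mem_upperSet h1)]
    · rw [Set.indicator_of_notMem h1]; exact Set.indicator_nonneg (fun _ _ => hd0) _
  · intro x
    by_cases h1 : x ∈ upperSet T f d
    · rw [Set.indicator_of_mem h1]; exact exists_of_mem_upperSet h1
    · rw [Set.indicator_of_notMem h1]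
      exact ⟨1, le_rfl, by simpa using h0 x⟩

/-- If the averages of `f` are asymptotically at least `m ≥ ∫ f`, they are at most `m`. -/
lemma ae_notMem_upperSet_of_lowerSet (hT : MeasurePreserving T μ μ) (hfm : Measurable f)
    (hf : Integrable f μ) (h0 : ∀ x, 0 ≤ f x) {m : ℝ} (hm : ∫ x, f x ∂μ ≤ m)
    (hlow : ∀ c, 0 ≤ c → c < m → ∀ᵐ x ∂μ, x ∈ lowerSet T f c) {d : ℝ} (hd : m < d) :
    ∀ᵐ x ∂μ, x ∉ upperSet T f d := by
  have hm0 : 0 ≤ m := (integral_nonneg h0).trans hm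
  have hCm := measurableSet_upperSet hT.measurable hfm d
  have hle : ∀ c, 0 ≤ c → c < m → d * μ.real (upperSet T f d) +
      c * (1 - μ.real (upperSet T f d)) ≤ m := by
    intro c hc0 hc
    have hDm := measurableSet_lowerSet hT.measurable hfm c
    -- Almost surely `h` is `d` on the upper set and `c` off it. With `u` the mass of the upper set,
    -- the maximal inequality gives `d u + c (1 - u) ≤ m`, and `c` close to `m < d` then forces `u =
    -- 0`.
    set h : α → ℝ := fun x => max ((upperSet T f d).indicator (fun _ => d) x)
      ((lowerSet T f c).indicator (fun _ => c) x) with hh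
    have hhm : Measurable h :=
      (measurable_const.indicator hCm).max (measurable_const.indicator hDm)
    have hd0 : 0 ≤ d := by linarith
    have hval : ∀ x, (x ∈ upperSet T f d → h x = d) ∧
        (x ∉ upperSet T f d → x ∈ lowerSet T f c → h x = c) ∧
        (x ∉ upperSet T f d → x ∉ lowerSet T f c → h x = 0) := by
      intro x
      refine ⟨fun h1 => ?_, fun h1 h2 => ?_, fun h1 h2 => ?_⟩
      · by_cases h2 : x ∈ lowerSet T f c
        · simp only [hh, Set.indicator_of_mem h1, Set.indicator_of_mem h2]
          exact max_eq_left (by linarith)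
        · simp only [hh, Set.indicator_of_mem h1, Set.indicator_of_notMem h2]
          exact max_eq_left hd0
      · simp only [hh, Set.indicator_of_notMem h1, Set.indicator_of_mem h2]
        exact max_eq_right hc0
      · simp [hh, Set.indicator_of_notMem h1, Set.indicator_of_notMem h2]
    have hh0 : ∀ x, 0 ≤ h x := fun x =>
      le_max_of_le_left (Set.indicator_nonneg (fun _ _ => hd0) x)
    have hhd : ∀ x, h x ≤ d := fun x =>
      max_le (Set.indicator_le' (fun _ _ => le_rfl) (fun _ _ => hd0) x)
        (Set.indicator_le' (fun _ _ => by linarith) (fun _ _ => hd0) x)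
    have hinv : ∀ x, h x ≤ h (T x) := by
      intro x
      by_cases h1 : x ∈ upperSet T f d
      · rw [(hval (T x)).1 (map_mem_upperSet h1)]; exact hhd x
      · by_cases h2 : x ∈ lowerSet T f c
        · rw [(hval x).2.1 h1 h2]
          refine le_max_of_le_right ?_
          rw [Set.indicator_of_mem (map_mem_lowerSet h2)]
        · rw [(hval x).2.2 h1 h2]; exact hh0 _
    have hex : ∀ x, ∃ n, 1 ≤ n ∧ n * h x ≤ birkhoffSum T f n x := by
      intro x
      by_cases h1 : x ∈ upperSet T f d
      · rw [(hval x).1 h1]; exact exists_of_mem_upperSet h1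
      · by_cases h2 : x ∈ lowerSet T f c
        · rw [(hval x).2.1 h1 h2]; exact exists_of_mem_upperSet (lowerSet_subset_upperSet _ h2)
        · rw [(hval x).2.2 h1 h2]
          exact ⟨1, le_rfl, by simpa using h0 x⟩
    have hmain := integral_le_of_exists_mul_le_birkhoffSum hT hfm hf h0 hhm hh0 hhd hinv hex
    refine le_trans (le_of_eq ?_) (hmain.trans hm)
    have hae : h =ᵐ[μ] fun x => c + (upperSet T f d).indicator (fun _ => d - c) x := by
      filter_upwards [hlow c hc0 hc] with x hx
      by_cases h1 : x ∈ upperSet T f d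
      · rw [(hval x).1 h1, Set.indicator_of_mem h1]; ring
      · rw [(hval x).2.1 h1 hx, Set.indicator_of_notMem h1]; ring
    rw [integral_congr_ae hae, integral_add (integrable_const _)
      ((integrable_const _).indicator hCm), integral_indicator hCm]
    simp
    ring
  have hzero : μ.real (upperSet T f d) = 0 := by
    set u := μ.real (upperSet T f d)
    have hu0 : 0 ≤ u := measureReal_nonneg
    have hu1 : u ≤ 1 := measureReal_le_one
    by_contra hne
    have hu : 0 < u := lt_of_le_of_ne hu0 (Ne.symm hne)
    -- When `m = 0` there is no admissible `c`, and the plain maximal inequality is enough.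
    rcases hm0.eq_or_lt with hz | hpos
    · have h1 := mul_measureReal_upperSet_le hT hfm hf h0 (show 0 ≤ d by linarith)
      nlinarith
    -- The loss `m - c` is at most `(d - m) u / 2`, less than the gain `(d - m) u` on the upper set.
    · have hc := hle (max 0 (m - (d - m) * u / 2)) (le_max_left _ _)
        (max_lt hpos (by nlinarith))
      have : m - (d - m) * u / 2 ≤ max 0 (m - (d - m) * u / 2) := le_max_right _ _
      nlinarith [mul_pos (sub_pos.2 hd) hu]
  have := (measureReal_eq_zero_iff).1 hzero
  exact measure_eq_zero_iff_ae_notMem.1 this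

/-- The upper set is mapped into itself, so it is null or of full measure; full measure would give
`d ≤ ∫ f`. -/
lemma ae_notMem_upperSet_of_ergodic (hT : Ergodic T μ) (hfm : Measurable f) (hf : Integrable f μ)
    (h0 : ∀ x, 0 ≤ f x) {d : ℝ} (hd : ∫ x, f x ∂μ < d) : ∀ᵐ x ∂μ, x ∉ upperSet T f d := by
  have hCm := measurableSet_upperSet hT.measurable hfm d
  have hd0 : 0 ≤ d := (integral_nonneg h0).trans hd.le
  rcases hT.ae_empty_or_univ_of_ae_le_preimage hCm.nullMeasurableSet
    (Eventually.of_forall fun x hx => map_mem_upperSet hx) with h | h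
  · exact eventuallyEq_empty.1 h
  · exfalso
    have := mul_measureReal_upperSet_le hT.toMeasurePreserving hfm hf h0 hd0
    rw [measureReal_congr h, probReal_univ] at this
    linarith

lemma ae_eventually_birkhoffSum_le (hT : Ergodic T μ) (hfm : Measurable f) (hf : Integrable f μ)
    (h0 : ∀ x, 0 ≤ f x) {d : ℝ} (hd : ∫ x, f x ∂μ < d) :
    ∀ᵐ x ∂μ, ∀ᶠ n : ℕ in atTop, birkhoffSum T f n x ≤ d * n := by
  obtain ⟨q, hq1, hq2⟩ := exists_rat_btwn hd
  obtain ⟨c, hc1, hc2⟩ := exists_between hq1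
  filter_upwards [ae_notMem_upperSet_of_ergodic hT hfm hf h0 hc1] with x hx
  have : ¬ ∃ᶠ n : ℕ in atTop, q * n ≤ birkhoffSum T f n x := fun h => hx ⟨q, hc2, h⟩
  rw [not_frequently] at this
  filter_upwards [this] with n hn
  have : (0 : ℝ) ≤ n := n.cast_nonneg
  nlinarith

/-- The pointwise ergodic theorem for functions with values in `[0, 1]`. -/
lemma tendsto_birkhoffSum_div (hT : Ergodic T μ) (hfm : Measurable f)
    (h0 : ∀ x, 0 ≤ f x) (h1 : ∀ x, f x ≤ 1) :
    ∀ᵐ x ∂μ, Tendsto (fun n : ℕ => birkhoffSum T f n x / n) atTop (𝓝 (∫ x, f x ∂μ)) := by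
  have hf : Integrable f μ := by
    refine Integrable.of_bound hfm.aestronglyMeasurable 1 (Eventually.of_forall fun x => ?_)
    rw [Real.norm_of_nonneg (h0 x)]
    exact h1 x
  have hup : ∀ᵐ x ∂μ, ∀ k : ℕ, ∀ᶠ n : ℕ in atTop,
      birkhoffSum T f n x ≤ (∫ x, f x ∂μ + 1 / (k + 1)) * n :=
    ae_all_iff.2 fun k => ae_eventually_birkhoffSum_le hT hfm hf h0
      (by linarith [Nat.one_div_pos_of_nat (α := ℝ) (n := k)])
  -- The lower bound for `f` is the upper bound for `1 - f`, which is nonnegative as well.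
  have hlo : ∀ᵐ x ∂μ, ∀ k : ℕ, ∀ᶠ n : ℕ in atTop,
      birkhoffSum T (fun x => 1 - f x) n x ≤ (∫ x, (1 - f x) ∂μ + 1 / (k + 1)) * n :=
    ae_all_iff.2 fun k => ae_eventually_birkhoffSum_le hT (hfm.const_sub 1)
      ((integrable_const 1).sub hf) (fun x => by linarith [h1 x])
      (by linarith [Nat.one_div_pos_of_nat (α := ℝ) (n := k)])
  filter_upwards [hup, hlo] with x hx1 hx2
  rw [Metric.tendsto_atTop']
  intro ε hε
  obtain ⟨k, hk⟩ := exists_nat_one_div_lt hε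
  obtain ⟨N, hN⟩ := eventually_atTop.1 ((hx1 k).and (hx2 k))
  refine ⟨N, fun n hn => ?_⟩
  have hn0 : (0 : ℝ) < n := by exact_mod_cast (by omega : 0 < n)
  obtain ⟨h3, h4⟩ := hN n hn.le
  have h5 : birkhoffSum T (fun x => 1 - f x) n x = n - birkhoffSum T f n x := by
    simp [birkhoffSum]
  rw [h5, integral_sub (integrable_const 1) hf] at h4
  simp only [integral_const, probReal_univ, smul_eq_mul, mul_one] at h4
  rw [Real.dist_eq, abs_lt]
  constructor
  · rw [neg_lt_sub_iff_lt_add, add_comm, ← sub_lt_iff_lt_add, lt_div_iff₀ hn0]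
    nlinarith
  · rw [sub_lt_iff_lt_add, div_lt_iff₀ hn0]
    nlinarith

end Ergodic

end BiasedWalk
end

noncomputable section
namespace BiasedWalk

open scoped ENNReal

/-! ### The environment -/

lemma measurable_rateMinus (x : ℤ) : Measurable fun ξ : Environment => rateMinus ξ x :=
  measurable_subtype_coe.comp (measurable_fst.comp (measurable_pi_apply x))

lemma measurable_ratePlus (x : ℤ) : Measurable fun ξ : Environment => ratePlus ξ x :=
  measurable_subtype_coe.comp (measurable_snd.comp (measurable_pi_apply x))

lemma measurable_biasedRateMinus (lam : ℝ) (x : ℤ) :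
    Measurable fun ξ : Environment => biasedRateMinus lam ξ x :=
  (measurable_rateMinus x).mul_const _

lemma measurable_biasedRatePlus (lam : ℝ) (x : ℤ) :
    Measurable fun ξ : Environment => biasedRatePlus lam ξ x :=
  (measurable_ratePlus x).mul_const _

lemma rateMinus_pos (ξ : Environment) (x : ℤ) : 0 < rateMinus ξ x := (ξ x).1.2

lemma ratePlus_pos (ξ : Environment) (x : ℤ) : 0 < ratePlus ξ x := (ξ x).2.2

lemma biasedRateMinus_pos (lam : ℝ) (ξ : Environment) (x : ℤ) : 0 < biasedRateMinus lam ξ x :=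
  mul_pos (rateMinus_pos ξ x) (Real.exp_pos _)

lemma biasedRatePlus_pos (lam : ℝ) (ξ : Environment) (x : ℤ) : 0 < biasedRatePlus lam ξ x :=
  mul_pos (ratePlus_pos ξ x) (Real.exp_pos _)

lemma shift_iterate_apply (n : ℕ) (ξ : Environment) (x : ℤ) : shift^[n] ξ x = ξ (x + n) := by
  induction n generalizing ξ x with
  | zero => simp
  | succ n ih => rw [Function.iterate_succ_apply, ih]; simp only [shift]; congr 1; push_cast; ring

lemma biasedRateMinus_shift_iterate (lam : ℝ) (n : ℕ) (ξ : Environment) :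
    biasedRateMinus lam (shift^[n] ξ) = fun x => biasedRateMinus lam ξ (x + n) := by
  funext x; simp [biasedRateMinus, rateMinus, shift_iterate_apply]

lemma biasedRatePlus_shift_iterate (lam : ℝ) (n : ℕ) (ξ : Environment) :
    biasedRatePlus lam (shift^[n] ξ) = fun x => biasedRatePlus lam ξ (x + n) := by
  funext x; simp [biasedRatePlus, ratePlus, shift_iterate_apply]

lemma laplaceIter_translate (a b : ℤ → ℝ) (s : ℝ) (j : ℕ) (x y : ℤ) :
    laplaceIter a b s j (x + y) = laplaceIter (fun i => a (i + y)) (fun i => b (i + y)) s j x := by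
  induction j generalizing x with
  | zero => rfl
  | succ j ih => rw [laplaceIter, laplaceIter, ← ih, show x + y - 1 = x - 1 + y by ring]

/-- The walk in the biased environment `ξ`, driven by the noise `η`. -/
abbrev envChain (lam : ℝ) (p : Environment × Noise) : ℕ → ℤ :=
  chain (biasedRateMinus lam p.1) (biasedRatePlus lam p.1) 0 p.2

/-- The jump times of the walk in the biased environment `ξ`, driven by the noise `η`. -/
abbrev envClock (lam : ℝ) (p : Environment × Noise) : ℕ → ℝ :=
  clock (biasedRateMinus lam p.1) (biasedRatePlus lam p.1) 0 p.2

lemma jumpChain_eq (lam : ℝ) (ξ : Environment) (η : Noise) (n : ℕ) :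
    jumpChain lam ξ η n = envChain lam (ξ, η) n := by
  induction n with
  | zero => rfl
  | succ n ih => rw [jumpChain, envChain, chain_succ, ih]; rfl

lemma jumpTime_eq (lam : ℝ) (ξ : Environment) (η : Noise) (n : ℕ) :
    jumpTime lam ξ η n = envClock lam (ξ, η) n := by
  unfold jumpTime holdingTime
  simp_rw [jumpChain_eq]
  rfl

lemma measurable_envChain (lam : ℝ) (n : ℕ) : Measurable fun p => envChain lam p n :=
  measurable_chain (fun x => (measurable_biasedRateMinus lam x).comp measurable_fst)
    (fun x => (measurable_biasedRatePlus lam x).comp measurable_fst) measurable_snd 0 n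

lemma measurable_envClock (lam : ℝ) (n : ℕ) : Measurable fun p => envClock lam p n :=
  measurable_clock (fun x => (measurable_biasedRateMinus lam x).comp measurable_fst)
    (fun x => (measurable_biasedRatePlus lam x).comp measurable_fst) measurable_snd 0 n

lemma measurable_laplaceIter (lam s : ℝ) (j : ℕ) (x : ℤ) : Measurable fun ξ : Environment =>
    laplaceIter (biasedRateMinus lam ξ) (biasedRatePlus lam ξ) s j x := by
  induction j generalizing x with
  | zero => exact measurable_const
  | succ j ih =>
    have := measurable_biasedRateMinus lam x
    have := measurable_biasedRatePlus lam x
    have := ih (x - 1)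
    simp only [laplaceIter]
    fun_prop

lemma measurable_meanIter (lam : ℝ) (j : ℕ) (x : ℤ) : Measurable fun ξ : Environment =>
    meanIter (biasedRateMinus lam ξ) (biasedRatePlus lam ξ) j x := by
  induction j generalizing x with
  | zero => exact measurable_const
  | succ j ih =>
    have := measurable_biasedRateMinus lam x
    have := measurable_biasedRatePlus lam x
    have := ih (x - 1)
    simp only [meanIter]
    fun_prop

/-- The mean time that the walk with bias `lam` takes to go from `0` to `1`. -/
def meanPassage (P : Measure Environment) (lam : ℝ) : ℝ≥0∞ :=
  ⨆ j, ∫⁻ ξ, ENNReal.ofReal (meanIter (biasedRateMinus lam ξ) (biasedRatePlus lam ξ) j 0) ∂P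


lemma meanPassage_pos {P : Measure Environment} [NeZero P] (lam : ℝ) : 0 < meanPassage P lam := by
  refine lt_of_lt_of_le ?_ (le_iSup _ 1)
  rw [lintegral_pos_iff_support (measurable_meanIter lam 1 0).ennreal_ofReal]
  have : (Function.support fun ξ : Environment => ENNReal.ofReal
      (meanIter (biasedRateMinus lam ξ) (biasedRatePlus lam ξ) 1 0)) = Set.univ := by
    refine Set.eq_univ_of_forall fun ξ => ?_
    simp [meanIter, biasedRatePlus_pos]
  rw [this]
  exact NeZero.pos _

/-! ### Slow passage -/

/-- A form of the Borel–Cantelli lemma. -/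
lemma ae_eventually_notMem_of_exp {Ω : Type*} [MeasurableSpace Ω] {μ : Measure Ω} {A : ℕ → Set Ω}
    {δ : ℝ} (hδ : 0 < δ) (hA : ∀ᶠ n : ℕ in atTop, μ (A n) ≤ ENNReal.ofReal (Real.exp (-δ * n))) :
    ∀ᵐ ω ∂μ, ∀ᶠ n in atTop, ω ∉ A n := by
  obtain ⟨N, hN⟩ := eventually_atTop.1 hA
  have hs : ∑' n, μ (A (n + N)) ≠ ∞ := by
    have hsum : Summable fun n : ℕ => Real.exp (-δ * n) := by
      have : (fun n : ℕ => Real.exp (-δ * n)) = fun n : ℕ => Real.exp (-δ) ^ n := by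
        funext n; rw [← Real.exp_nat_mul]; ring_nf
      rw [this]
      exact summable_geometric_of_lt_one (Real.exp_pos _).le (by rw [← Real.exp_zero]; exact Real.exp_lt_exp.2 (by linarith))
    refine ne_top_of_le_ne_top hsum.tsum_ofReal_ne_top (ENNReal.tsum_le_tsum fun n => ?_)
    refine (hN (n + N) (by omega)).trans (ENNReal.ofReal_le_ofReal (Real.exp_le_exp.2 ?_))
    push_cast
    nlinarith [(Nat.cast_nonneg N : (0 : ℝ) ≤ N)]
  filter_upwards [ae_eventually_notMem hs] with ω hω
  obtain ⟨M, hM⟩ := eventually_atTop.1 hω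
  refine eventually_atTop.2 ⟨M + N, fun n hn => ?_⟩
  have := hM (n - N) (by omega)
  rwa [Nat.sub_add_cancel (by omega)] at this

/-- The exponent of the Chernoff bound is additive over sites and covariant under the shift, so the
ergodic theorem applies to it. -/
lemma sum_Ico_laplaceIter (lam s : ℝ) (j : ℕ) (ξ : Environment) (n : ℕ) :
    ∑ k ∈ Finset.Ico (0 : ℤ) n,
      laplaceIter (biasedRateMinus lam ξ) (biasedRatePlus lam ξ) s j k =
    birkhoffSum shift
      (fun ξ => laplaceIter (biasedRateMinus lam ξ) (biasedRatePlus lam ξ) s j 0) n ξ := by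
  unfold birkhoffSum
  have himg : Finset.Ico (0 : ℤ) n = (Finset.range n).map Nat.castEmbedding := by
    ext k
    simp only [Finset.mem_Ico, Finset.mem_map, Finset.mem_range, Nat.castEmbedding_apply]
    constructor
    · rintro ⟨h1, h2⟩
      exact ⟨k.toNat, by omega, by omega⟩
    · rintro ⟨i, h1, rfl⟩
      omega
  rw [himg, Finset.sum_map]
  refine Finset.sum_congr rfl fun k _ => ?_
  beta_reduce
  rw [biasedRateMinus_shift_iterate, biasedRatePlus_shift_iterate, ← laplaceIter_translate,
    zero_add]
  rfl

variable {P : Measure Environment} [IsProbabilityMeasure P]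

lemma ae_tendsto_birkhoffSum_laplaceIter (hP : Ergodic shift P) (lam : ℝ) {s : ℝ} (hs : 0 ≤ s)
    (j : ℕ) : ∀ᵐ ξ ∂P, Tendsto (fun n : ℕ => birkhoffSum shift
      (fun ξ => laplaceIter (biasedRateMinus lam ξ) (biasedRatePlus lam ξ) s j 0) n ξ / n) atTop
      (𝓝 (∫ ξ, laplaceIter (biasedRateMinus lam ξ) (biasedRatePlus lam ξ) s j 0 ∂P)) := by
  have hb := fun ξ : Environment => isLaplaceBound_laplaceIter (biasedRateMinus_pos lam ξ)
    (biasedRatePlus_pos lam ξ) hs j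
  exact tendsto_birkhoffSum_div hP (measurable_laplaceIter lam s j 0)
    (fun ξ => (hb ξ).nonneg 0) (fun ξ => ((hb ξ).lt_one 0).le)

/-- Fatou's lemma as `s → 0`: the quotients `ψ / s` converge pointwise to the `j`-th mean iterate.
Only a lower bound on the limit is needed, so infinite means are allowed. -/
lemma exists_lt_integral_laplaceIter {lam c : ℝ} (hc : ENNReal.ofReal c < meanPassage P lam) :
    ∃ (j : ℕ) (s : ℝ), 0 < s ∧
      s * c < ∫ ξ, laplaceIter (biasedRateMinus lam ξ) (biasedRatePlus lam ξ) s j 0 ∂P := by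
  obtain ⟨j, hj⟩ := lt_iSup_iff.1 hc
  set ψ : ℝ → Environment → ℝ := fun s ξ =>
    laplaceIter (biasedRateMinus lam ξ) (biasedRatePlus lam ξ) s j 0
  have hF := lintegral_liminf_le (μ := P) (u := 𝓝[>] (0 : ℝ))
    (f := fun s ξ => ENNReal.ofReal (ψ s ξ / s))
    (fun s => ((measurable_laplaceIter lam s j 0).div_const s).ennreal_ofReal)
  have hlim : ∀ ξ, liminf (fun s => ENNReal.ofReal (ψ s ξ / s)) (𝓝[>] (0 : ℝ)) =
      ENNReal.ofReal (meanIter (biasedRateMinus lam ξ) (biasedRatePlus lam ξ) j 0) := fun ξ =>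
    (ENNReal.tendsto_ofReal (tendsto_laplaceIter_div (biasedRateMinus_pos lam ξ)
      (biasedRatePlus_pos lam ξ) j 0).2).liminf_eq
  simp_rw [hlim] at hF
  have hev := eventually_lt_of_lt_liminf (hj.trans_le hF)
  obtain ⟨s, hs, hs0⟩ := (hev.and self_mem_nhdsWithin).exists
  have hs0 : 0 < s := hs0
  refine ⟨j, s, hs0, ?_⟩
  have hb := fun ξ : Environment => isLaplaceBound_laplaceIter (biasedRateMinus_pos lam ξ)
    (biasedRatePlus_pos lam ξ) hs0.le j
  rw [← ofReal_integral_eq_lintegral_ofReal] at hs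
  · rw [integral_div] at hs
    have := lt_of_not_ge fun h => hs.not_ge (ENNReal.ofReal_le_ofReal h)
    rw [lt_div_iff₀ hs0] at this
    linarith
  · refine Integrable.of_bound ((measurable_laplaceIter lam s j 0).div_const s).aestronglyMeasurable
      (1 / s) (Eventually.of_forall fun ξ => ?_)
    rw [Real.norm_of_nonneg (div_nonneg ((hb ξ).nonneg 0) hs0.le)]
    exact div_le_div_of_nonneg_right ((hb ξ).lt_one 0).le hs0.le
  · exact Eventually.of_forall fun ξ => div_nonneg ((hb ξ).nonneg 0) hs0.le

/-- The walk is asymptotically not faster than one over the mean passage time. -/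
lemma ae_eventually_lt_envClock (hP : Ergodic shift P) {lam c : ℝ}
    (hc : ENNReal.ofReal c < meanPassage P lam) :
    ∀ᵐ p ∂(P.prod noiseLaw), ∀ᶠ n : ℕ in atTop, ∀ k, envChain lam p k = n →
      c * n < envClock lam p k := by
  have hmeas : MeasurableSet {p | ∀ᶠ n : ℕ in atTop, ∀ k, envChain lam p k = n →
      c * n < envClock lam p k} := by
    have : {p | ∀ᶠ n : ℕ in atTop, ∀ k, envChain lam p k = n → c * n < envClock lam p k} =
        ⋃ N : ℕ, ⋂ n : ℕ, ⋂ _ : N ≤ n, ⋂ k, ({p | envChain lam p k = n}ᶜ ∪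
          {p | c * n < envClock lam p k}) := by
      ext p
      simp only [eventually_atTop, Set.mem_ofPred_eq, Set.mem_iUnion, Set.mem_iInter, Set.mem_union,
        Set.mem_compl_iff, imp_iff_not_or]
    rw [this]
    refine MeasurableSet.iUnion fun N => MeasurableSet.iInter fun n => MeasurableSet.iInter fun _ =>
      MeasurableSet.iInter fun k => ?_
    exact (measurable_envChain lam k (measurableSet_singleton _)).compl.union
      (measurableSet_lt measurable_const (measurable_envClock lam k))
  rw [Measure.ae_prod_iff_ae_ae hmeas]
  obtain ⟨j, s, hs, hlt⟩ := exists_lt_integral_laplaceIter hc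
  filter_upwards [ae_tendsto_birkhoffSum_laplaceIter hP lam hs.le j] with ξ hξ
  -- The sum of the exponents up to `n` eventually exceeds `κ n`, against `s c n` from the time
  -- allowed, so the probability decays like `e^{-(κ - s c) n}`.
  obtain ⟨κ, hκ1, hκ2⟩ := exists_between hlt
  have hev : ∀ᶠ n : ℕ in atTop, noiseLaw {η | ∃ k,
      chain (biasedRateMinus lam ξ) (biasedRatePlus lam ξ) 0 η k = n ∧
      clock (biasedRateMinus lam ξ) (biasedRatePlus lam ξ) 0 η k ≤ c * n} ≤
      ENNReal.ofReal (Real.exp (-(κ - s * c) * n)) := by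
    filter_upwards [hξ.eventually (lt_mem_nhds hκ2), eventually_gt_atTop 0] with n hn hn0
    refine (noiseLaw_visit_le (biasedRateMinus_pos lam ξ) (biasedRatePlus_pos lam ξ) hs.le
      (isLaplaceBound_laplaceIter (biasedRateMinus_pos lam ξ) (biasedRatePlus_pos lam ξ) hs.le j)
      (by omega) _).trans (ENNReal.ofReal_le_ofReal (Real.exp_le_exp.2 ?_))
    rw [sum_Ico_laplaceIter]
    rw [lt_div_iff₀ (by exact_mod_cast hn0)] at hn
    linarith
  filter_upwards [ae_eventually_notMem_of_exp (by linarith) hev] with η hη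
  filter_upwards [hη] with n hn k hk
  by_contra hle
  exact hn ⟨k, hk, not_lt.1 hle⟩

/-! ### Reflection -/

/-- The environment reflected at the origin. -/
def mirror (ξ : Environment) : Environment := fun x => ((ξ (-x)).2, (ξ (-x)).1)

/-- The noise with the roles of the two directions exchanged. -/
def mirrorNoise (η : Noise) : Noise := fun n => (unitInterval.symm (η n).1, (η n).2)

lemma measurable_mirror : Measurable mirror :=
  measurable_pi_lambda _ fun x => (measurable_snd.comp (measurable_pi_apply (-x))).prodMk
    (measurable_fst.comp (measurable_pi_apply (-x)))

lemma biasedRateMinus_mirror (lam : ℝ) (ξ : Environment) (x : ℤ) :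
    biasedRateMinus (-lam) (mirror ξ) x = biasedRatePlus lam ξ (-x) := by
  simp [biasedRateMinus, biasedRatePlus, rateMinus, ratePlus, mirror]

lemma biasedRatePlus_mirror (lam : ℝ) (ξ : Environment) (x : ℤ) :
    biasedRatePlus (-lam) (mirror ξ) x = biasedRateMinus lam ξ (-x) := by
  simp [biasedRateMinus, biasedRatePlus, rateMinus, ratePlus, mirror]

lemma measurePreserving_mirrorNoise : MeasurePreserving mirrorNoise noiseLaw noiseLaw := by
  have hm : Measurable fun e : unitInterval × ℝ => (unitInterval.symm e.1, e.2) := by fun_prop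
  have h1 : stepLaw.map (fun e : unitInterval × ℝ => (unitInterval.symm e.1, e.2)) = stepLaw :=
    (unitInterval.measurePreserving_symm.prod (MeasurePreserving.id (expMeasure 1))).map_eq
  refine ⟨measurable_pi_lambda _ fun n => hm.comp (measurable_pi_apply n), ?_⟩
  have := Measure.infinitePi_map_pi (fun _ : ℕ => stepLaw)
    (f := fun (_ : ℕ) (e : unitInterval × ℝ) => (unitInterval.symm e.1, e.2)) (fun _ => hm)
  simp_rw [h1] at this
  exact this

/-- Reflection conjugates the shift to its inverse, and the inverse of an ergodic automorphism is
ergodic. -/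
lemma ergodic_mirror {P : Measure Environment} (hP : Ergodic shift P) : Ergodic shift (P.map mirror) := by
  have hm : ∀ f : ℤ → ℤ, Measurable fun (ξ : Environment) (x : ℤ) => ξ (f x) := fun f =>
    measurable_pi_lambda _ fun x => measurable_pi_apply (f x)
  let e : Environment ≃ᵐ Environment :=
    { toFun := shift
      invFun := fun ξ x => ξ (x - 1)
      left_inv := fun ξ => by funext x; simp [shift]
      right_inv := fun ξ => by funext x; simp [shift]
      measurable_toFun := hm _
      measurable_invFun := hm _ }
  have he : Ergodic e P := hP
  refine MeasurePreserving.ergodic_of_ergodic_semiconj (measurable_mirror.measurePreserving P)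
    he.symm (hm (· + 1)) fun ξ => ?_
  funext x
  change mirror (fun y => ξ (y - 1)) x = mirror ξ (x + 1)
  simp only [mirror]
  rw [show -(x + 1) = -x - 1 by ring]

/-- The joint reflection of the environment and the noise. -/
def mirrorBoth (p : Environment × Noise) : Environment × Noise := (mirror p.1, mirrorNoise p.2)

lemma measurePreserving_mirrorBoth :
    MeasurePreserving mirrorBoth (P.prod noiseLaw) ((P.map mirror).prod noiseLaw) := by
  have := Measure.isProbabilityMeasure_map (μ := P) measurable_mirror.aemeasurable
  exact (measurable_mirror.measurePreserving P).prod measurePreserving_mirrorNoise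

lemma ae_noiseLaw_ne (r : ℤ → ℝ) : ∀ᵐ η ∂noiseLaw, ∀ (k : ℕ) (y : ℤ), ((η k).1 : ℝ) ≠ r y := by
  refine ae_all_iff.2 fun k => ae_all_iff.2 fun y => ?_
  have h1 : MeasurePreserving (fun η : Noise => η k) noiseLaw stepLaw :=
    measurePreserving_eval_infinitePi (fun _ : ℕ => stepLaw) k
  have h2 : MeasurePreserving (Prod.fst : unitInterval × ℝ → unitInterval) stepLaw volume :=
    measurePreserving_fst
  refine (h2.comp h1).quasiMeasurePreserving.ae
    (p := fun γ : unitInterval => (γ : ℝ) ≠ r y) ?_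
  rw [ae_iff]
  simp only [ne_eq, not_not]
  refine Set.Subsingleton.measure_zero ?_ _
  intro γ hγ γ' hγ'
  exact Subtype.ext (hγ.trans hγ'.symm)

/-- Replacing `γ` by `1 - γ` exchanges the two directions, except that the inequality `≤` becomes
`≥`; ties have probability zero, hence the almost sure form. -/
lemma ae_envChain_mirrorBoth (lam : ℝ) : ∀ᵐ p ∂(P.prod noiseLaw), ∀ k,
    envChain (-lam) (mirrorBoth p) k = -envChain lam p k := by
  have hmeas : MeasurableSet {p | ∀ k, envChain (-lam) (mirrorBoth p) k = -envChain lam p k} := by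
    rw [Set.ofPred_forall]
    refine MeasurableSet.iInter fun k => measurableSet_eq_fun ?_ (measurable_envChain lam k).neg
    exact (measurable_envChain (-lam) k).comp
      (measurePreserving_mirrorBoth (P := P)).measurable
  rw [Measure.ae_prod_iff_ae_ae hmeas]
  refine Eventually.of_forall fun ξ => ?_
  filter_upwards [ae_noiseLaw_ne fun y => biasedRatePlus lam ξ y /
    (biasedRateMinus lam ξ y + biasedRatePlus lam ξ y)] with η hη k
  induction k with
  | zero => simp
  | succ k ih =>
    simp only [envChain, mirrorBoth] at ih ⊢
    rw [chain_succ, chain_succ, ih, biasedRateMinus_mirror, biasedRatePlus_mirror, neg_neg]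
    set y := chain (biasedRateMinus lam ξ) (biasedRatePlus lam ξ) 0 η k
    have h1 := biasedRateMinus_pos lam ξ y
    have h2 := biasedRatePlus_pos lam ξ y
    have h3 := hη k y
    have h4 : biasedRateMinus lam ξ y / (biasedRatePlus lam ξ y + biasedRateMinus lam ξ y) =
        1 - biasedRatePlus lam ξ y / (biasedRateMinus lam ξ y + biasedRatePlus lam ξ y) := by
      rw [eq_sub_iff_add_eq, add_comm (biasedRatePlus lam ξ y), ← add_div,
        div_self (by positivity)]
    rw [h4]
    have hγ : ((mirrorNoise η k).1 : ℝ) = 1 - (η k).1 := unitInterval.coe_symm_eq _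
    by_cases h5 : ((η k).1 : ℝ) ≤
        biasedRatePlus lam ξ y / (biasedRateMinus lam ξ y + biasedRatePlus lam ξ y)
    · have h6 : ¬ ((mirrorNoise η k).1 : ℝ) ≤ 1 - biasedRatePlus lam ξ y /
          (biasedRateMinus lam ξ y + biasedRatePlus lam ξ y) := fun h =>
        h3 (le_antisymm h5 (by linarith))
      rw [if_pos h5, if_neg h6]
      ring
    · have h6 : ((mirrorNoise η k).1 : ℝ) ≤ 1 - biasedRatePlus lam ξ y /
          (biasedRateMinus lam ξ y + biasedRatePlus lam ξ y) := by linarith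
      rw [if_neg h5, if_pos h6]
      ring

lemma envClock_mirrorBoth {lam : ℝ} {p : Environment × Noise}
    (hp : ∀ k, envChain (-lam) (mirrorBoth p) k = -envChain lam p k) (k : ℕ) :
    envClock (-lam) (mirrorBoth p) k = envClock lam p k := by
  unfold envClock clock
  refine Finset.sum_congr rfl fun i _ => ?_
  rw [show chain (biasedRateMinus (-lam) (mirrorBoth p).1) (biasedRatePlus (-lam) (mirrorBoth p).1)
    0 (mirrorBoth p).2 i = _ from hp i]
  simp only [mirrorBoth, biasedRateMinus_mirror, biasedRatePlus_mirror, neg_neg, mirrorNoise]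
  rw [add_comm (biasedRatePlus lam _ _)]

lemma walk_eq (lam : ℝ) (p : Environment × Noise) (t : ℝ) :
    walk lam p.1 p.2 t = envChain lam p (sSup {n : ℕ | envClock lam p n ≤ t}) := by
  unfold walk
  rw [jumpChain_eq]
  simp_rw [jumpTime_eq]

lemma IsAsymptoticVelocity.of_mirror {lam v : ℝ}
    (h : IsAsymptoticVelocity (P.map mirror) (-lam) v) : IsAsymptoticVelocity P lam (-v) := by
  have h' := (measurePreserving_mirrorBoth (P := P)).quasiMeasurePreserving.ae h
  unfold IsAsymptoticVelocity
  filter_upwards [h', ae_envChain_mirrorBoth lam] with p hp hm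
  have hc := envClock_mirrorBoth hm
  obtain ⟨h1, h2⟩ := hp
  simp_rw [jumpTime_eq] at h1 ⊢
  simp_rw [walk_eq] at h2 ⊢
  simp_rw [Prod.mk.eta, hc, hm] at h1 h2
  refine ⟨h1, ?_⟩
  convert h2.neg using 2
  push_cast
  ring

end BiasedWalk
end

noncomputable section
namespace BiasedWalk

open scoped ENNReal

/-! ### No explosion -/

lemma lintegral_exp_neg_sum (n : ℕ) :
    ∫⁻ η, ENNReal.ofReal (Real.exp (-∑ k ∈ Finset.range n, (η k).2)) ∂noiseLaw =
      ENNReal.ofReal (1 / 2) ^ n := by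
  have hm : ∀ n : ℕ, Measurable fun η : Noise =>
      ENNReal.ofReal (Real.exp (-∑ k ∈ Finset.range n, (η k).2)) := fun n => by fun_prop
  induction n with
  | zero => simp
  | succ n ih =>
    rw [lintegral_noiseLaw (hm (n + 1))]
    have hstep : ∀ e : unitInterval × ℝ, ∫⁻ η, ENNReal.ofReal
        (Real.exp (-∑ k ∈ Finset.range (n + 1), (consNoise e η k).2)) ∂noiseLaw =
        ENNReal.ofReal (Real.exp (-(1 * e.2))) *
          (if (e.1 : ℝ) ≤ 1 then ENNReal.ofReal (1 / 2) ^ n else ENNReal.ofReal (1 / 2) ^ n) := by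
      intro e
      rw [ite_self, ← ih, ← lintegral_const_mul _ (hm n)]
      refine lintegral_congr fun η => ?_
      rw [Finset.sum_range_succ', ← ENNReal.ofReal_mul (Real.exp_pos _).le, ← Real.exp_add]
      simp only [consNoise_succ, consNoise_zero]
      congr 2
      ring
    simp_rw [hstep]
    rw [lintegral_stepLaw_mul zero_le_one le_rfl
      (h := fun w => ENNReal.ofReal (Real.exp (-(1 * w)))) (by fun_prop),
      lintegral_exp_neg_expMeasure zero_le_one]
    norm_num
    rw [pow_succ, mul_comm]

/-- Markov's inequality for `exp(C - sum)`: each exponential variable contributes a factor `1/2`. -/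
lemma ae_exists_lt_sum : ∀ᵐ η ∂noiseLaw, ∀ C : ℕ, ∃ n, (C : ℝ) <
    ∑ k ∈ Finset.range n, (η k).2 := by
  refine ae_all_iff.2 fun C => ?_
  rw [ae_iff]
  simp only [not_exists, not_lt]
  have hbound : ∀ n : ℕ, noiseLaw {η | ∀ n, ∑ k ∈ Finset.range n, (η k).2 ≤ C} ≤
      ENNReal.ofReal (Real.exp C) * ENNReal.ofReal (1 / 2) ^ n := by
    intro n
    have hm : Measurable fun η : Noise =>
        ENNReal.ofReal (Real.exp (C - ∑ k ∈ Finset.range n, (η k).2)) := by fun_prop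
    calc noiseLaw {η | ∀ n, ∑ k ∈ Finset.range n, (η k).2 ≤ C}
        ≤ noiseLaw {η | 1 ≤ ENNReal.ofReal (Real.exp (C - ∑ k ∈ Finset.range n, (η k).2))} := by
          refine measure_mono fun η hη => ?_
          rw [Set.mem_ofPred_eq, ENNReal.one_le_ofReal]
          exact Real.one_le_exp (sub_nonneg.2 (hη n))
      _ ≤ ∫⁻ η, ENNReal.ofReal (Real.exp (C - ∑ k ∈ Finset.range n, (η k).2)) ∂noiseLaw := by
          simpa using mul_meas_ge_le_lintegral hm 1
      _ = _ := by
          rw [← lintegral_exp_neg_sum, ← lintegral_const_mul _ (by fun_prop)]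
          refine lintegral_congr fun η => ?_
          rw [← ENNReal.ofReal_mul (Real.exp_pos _).le, ← Real.exp_add, sub_eq_add_neg]
  have hlim : Tendsto (fun n : ℕ => ENNReal.ofReal (Real.exp C) * ENNReal.ofReal (1 / 2) ^ n) atTop
      (𝓝 0) := by
    have := ENNReal.Tendsto.const_mul (a := ENNReal.ofReal (Real.exp C))
      (ENNReal.tendsto_pow_atTop_nhds_zero_of_lt_one
        (r := ENNReal.ofReal (1 / 2)) (by rw [ENNReal.ofReal_lt_one]; norm_num))
      (Or.inr ENNReal.ofReal_ne_top)
    simpa using this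
  exact le_antisymm (ge_of_tendsto' hlim hbound) (zero_le)

/-- If the clock stayed bounded, the linear lower bounds on arrival times would confine the walk to
a finite interval. The rates are bounded there, by `R` say, and the clock is at least the divergent
sum of the noise divided by `R`. -/
lemma tendsto_clock {a b : ℤ → ℝ} {x : ℤ} {η : Noise} (hab : ∀ y, 0 < a y + b y)
    (hη : ∀ k, 0 ≤ (η k).2) (hsum : ∀ C : ℕ, ∃ n, (C : ℝ) < ∑ k ∈ Finset.range n, (η k).2)
    (hup : ∃ c : ℝ, 0 < c ∧ ∀ᶠ n : ℕ in atTop, ∀ k, chain a b x η k = n → c * n < clock a b x η k)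
    (hlo : ∃ c : ℝ, 0 < c ∧
      ∀ᶠ n : ℕ in atTop, ∀ k, chain a b x η k = -(n : ℤ) → c * n < clock a b x η k) :
    Tendsto (clock a b x η) atTop atTop := by
  have hmono := clock_mono (x := x) hab hη
  refine hmono.tendsto_atTop_atTop fun C => ?_
  by_contra hC
  push Not at hC
  have hbd : ∀ σ : ℤ, (∃ c : ℝ, 0 < c ∧
      ∀ᶠ n : ℕ in atTop, ∀ k, chain a b x η k = σ * n → c * n < clock a b x η k) →
      ∃ N : ℕ, ∀ n ≥ N, ∀ k, chain a b x η k ≠ σ * n := by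
    rintro σ ⟨c, hc0, hc⟩
    obtain ⟨N, hN⟩ := eventually_atTop.1 hc
    obtain ⟨M, hM⟩ := exists_nat_gt (C / c)
    refine ⟨max N M, fun n hn k hk => ?_⟩
    have h1 := hN n (le_trans (le_max_left _ _) hn) k hk
    have h2 : (M : ℝ) ≤ n := by exact_mod_cast le_trans (le_max_right _ _) hn
    rw [div_lt_iff₀ hc0] at hM
    have := hC k
    nlinarith
  obtain ⟨N, hN⟩ := hbd 1 (by simpa using hup)
  obtain ⟨M, hM⟩ := hbd (-1) (by simpa using hlo)
  have hrange : ∀ k, chain a b x η k ∈ Finset.Icc (-(M : ℤ)) N := by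
    intro k
    rw [Finset.mem_Icc]
    constructor
    · by_contra hlt
      have := hM (-(chain a b x η k)).toNat (by omega) k
      omega
    · by_contra hlt
      have := hN (chain a b x η k).toNat (by omega) k
      omega
  set R := ∑ y ∈ Finset.Icc (-(M : ℤ)) N, (a y + b y) with hR
  have hRle : ∀ k, a (chain a b x η k) + b (chain a b x η k) ≤ R := fun k =>
    Finset.single_le_sum (f := fun y => a y + b y) (fun y _ => (hab y).le) (hrange k)
  have hR0 : 0 < R := (hab _).trans_le (hRle 0)
  have hlow : ∀ n, (∑ k ∈ Finset.range n, (η k).2) / R ≤ clock a b x η n := by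
    intro n
    rw [Finset.sum_div]
    exact Finset.sum_le_sum fun k _ => div_le_div_of_nonneg_left (hη k) (hab _) (hRle k)
  obtain ⟨L, hL⟩ := exists_nat_gt (C * R)
  obtain ⟨n, hn⟩ := hsum L
  have h1 := hlow n
  have h2 := hC n
  rw [div_le_iff₀ hR0] at h1
  nlinarith

variable {P : Measure Environment} [IsProbabilityMeasure P]

lemma ae_prod_of_ae_noise {Q : Noise → Prop} (h : ∀ᵐ η ∂noiseLaw, Q η) :
    ∀ᵐ p ∂(P.prod noiseLaw), Q p.2 :=
  (measurePreserving_snd (μ := P) (ν := noiseLaw)).quasiMeasurePreserving.ae h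

lemma exists_ofReal_lt_meanPassage (P : Measure Environment) [IsProbabilityMeasure P] (lam : ℝ) :
    ∃ c : ℝ, 0 < c ∧ ENNReal.ofReal c < meanPassage P lam := by
  obtain ⟨c, hc1, hc2⟩ := ENNReal.lt_iff_exists_real_btwn.1 (meanPassage_pos (P := P) lam)
  exact ⟨c, by simpa using hc2.1, hc2.2⟩

/-- The walk is asymptotically not faster to the left than one over the mean passage time of the
reflected walk. -/
lemma ae_eventually_lt_envClock_neg (hP : Ergodic shift P) {lam c : ℝ}
    (hc : ENNReal.ofReal c < meanPassage (P.map mirror) (-lam)) :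
    ∀ᵐ p ∂(P.prod noiseLaw), ∀ᶠ n : ℕ in atTop, ∀ k, envChain lam p k = -(n : ℤ) →
      c * n < envClock lam p k := by
  have hprob := Measure.isProbabilityMeasure_map (μ := P) measurable_mirror.aemeasurable
  have h := (measurePreserving_mirrorBoth (P := P)).quasiMeasurePreserving.ae
    (ae_eventually_lt_envClock (ergodic_mirror hP) hc)
  filter_upwards [h, ae_envChain_mirrorBoth lam] with p hp hm
  have hcl := envClock_mirrorBoth hm
  filter_upwards [hp] with n hn k hk
  rw [← hcl]
  exact hn k (by rw [hm, hk, neg_neg])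

/-- The walk does not explode. -/
lemma ae_tendsto_envClock (hP : Ergodic shift P) (lam : ℝ) :
    ∀ᵐ p ∂(P.prod noiseLaw), Tendsto (envClock lam p) atTop atTop := by
  have hprob := Measure.isProbabilityMeasure_map (μ := P) measurable_mirror.aemeasurable
  obtain ⟨c, hc0, hc⟩ := exists_ofReal_lt_meanPassage P lam
  obtain ⟨d, hd0, hd⟩ := exists_ofReal_lt_meanPassage (P.map mirror) (-lam)
  filter_upwards [ae_eventually_lt_envClock hP hc, ae_eventually_lt_envClock_neg hP hd,
    ae_prod_of_ae_noise ae_noiseLaw_nonneg, ae_prod_of_ae_noise ae_exists_lt_sum]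
    with p h1 h2 h3 h4
  exact tendsto_clock (fun y => add_pos (biasedRateMinus_pos lam p.1 y)
    (biasedRatePlus_pos lam p.1 y)) h3 h4 ⟨c, hc0, h1⟩ ⟨d, hd0, h2⟩

/-! ### From passage times to the walk -/

/-- The number of jumps made up to time `t`. -/
def jumpCount (u : ℕ → ℝ) (t : ℝ) : ℕ := sSup {n : ℕ | u n ≤ t}

lemma jumpCount_spec {u : ℕ → ℝ} (hu : Monotone u) (h0 : u 0 = 0)
    (hlim : Tendsto u atTop atTop) {t : ℝ} (ht : 0 ≤ t) :
    u (jumpCount u t) ≤ t ∧ t < u (jumpCount u t + 1) := by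
  obtain ⟨N, hN⟩ := (hlim.eventually_gt_atTop t).exists
  have hbdd : BddAbove {n : ℕ | u n ≤ t} := by
    refine ⟨N, fun n hn => ?_⟩
    by_contra hlt
    exact absurd (hu (not_le.1 hlt).le) (not_le.2 (lt_of_le_of_lt hn hN))
  have hne : {n : ℕ | u n ≤ t}.Nonempty := ⟨0, by simpa [h0] using ht⟩
  refine ⟨Nat.sSup_mem hne hbdd, ?_⟩
  by_contra hle
  have : jumpCount u t + 1 ≤ jumpCount u t := le_csSup hbdd (not_lt.1 hle)
  omega

lemma eventually_apply_jumpCount_le {u : ℕ → ℝ} {X : ℕ → ℤ} (hu : Monotone u) (h0 : u 0 = 0)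
    (hlim : Tendsto u atTop atTop) {c : ℝ} (hc : 0 < c)
    (hX : ∀ᶠ n : ℕ in atTop, ∀ k, X k = n → c * n < u k) :
    ∀ᶠ t : ℝ in atTop, (X (jumpCount u t) : ℝ) ≤ t / c := by
  -- Sites below `N` are harmless once `t ≥ c N`.
  obtain ⟨N, hN⟩ := eventually_atTop.1 hX
  filter_upwards [eventually_ge_atTop (c * N)] with t ht
  have ht0 : 0 ≤ t := le_trans (by positivity) ht
  obtain ⟨h1, -⟩ := jumpCount_spec hu h0 hlim ht0
  rw [le_div_iff₀ hc]
  rcases le_or_gt (N : ℤ) (X (jumpCount u t)) with h | h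
  · obtain ⟨n, hn⟩ := Int.eq_ofNat_of_zero_le (show 0 ≤ X (jumpCount u t) by omega)
    have := hN n (by omega) _ hn
    rw [hn]
    push_cast
    linarith
  · have : (X (jumpCount u t) : ℝ) ≤ N := by exact_mod_cast h.le
    nlinarith

/-- A lower bound on the position from the first passage times `u (M n)` at the sites `n` and
from the absence of fast passages after backtracking. -/
lemma eventually_le_apply_jumpCount {u : ℕ → ℝ} {X : ℕ → ℤ} (hu : Monotone u) (h0 : u 0 = 0)
    (hlim : Tendsto u atTop atTop)
    (hX : ∀ i j : ℕ, i ≤ j → ∀ m : ℤ, X j ≤ m → m ≤ X i → ∃ k, i ≤ k ∧ k ≤ j ∧ X k = m)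
    {M : ℕ → ℕ} (hM : StrictMono M) (hXM : ∀ n, X (M n) = n) (hfirst : ∀ n, ∀ l < M n, X l ≠ n)
    (hM0 : M 0 = 0)
    {T : ℝ} (hT : 0 < T) (hlimM : Tendsto (fun n : ℕ => u (M n) / n) atTop (𝓝 T))
    {ε c : ℝ} (hε0 : 0 < ε) (hε1 : ε < 1) (hc : 0 < c)
    (hback : ∀ᶠ n : ℕ in atTop, ¬ ∃ i j k, (∀ l < i, X l ≠ n) ∧ X i = n ∧ i ≤ j ∧
      (∀ l, i ≤ l → l < j → X l ≠ ⌊(1 - ε) * n⌋₊) ∧ X j = ⌊(1 - ε) * n⌋₊ ∧ j ≤ k ∧ X k = n + 1 ∧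
      u k - u j ≤ c * n)
    {v : ℝ} (hv0 : 0 ≤ v) (hv : v * T < 1 - ε) :
    ∀ᶠ t : ℝ in atTop, v * t ≤ X (jumpCount u t) := by
  -- `w` is a speed for the running maximum: it is below `1 / T`, and `w (1 - ε)` still exceeds `v`
  -- by at least the `δ` below, which absorbs the rounding errors.
  obtain ⟨w, hw1, hw2⟩ : ∃ w : ℝ, v ≤ w * (1 - ε) - w * (1 - ε - v * T) / 2 ∧ 0 < w ∧ w * T < 1 := by
    by_cases hvz : v = 0
    · subst hvz
      refine ⟨1 / (2 * T), ?_, by positivity, ?_⟩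
      · have : 0 < 1 / (2 * T) := by positivity
        nlinarith
      · field_simp; norm_num
    · have hvp : 0 < v := lt_of_le_of_ne hv0 (Ne.symm hvz)
      have hvT : 0 < v * T := by positivity
      refine ⟨2 * v / (1 - ε + v * T), ?_, div_pos (by linarith) (by linarith), ?_⟩
      · have h1 : 2 * v / (1 - ε + v * T) * (1 - ε) - 2 * v / (1 - ε + v * T) * (1 - ε - v * T) / 2 =
            2 * v / (1 - ε + v * T) * ((1 - ε + v * T) / 2) := by ring
        rw [h1]
        apply le_of_eq
        have : (1 - ε + v * T) ≠ 0 := by linarith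
        field_simp
      · rw [div_mul_eq_mul_div, div_lt_one (by linarith)]
        linarith
  obtain ⟨hw0, hwT⟩ := hw2
  set δ := w * (1 - ε - v * T) / 2 with hδ
  have hδ0 : 0 < δ := by rw [hδ]; exact half_pos (mul_pos hw0 (by linarith))
  have hTw : T < 1 / w := by rw [lt_div_iff₀ hw0]; linarith
  have hev1 : ∀ᶠ n : ℕ in atTop, u (M n) ≤ 1 / w * n ∧ u (M n) ≤ (T + c / 4) * n ∧
      (T - c / 4) * n ≤ u (M n) := by
    filter_upwards [hlimM.eventually (gt_mem_nhds hTw),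
      hlimM.eventually (gt_mem_nhds (show T < T + c / 4 by linarith)),
      hlimM.eventually (lt_mem_nhds (show T - c / 4 < T by linarith)),
      eventually_gt_atTop 0] with n h1 h2 h3 hn
    have hn' : (0 : ℝ) < n := by exact_mod_cast hn
    rw [div_lt_iff₀ hn'] at h1 h2
    rw [lt_div_iff₀ hn'] at h3
    exact ⟨h1.le, h2.le, h3.le⟩
  obtain ⟨N1, hN1⟩ := eventually_atTop.1 hev1
  obtain ⟨N2, hN2⟩ := eventually_atTop.1 hback
  obtain ⟨N3, hN3⟩ := exists_nat_gt ((T + c / 4) / (c / 2))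
  set N := max (max N1 N2) (max N3 1) with hN
  filter_upwards [eventually_ge_atTop 0, eventually_ge_atTop (u (M (N + 1))),
    eventually_ge_atTop (2 / δ)] with t ht0 htN htδ
  obtain ⟨hK1, hK2⟩ := jumpCount_spec hu h0 hlim ht0
  set K := jumpCount u t with hK
  -- The least such `n` is the running maximum at time `t`: level `n` has been reached and level `n
  -- + 1` has not.
  have hex : ∃ n, K < M (n + 1) := ⟨K, lt_of_lt_of_le (Nat.lt_succ_self K) hM.le_apply⟩
  classical
  set n := Nat.find hex with hn
  have hnK : K < M (n + 1) := Nat.find_spec hex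
  have hMnK : M n ≤ K := by
    rcases Nat.eq_zero_or_pos n with h | h
    · rw [h, hM0]; exact Nat.zero_le _
    · have := Nat.find_min hex (m := n - 1) (by omega)
      rw [Nat.sub_add_cancel h] at this
      exact not_lt.1 this
  have hnN : N ≤ n := by
    by_contra hlt
    have h1 : M (n + 1) ≤ M (N + 1) := hM.monotone (by omega)
    have h2 : K + 1 ≤ M (N + 1) := by omega
    have := hu h2
    linarith
  have hn1 := hN1 n (by omega)
  have hn1' := hN1 (n + 1) (by omega)
  have hn3 : (N3 : ℝ) ≤ n := by exact_mod_cast (by omega : N3 ≤ n)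
  have htn : w * t ≤ n + 1 := by
    have h1 : u (K + 1) ≤ u (M (n + 1)) := hu (by omega)
    have h2 : t ≤ 1 / w * ((n + 1 : ℕ) : ℝ) := by linarith [hn1'.1]
    rw [one_div, inv_mul_eq_div, le_div_iff₀ hw0] at h2
    push_cast at h2
    linarith
  -- Both passage times are `T n` up to `c n / 4`; `N3` makes the extra `T + c / 4` at most `c n /
  -- 2`.
  have hgap : u (M (n + 1)) - u (M n) ≤ c * n := by
    have h1 := hn1'.2.1
    have h2 := hn1.2.2
    push_cast at h1
    have h3 : (T + c / 4) / (c / 2) < n := hN3.trans_le hn3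
    rw [div_lt_iff₀ (by linarith)] at h3
    nlinarith
  -- Otherwise the walk drops to `⌊(1 - ε) n⌋` between its first visits to `n` and `n + 1`, and it
  -- returns within time `c n`, against `hback`.
  have hpos : (⌊(1 - ε) * n⌋₊ : ℤ) < X K := by
    by_contra hle
    have hle' := not_lt.1 hle
    have hmn : (⌊(1 - ε) * n⌋₊ : ℤ) ≤ X (M n) := by
      rw [hXM]
      have h1 : (⌊(1 - ε) * n⌋₊ : ℝ) ≤ (1 - ε) * n :=
        Nat.floor_le (mul_nonneg (by linarith) n.cast_nonneg)
      have h2 : (⌊(1 - ε) * n⌋₊ : ℝ) ≤ n := by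
        nlinarith [(Nat.cast_nonneg n : (0 : ℝ) ≤ n)]
      exact_mod_cast h2
    obtain ⟨k0, hk1, hk2, hk3⟩ := hX (M n) K hMnK _ hle' hmn
    have hex2 : ∃ k, M n ≤ k ∧ X k = ⌊(1 - ε) * n⌋₊ := ⟨k0, hk1, hk3⟩
    obtain ⟨hj1, hj2⟩ := Nat.find_spec hex2
    have hj3 : Nat.find hex2 ≤ k0 := Nat.find_min' hex2 ⟨hk1, hk3⟩
    refine hN2 n (by omega) ⟨M n, Nat.find hex2, M (n + 1), hfirst n, hXM n, hj1, ?_, hj2, by omega,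
      ?_, ?_⟩
    · intro l hl1 hl2 hl3
      exact Nat.find_min hex2 hl2 ⟨hl1, hl3⟩
    · rw [hXM]; push_cast; ring
    · have := hu hj1
      linarith
  have h1 : (1 - ε) * n < ⌊(1 - ε) * n⌋₊ + 1 := Nat.lt_floor_add_one _
  have h2 : ((⌊(1 - ε) * n⌋₊ : ℝ)) + 1 ≤ X K := by exact_mod_cast hpos
  rw [div_le_iff₀ hδ0] at htδ
  have h3 : (1 - ε) * (w * t - 1) ≤ (1 - ε) * n :=
    mul_le_mul_of_nonneg_left (by linarith) (by linarith)
  have h4 : v * t ≤ (w * (1 - ε) - δ) * t := mul_le_mul_of_nonneg_right hw1 ht0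
  nlinarith

end BiasedWalk
end

noncomputable section
namespace BiasedWalk

open scoped ENNReal

/-! ### The stationary sequence of passage times -/

open Classical in
/-- The index of the first visit of the walk to `1` (and `0` should there be no visit). -/
def hitIndex (lam : ℝ) (p : Environment × Noise) : ℕ :=
  if h : ∃ k, envChain lam p k = 1 then Nat.find h else 0

lemma hitIndex_eq_iff {lam : ℝ} {p : Environment × Noise} (h : ∃ k, envChain lam p k = 1) (j : ℕ) :
    hitIndex lam p = j ↔ envChain lam p j = 1 ∧ ∀ l < j, envChain lam p l ≠ 1 := by
  classical
  rw [hitIndex, dif_pos h, Nat.find_eq_iff]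

lemma envChain_hitIndex {lam : ℝ} {p : Environment × Noise} (h : ∃ k, envChain lam p k = 1) :
    envChain lam p (hitIndex lam p) = 1 := ((hitIndex_eq_iff h _).1 rfl).1

lemma measurableSet_firstVisit (lam : ℝ) (j : ℕ) : MeasurableSet
    {p : Environment × Noise | envChain lam p j = 1 ∧ ∀ l < j, envChain lam p l ≠ 1} := by
  have : {p : Environment × Noise | envChain lam p j = 1 ∧ ∀ l < j, envChain lam p l ≠ 1} =
      {p | envChain lam p j = 1} ∩ ⋂ l ∈ Finset.range j, {p | envChain lam p l = 1}ᶜ := by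
    ext p
    simp
  rw [this]
  exact (measurable_envChain lam j (measurableSet_singleton 1)).inter
    (Finset.measurableSet_biInter _ fun l _ =>
      (measurable_envChain lam l (measurableSet_singleton 1)).compl)

lemma measurable_hitIndex (lam : ℝ) : Measurable (hitIndex lam) := by
  have hH : MeasurableSet {p : Environment × Noise | ∃ k, envChain lam p k = 1} := by
    rw [Set.ofPred_exists]
    exact MeasurableSet.iUnion fun k => measurable_envChain lam k (measurableSet_singleton 1)
  refine measurable_to_countable' fun j => ?_
  have : hitIndex lam ⁻¹' {j} =
      ({p | ∃ k, envChain lam p k = 1} ∩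
        {p | envChain lam p j = 1 ∧ ∀ l < j, envChain lam p l ≠ 1}) ∪
      ({p | ∃ k, envChain lam p k = 1}ᶜ ∩ {_p | 0 = j}) := by
    ext p
    by_cases h : ∃ k, envChain lam p k = 1
    · simp only [Set.mem_preimage, Set.mem_singleton_iff, hitIndex_eq_iff h, Set.mem_union,
        Set.mem_inter_iff, Set.mem_ofPred_eq, h, true_and, Set.mem_compl_iff, not_true_eq_false,
        false_and, or_false]
    · have hz : hitIndex lam p = 0 := dif_neg h
      simp only [Set.mem_preimage, Set.mem_singleton_iff, hz, Set.mem_union,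
        Set.mem_inter_iff, Set.mem_ofPred_eq, h, false_and, Set.mem_compl_iff, not_false_eq_true,
        true_and, false_or]
  rw [this]
  exact (hH.inter (measurableSet_firstVisit lam j)).union (hH.compl.inter (MeasurableSet.const _))

/-- Restart the walk at the first visit to `1`, and move the origin there. -/
def restart (lam : ℝ) (p : Environment × Noise) : Environment × Noise :=
  (shift p.1, shiftNoise (hitIndex lam p) p.2)

lemma measurable_shiftNoise_hitIndex (lam : ℝ) :
    Measurable fun p : Environment × Noise => shiftNoise (hitIndex lam p) p.2 := by
  have : Measurable fun q : Noise × ℕ => shiftNoise q.2 q.1 :=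
    measurable_from_prod_countable_left fun j => measurable_shiftNoise j
  exact this.comp (measurable_snd.prodMk (measurable_hitIndex lam))

/-- Strong Markov property at the first visit to `1`: the events that this visit occurs at step `j`
are disjoint, determined by the first `j` steps, and exhaust the space almost surely. -/
lemma map_shiftNoise_hitIndex {lam : ℝ} {ξ : Environment}
    (h : ∀ᵐ η ∂noiseLaw, ∃ k, envChain lam (ξ, η) k = 1) :
    noiseLaw.map (fun η => shiftNoise (hitIndex lam (ξ, η)) η) = noiseLaw := by
  have hm : Measurable fun η => shiftNoise (hitIndex lam (ξ, η)) η :=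
    (measurable_shiftNoise_hitIndex lam).comp measurable_prodMk_left
  ext B hB
  rw [Measure.map_apply hm hB]
  set A : ℕ → Set Noise := fun j =>
    {η | envChain lam (ξ, η) j = 1 ∧ ∀ l < j, envChain lam (ξ, η) l ≠ 1}
  have hA : ∀ j, MeasurableSet (A j) := fun j =>
    measurable_prodMk_left (measurableSet_firstVisit lam j)
  have hdep : ∀ j, ∀ η η' : Noise, (∀ i < j, η i = η' i) → η ∈ A j → η' ∈ A j := by
    rintro j η η' hη ⟨h1, h2⟩
    have hc : ∀ k ≤ j, envChain lam (ξ, η) k = envChain lam (ξ, η') k := fun k hk =>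
      chain_congr hη hk
    refine ⟨by rw [← hc j le_rfl]; exact h1, fun l hl => by rw [← hc l hl.le]; exact h2 l hl⟩
  have hdisj : Pairwise (Function.onFun Disjoint A) := by
    intro j j' hjj'
    refine Set.disjoint_left.2 ?_
    rintro η ⟨h1, h2⟩ ⟨h1', h2'⟩
    rcases lt_or_gt_of_ne hjj' with h | h
    · exact h2' _ h h1
    · exact h2 _ h h1'
  have hmem : ∀ η, (∃ k, envChain lam (ξ, η) k = 1) → η ∈ A (hitIndex lam (ξ, η)) := fun η hη =>
    (hitIndex_eq_iff hη _).1 rfl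
  have huniv : noiseLaw (⋃ j, A j) = 1 := by
    rw [prob_compl_eq_zero_iff (MeasurableSet.iUnion hA) |>.symm]
    refine mem_ae_iff.1 ?_
    filter_upwards [h] with η hη
    exact Set.mem_iUnion.2 ⟨_, hmem η hη⟩
  have hset : (fun η => shiftNoise (hitIndex lam (ξ, η)) η) ⁻¹' B =ᵐ[noiseLaw]
      ⋃ j, A j ∩ shiftNoise j ⁻¹' B := by
    filter_upwards [h] with η hη
    refine propext ⟨fun hB => ?_, fun hB => ?_⟩
    · exact Set.mem_iUnion.2 ⟨_, hmem η hη, hB⟩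
    · obtain ⟨j, h1, h2⟩ := Set.mem_iUnion.1 hB
      have : hitIndex lam (ξ, η) = j := (hitIndex_eq_iff hη j).2 h1
      change shiftNoise (hitIndex lam (ξ, η)) η ∈ B
      rw [this]
      exact h2
  rw [measure_congr hset, noiseLaw_iUnion_inter_shiftNoise hA hdisj hdep hB, huniv, one_mul]

variable {P : Measure Environment} [IsProbabilityMeasure P]

/-- The restart is a skew product over the shift of the environment, with measure-preserving fibre
maps. -/
lemma measurePreserving_restart (hP : MeasurePreserving shift P P) {lam : ℝ}
    (h : ∀ᵐ p ∂(P.prod noiseLaw), ∃ k, envChain lam p k = 1) :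
    MeasurePreserving (restart lam) (P.prod noiseLaw) (P.prod noiseLaw) :=
  hP.skew_product (g := fun ξ η => shiftNoise (hitIndex lam (ξ, η)) η)
    (measurable_shiftNoise_hitIndex lam)
    ((Measure.ae_ae_of_ae_prod h).mono fun _ hξ => map_shiftNoise_hitIndex hξ)

/-- The time of the passage from `0` to `1`. -/
def passageTime (lam : ℝ) (p : Environment × Noise) : ℝ := max 0 (envClock lam p (hitIndex lam p))

lemma measurable_passageTime (lam : ℝ) : Measurable (passageTime lam) := by
  have : Measurable fun q : (Environment × Noise) × ℕ => envClock lam q.1 q.2 :=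
    measurable_from_prod_countable_left fun j => measurable_envClock lam j
  exact measurable_const.max (this.comp (measurable_id.prodMk (measurable_hitIndex lam)))

/-- The passage clock of the walk in the environment. -/
abbrev envPassageClock (lam : ℝ) (p : Environment × Noise) : ℕ → ℝ≥0∞ :=
  passageClock (biasedRateMinus lam p.1) (biasedRatePlus lam p.1) 0 p.2

lemma lintegral_iSup_envPassageClock_le (P : Measure Environment) [IsProbabilityMeasure P]
    (lam : ℝ) :
    ∫⁻ p, ⨆ K, envPassageClock lam p K ∂(P.prod noiseLaw) ≤ meanPassage P lam := by
  have hm : ∀ K, Measurable fun p => envPassageClock lam p K := fun K =>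
    measurable_passageClock (fun x => (measurable_biasedRateMinus lam x).comp measurable_fst)
      (fun x => (measurable_biasedRatePlus lam x).comp measurable_fst) measurable_snd 0 K
  have hmono : Monotone fun K p => envPassageClock lam p K := by
    refine monotone_nat_of_le_succ fun K p => ?_
    simp only [envPassageClock, passageClock]
    rw [Finset.sum_range_succ]
    exact le_self_add
  rw [lintegral_iSup hm hmono]
  refine iSup_mono fun K => ?_
  rw [lintegral_prod _ (hm K).aemeasurable]
  refine lintegral_mono fun ξ => ?_
  refine (lintegral_passageClock_le (biasedRateMinus_pos lam ξ) (biasedRatePlus_pos lam ξ) K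
    zero_le_one).trans (le_of_eq ?_)
  have : Finset.Ico (0 : ℤ) 1 = {0} := by decide
  rw [this, Finset.sum_singleton]

lemma passageClock_eq {a b : ℤ → ℝ} {x : ℤ} {η : Noise} (hab : ∀ y, 0 < a y + b y)
    (hη : ∀ k, 0 ≤ (η k).2) {K : ℕ} (h : ∀ i < K, chain a b x η i ≠ 1) :
    passageClock a b x η K = ENNReal.ofReal (clock a b x η K) := by
  unfold passageClock clock
  rw [ENNReal.ofReal_sum_of_nonneg fun k _ => div_nonneg (hη k) (hab _).le]
  refine Finset.sum_congr rfl fun k hk => ?_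
  rw [if_pos fun i hi => h i (lt_of_le_of_lt hi (Finset.mem_range.1 hk))]

/-- On a path that never visits `1` the truncated passage times are the jump times themselves, which
tend to infinity; their supremum has finite mean. -/
lemma ae_exists_envChain_eq_one (hP : Ergodic shift P) {lam : ℝ} (hfin : meanPassage P lam ≠ ∞) :
    ∀ᵐ p ∂(P.prod noiseLaw), ∃ k, envChain lam p k = 1 := by
  have hm : Measurable fun p => ⨆ K, envPassageClock lam p K := Measurable.iSup fun K =>
    measurable_passageClock (fun x => (measurable_biasedRateMinus lam x).comp measurable_fst)
      (fun x => (measurable_biasedRatePlus lam x).comp measurable_fst) measurable_snd 0 K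
  have hlt := ae_lt_top hm
    (ne_top_of_le_ne_top hfin (lintegral_iSup_envPassageClock_le P lam))
  filter_upwards [hlt, ae_tendsto_envClock hP lam, ae_prod_of_ae_noise ae_noiseLaw_nonneg]
    with p h1 h2 h3
  by_contra hne
  push Not at hne
  obtain ⟨K, hK⟩ := (h2.eventually_gt_atTop (⨆ K, envPassageClock lam p K).toReal).exists
  have h4 := le_iSup (fun K => envPassageClock lam p K) K
  rw [show envPassageClock lam p K = ENNReal.ofReal (envClock lam p K) from
    passageClock_eq (fun y => add_pos (biasedRateMinus_pos lam p.1 y)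
      (biasedRatePlus_pos lam p.1 y)) h3 fun i _ => hne i] at h4
  exact absurd ((ENNReal.ofReal_le_iff_le_toReal h1.ne).1 h4) (not_le.2 hK)

lemma integral_passageTime_le (hP : Ergodic shift P) {lam : ℝ} (hfin : meanPassage P lam ≠ ∞) :
    Integrable (passageTime lam) (P.prod noiseLaw) ∧
      ∫ p, passageTime lam p ∂(P.prod noiseLaw) ≤ (meanPassage P lam).toReal := by
  have h0 : ∀ p, 0 ≤ passageTime lam p := fun p => le_max_left _ _
  have hle : ∫⁻ p, ENNReal.ofReal (passageTime lam p) ∂(P.prod noiseLaw) ≤ meanPassage P lam := by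
    refine le_trans (lintegral_mono_ae ?_) (lintegral_iSup_envPassageClock_le P lam)
    filter_upwards [ae_exists_envChain_eq_one hP hfin, ae_prod_of_ae_noise ae_noiseLaw_nonneg]
      with p h1 h2
    refine le_trans (le_of_eq ?_) (le_iSup _ (hitIndex lam p))
    have hab := fun y => add_pos (biasedRateMinus_pos lam p.1 y) (biasedRatePlus_pos lam p.1 y)
    rw [show envPassageClock lam p (hitIndex lam p) =
      ENNReal.ofReal (envClock lam p (hitIndex lam p)) from
      passageClock_eq hab h2 ((hitIndex_eq_iff h1 _).1 rfl).2,
      passageTime, max_eq_right (clock_nonneg hab h2 _)]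
  refine ⟨⟨(measurable_passageTime lam).aestronglyMeasurable, ?_⟩, ?_⟩
  · rw [hasFiniteIntegral_iff_ofReal (Eventually.of_forall h0)]
    exact hle.trans_lt (lt_top_iff_ne_top.2 hfin)
  · rw [integral_eq_lintegral_of_nonneg_ae (Eventually.of_forall h0)
      (measurable_passageTime lam).aestronglyMeasurable]
    exact ENNReal.toReal_mono hfin hle

/-- The index of the first visit to `n`, for a walk that visits all `n ≥ 0`. -/
def hitSum (lam : ℝ) (p : Environment × Noise) (n : ℕ) : ℕ :=
  ∑ k ∈ Finset.range n, hitIndex lam ((restart lam)^[k] p)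

lemma restart_iterate (lam : ℝ) (p : Environment × Noise) (n : ℕ) :
    (restart lam)^[n] p = (shift^[n] p.1, shiftNoise (hitSum lam p n) p.2) := by
  induction n with
  | zero => simp [hitSum]
  | succ n ih =>
    have h1 : (restart lam)^[n + 1] p = restart lam ((restart lam)^[n] p) :=
      Function.iterate_succ_apply' _ _ _
    have h2 : hitSum lam p (n + 1) = hitSum lam p n + hitIndex lam ((restart lam)^[n] p) :=
      Finset.sum_range_succ _ _
    rw [h1, h2, Function.iterate_succ_apply']
    conv_lhs => rw [restart]
    rw [show ((restart lam)^[n] p).2 = shiftNoise (hitSum lam p n) p.2 by rw [ih],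
      show ((restart lam)^[n] p).1 = shift^[n] p.1 by rw [ih], shiftNoise_shiftNoise]

lemma envChain_hitSum_add {lam : ℝ} {p : Environment × Noise} {n : ℕ}
    (h : envChain lam p (hitSum lam p n) = n) (k : ℕ) :
    envChain lam p (hitSum lam p n + k) = n + envChain lam ((restart lam)^[n] p) k ∧
    envClock lam p (hitSum lam p n + k) =
      envClock lam p (hitSum lam p n) + envClock lam ((restart lam)^[n] p) k := by
  simp only [envChain, envClock] at h ⊢
  rw [chain_add, clock_add, h, restart_iterate, biasedRateMinus_shift_iterate,
    biasedRatePlus_shift_iterate, ← chain_translate, ← clock_translate, zero_add]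
  exact ⟨rfl, rfl⟩

variable {lam : ℝ} {p : Environment × Noise}

/-- After reaching `n`, the walk seen from `n` is the restarted one; having steps `±1`, it cannot
pass `1` without visiting it. -/
lemma hitSum_spec (hp : ∀ n, ∃ k, envChain lam ((restart lam)^[n] p) k = 1) (n : ℕ) :
    envChain lam p (hitSum lam p n) = n ∧ ∀ l < hitSum lam p n, envChain lam p l < n := by
  induction n with
  | zero => simp [hitSum]
  | succ n ih =>
    have hs : hitSum lam p (n + 1) = hitSum lam p n + hitIndex lam ((restart lam)^[n] p) :=
      Finset.sum_range_succ _ _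
    rw [hs]
    have hadd := fun k => (envChain_hitSum_add ih.1 k).1
    refine ⟨by rw [hadd, envChain_hitIndex (hp n)]; push_cast; ring, fun l hl => ?_⟩
    push_cast
    rcases lt_or_ge l (hitSum lam p n) with h | h
    · have := ih.2 l h
      omega
    · obtain ⟨k, rfl⟩ := Nat.exists_eq_add_of_le h
      rw [hadd]
      have hfirst := ((hitIndex_eq_iff (hp n) _).1 rfl).2
      by_contra hge
      obtain ⟨i, -, hi2, hi3⟩ := exists_chain_eq
        (a := biasedRateMinus lam ((restart lam)^[n] p).1)
        (b := biasedRatePlus lam ((restart lam)^[n] p).1)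
        (x := 0) (η := ((restart lam)^[n] p).2) (Nat.zero_le k) (m := 1)
        (Or.inl ⟨by simp, by
          change 1 ≤ envChain lam ((restart lam)^[n] p) k
          omega⟩)
      exact hfirst i (by omega) hi3

lemma birkhoffSum_passageTime (hp : ∀ n, ∃ k, envChain lam ((restart lam)^[n] p) k = 1)
    (hη : ∀ k, 0 ≤ (p.2 k).2) (n : ℕ) :
    birkhoffSum (restart lam) (passageTime lam) n p = envClock lam p (hitSum lam p n) := by
  induction n with
  | zero => simp [hitSum]
  | succ n ih =>
    have hs : hitSum lam p (n + 1) = hitSum lam p n + hitIndex lam ((restart lam)^[n] p) :=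
      Finset.sum_range_succ _ _
    rw [hs, birkhoffSum_succ, ih, (envChain_hitSum_add (hitSum_spec hp n).1 _).2, passageTime,
      max_eq_right]
    refine clock_nonneg (fun y => add_pos (biasedRateMinus_pos lam _ y)
      (biasedRatePlus_pos lam _ y)) (fun k => ?_) _
    rw [restart_iterate]
    exact hη _

lemma strictMono_hitSum (hp : ∀ n, ∃ k, envChain lam ((restart lam)^[n] p) k = 1) :
    StrictMono (hitSum lam p) := by
  refine strictMono_nat_of_lt_succ fun n => ?_
  rw [show hitSum lam p (n + 1) = hitSum lam p n + hitIndex lam ((restart lam)^[n] p) from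
    Finset.sum_range_succ _ _]
  have : hitIndex lam ((restart lam)^[n] p) ≠ 0 := by
    intro h
    have := envChain_hitIndex (hp n)
    rw [h] at this
    simp at this
  omega

/-- The Chernoff estimate bounds the averages of the passage times below by `T`, and their common
mean is at most `T`. These two facts determine the limit. -/
lemma ae_tendsto_envClock_hitSum (hP : Ergodic shift P) (hfin : meanPassage P lam ≠ ∞) :
    ∀ᵐ p ∂(P.prod noiseLaw), (∀ n, ∃ k, envChain lam ((restart lam)^[n] p) k = 1) ∧
      Tendsto (fun n : ℕ => envClock lam p (hitSum lam p n) / n) atTop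
        (𝓝 (meanPassage P lam).toReal) := by
  have hhit := ae_exists_envChain_eq_one hP hfin
  have hpres := measurePreserving_restart hP.toMeasurePreserving hhit
  have hall : ∀ᵐ p ∂(P.prod noiseLaw), ∀ n, ∃ k, envChain lam ((restart lam)^[n] p) k = 1 :=
    ae_all_iff.2 fun n => (hpres.iterate n).quasiMeasurePreserving.ae hhit
  have hnn := ae_prod_of_ae_noise (P := P) ae_noiseLaw_nonneg
  set T := (meanPassage P lam).toReal with hT
  have hslow : ∀ c : ℝ, c < T → ∀ᵐ p ∂(P.prod noiseLaw),
      ∀ᶠ n : ℕ in atTop, c * n < envClock lam p (hitSum lam p n) := by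
    intro c hc
    have hc' : ENNReal.ofReal c < meanPassage P lam := by
      rcases le_or_gt 0 c with h | h
      · exact (ENNReal.ofReal_lt_iff_lt_toReal h hfin).2 hc
      · rw [ENNReal.ofReal_of_nonpos h.le]
        exact meanPassage_pos lam
    filter_upwards [ae_eventually_lt_envClock hP hc', hall] with p h1 h2
    filter_upwards [h1] with n hn using hn _ (hitSum_spec h2 n).1
  have hint := integral_passageTime_le hP hfin
  -- The `max` with `0` in `passageTime` gives nonnegativity at every point, as the ergodic lemmas
  -- require; it changes the passage time only on a null set.
  have h0 : ∀ p, 0 ≤ passageTime lam p := fun p => le_max_left _ _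
  have hfast : ∀ d : ℝ, T < d → ∀ᵐ p ∂(P.prod noiseLaw),
      p ∉ upperSet (restart lam) (passageTime lam) d := by
    intro d hd
    refine ae_notMem_upperSet_of_lowerSet hpres (measurable_passageTime lam) hint.1 h0 hint.2 ?_ hd
    intro c _ hc
    obtain ⟨q, hq1, hq2⟩ := exists_rat_btwn hc
    filter_upwards [hslow q hq2, hall, hnn] with p h1 h2 h3
    refine ⟨q, hq1, ?_⟩
    filter_upwards [h1] with n hn
    rw [birkhoffSum_passageTime h2 h3]
    exact hn.le
  have h1 : ∀ᵐ p ∂(P.prod noiseLaw), ∀ i : ℕ, ∀ᶠ n : ℕ in atTop,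
      (T - 1 / (i + 1)) * n < envClock lam p (hitSum lam p n) :=
    ae_all_iff.2 fun i => hslow _ (by linarith [Nat.one_div_pos_of_nat (α := ℝ) (n := i)])
  have h2 : ∀ᵐ p ∂(P.prod noiseLaw), ∀ i : ℕ,
      p ∉ upperSet (restart lam) (passageTime lam) (T + 1 / (i + 1)) :=
    ae_all_iff.2 fun i => hfast _ (by linarith [Nat.one_div_pos_of_nat (α := ℝ) (n := i)])
  filter_upwards [h1, h2, hall, hnn] with p h3 h4 h5 h6
  refine ⟨h5, ?_⟩
  rw [tendsto_order]
  constructor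
  · intro c hc
    obtain ⟨i, hi⟩ := exists_nat_one_div_lt (sub_pos.2 hc)
    filter_upwards [h3 i, eventually_gt_atTop 0] with n hn hn0
    have hn' : (0 : ℝ) < n := by exact_mod_cast hn0
    rw [lt_div_iff₀ hn']
    nlinarith
  · intro d hd
    obtain ⟨i, hi⟩ := exists_nat_one_div_lt (sub_pos.2 hd)
    obtain ⟨q, hq1, hq2⟩ := exists_rat_btwn (show T + 1 / (i + 1) < d by linarith)
    have : ¬ ∃ᶠ n : ℕ in atTop, q * n ≤ birkhoffSum (restart lam) (passageTime lam) n p :=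
      fun h => h4 i ⟨q, hq1, h⟩
    rw [not_frequently] at this
    filter_upwards [this, eventually_gt_atTop 0] with n hn hn0
    have hn' : (0 : ℝ) < n := by exact_mod_cast hn0
    rw [birkhoffSum_passageTime h5 h6] at hn
    rw [div_lt_iff₀ hn']
    nlinarith

end BiasedWalk
end

noncomputable section
namespace BiasedWalk

open scoped ENNReal

/-! ### The asymptotic velocity -/

variable {P : Measure Environment} [IsProbabilityMeasure P] {lam : ℝ}

lemma sum_Ico_eq_sub (f : ℤ → ℝ) {m n : ℕ} (h : m ≤ n) :
    ∑ k ∈ Finset.Ico (m : ℤ) n, f k =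
      ∑ k ∈ Finset.Ico (0 : ℤ) n, f k - ∑ k ∈ Finset.Ico (0 : ℤ) m, f k := by
  rw [eq_sub_iff_add_eq, add_comm, ← Finset.sum_union]
  · congr 1
    ext k
    simp only [Finset.mem_union, Finset.mem_Ico]
    omega
  · rw [Finset.disjoint_left]
    intro k
    simp only [Finset.mem_Ico]
    omega

/-- After a long backtracking, the walk does not come back fast. -/
lemma exists_ae_eventually_not_recross (hP : Ergodic shift P) (lam : ℝ) {ε : ℝ} (hε0 : 0 < ε)
    (hε1 : ε < 1) :
    ∃ c : ℝ, 0 < c ∧ ∀ᵐ p ∂(P.prod noiseLaw), ∀ᶠ n : ℕ in atTop,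
      ¬ ∃ i j k, (∀ l < i, envChain lam p l ≠ n) ∧ envChain lam p i = n ∧ i ≤ j ∧
      (∀ l, i ≤ l → l < j → envChain lam p l ≠ ⌊(1 - ε) * n⌋₊) ∧
      envChain lam p j = ⌊(1 - ε) * n⌋₊ ∧ j ≤ k ∧ envChain lam p k = n + 1 ∧
      envClock lam p k - envClock lam p j ≤ c * n := by
  obtain ⟨c₀, hc₀, hc₀'⟩ := exists_ofReal_lt_meanPassage P lam
  obtain ⟨J, s, hs, hlt⟩ := exists_lt_integral_laplaceIter hc₀'
  set κ := ∫ ξ, laplaceIter (biasedRateMinus lam ξ) (biasedRatePlus lam ξ) s J 0 ∂P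
  have hκ : 0 < κ := lt_trans (by positivity) hlt
  -- The sites between `(1 - ε) n` and `n` contribute about `κ ε n` to the exponent. This `c` makes
  -- the time term `s c n` only a quarter of that, and the errors of the ergodic averages at most
  -- another quarter.
  refine ⟨κ * ε / (4 * s), by positivity, ?_⟩
  have hmeas : MeasurableSet {p : Environment × Noise | ∀ᶠ n : ℕ in atTop,
      ¬ ∃ i j k, (∀ l < i, envChain lam p l ≠ n) ∧ envChain lam p i = n ∧ i ≤ j ∧
      (∀ l, i ≤ l → l < j → envChain lam p l ≠ ⌊(1 - ε) * n⌋₊) ∧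
      envChain lam p j = ⌊(1 - ε) * n⌋₊ ∧ j ≤ k ∧ envChain lam p k = n + 1 ∧
      envClock lam p k - envClock lam p j ≤ κ * ε / (4 * s) * n} := by
    have hX : ∀ (k : ℕ) (y : ℤ), Measurable fun p : Environment × Noise => envChain lam p k = y :=
      fun k y => measurableSet_setOfPred.1 (measurable_envChain lam k (measurableSet_singleton y))
    have hU : ∀ (j k : ℕ) (t : ℝ), Measurable fun p : Environment × Noise =>
        envClock lam p k - envClock lam p j ≤ t := fun j k t =>
      measurableSet_setOfPred.1 (measurableSet_le
        ((measurable_envClock lam k).sub (measurable_envClock lam j)) measurable_const)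
    simp only [eventually_atTop]
    refine measurableSet_setOfPred.2 ?_
    refine Measurable.exists fun N => Measurable.forall fun n => Measurable.imp measurable_const
      (Measurable.not (Measurable.exists fun i => Measurable.exists fun j =>
        Measurable.exists fun k => ?_))
    refine Measurable.and (Measurable.forall fun l => Measurable.imp measurable_const (hX l _).not) ?_
    refine (hX i _).and (Measurable.and measurable_const ?_)
    refine Measurable.and (Measurable.forall fun l => Measurable.imp measurable_const
      (Measurable.imp measurable_const (hX l _).not)) ?_
    exact (hX j _).and (Measurable.and measurable_const ((hX k _).and (hU j k _)))
  rw [Measure.ae_prod_iff_ae_ae hmeas]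
  filter_upwards [ae_tendsto_birkhoffSum_laplaceIter hP lam hs.le J] with ξ hξ
  set S : ℕ → ℝ := fun n => birkhoffSum shift (fun ξ =>
    laplaceIter (biasedRateMinus lam ξ) (biasedRatePlus lam ξ) s J 0) n ξ with hS
  have hb := isLaplaceBound_laplaceIter (biasedRateMinus_pos lam ξ) (biasedRatePlus_pos lam ξ)
    hs.le J
  have hδ : 0 < κ * ε / 8 := by positivity
  have hbd : ∀ᶠ n : ℕ in atTop, (κ - κ * ε / 8) * n ≤ S n ∧ S n ≤ (κ + κ * ε / 8) * n := by
    filter_upwards [hξ.eventually (lt_mem_nhds (show κ - κ * ε / 8 < κ by linarith)),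
      hξ.eventually (gt_mem_nhds (show κ < κ + κ * ε / 8 by linarith)), eventually_gt_atTop 0]
      with n h1 h2 hn
    have hn' : (0 : ℝ) < n := by exact_mod_cast hn
    rw [lt_div_iff₀ hn'] at h1
    rw [div_lt_iff₀ hn'] at h2
    exact ⟨h1.le, h2.le⟩
  have hfloor : Tendsto (fun n : ℕ => ⌊(1 - ε) * (n : ℝ)⌋₊) atTop atTop :=
    tendsto_nat_floor_atTop.comp
      (tendsto_natCast_atTop_atTop.const_mul_atTop (by linarith))
  have hev : ∀ᶠ n : ℕ in atTop, noiseLaw {η | ∃ i j k,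
      (∀ l < i, envChain lam (ξ, η) l ≠ n) ∧ envChain lam (ξ, η) i = n ∧ i ≤ j ∧
      (∀ l, i ≤ l → l < j → envChain lam (ξ, η) l ≠ ⌊(1 - ε) * n⌋₊) ∧
      envChain lam (ξ, η) j = ⌊(1 - ε) * n⌋₊ ∧ j ≤ k ∧ envChain lam (ξ, η) k = n + 1 ∧
      envClock lam (ξ, η) k - envClock lam (ξ, η) j ≤ κ * ε / (4 * s) * n} ≤
      ENNReal.ofReal (Real.exp (-(κ * ε / 4) * n)) := by
    filter_upwards [(tendsto_add_atTop_nat 1).eventually hbd, hfloor.eventually hbd] with n h1 h2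
    have hfl : (⌊(1 - ε) * n⌋₊ : ℝ) ≤ (1 - ε) * n :=
      Nat.floor_le (mul_nonneg (by linarith) n.cast_nonneg)
    have hfn : ⌊(1 - ε) * (n : ℝ)⌋₊ ≤ n := by
      have : (⌊(1 - ε) * n⌋₊ : ℝ) ≤ n := by nlinarith [(Nat.cast_nonneg n : (0 : ℝ) ≤ n)]
      exact_mod_cast this
    refine (noiseLaw_recross_le (biasedRateMinus_pos lam ξ) (biasedRatePlus_pos lam ξ) hs.le hb
      (m := (⌊(1 - ε) * (n : ℝ)⌋₊ : ℤ)) (n := n) (by exact_mod_cast hfn) _).trans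
      (ENNReal.ofReal_le_ofReal (Real.exp_le_exp.2 ?_))
    have hsum := sum_Ico_eq_sub
      (laplaceIter (biasedRateMinus lam ξ) (biasedRatePlus lam ξ) s J)
      (show ⌊(1 - ε) * (n : ℝ)⌋₊ ≤ n + 1 by omega)
    rw [sum_Ico_laplaceIter, sum_Ico_laplaceIter] at hsum
    push_cast at hsum
    rw [hsum]
    change _ - (S (n + 1) - S ⌊(1 - ε) * (n : ℝ)⌋₊) ≤ _
    have h3 := h1.1
    have h4 := h2.2
    push_cast at h3
    have h5 : s * (κ * ε / (4 * s) * n) = κ * ε / 4 * n := by field_simp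
    rw [h5]
    have h6 : (κ + κ * ε / 8) * ⌊(1 - ε) * (n : ℝ)⌋₊ ≤ (κ + κ * ε / 8) * ((1 - ε) * n) :=
      mul_le_mul_of_nonneg_left hfl (by positivity)
    have hn0 : (0 : ℝ) ≤ n := n.cast_nonneg
    have h7 : 0 ≤ κ * ε * n := by positivity
    have h8 : 0 ≤ κ * ε * ε * n := by positivity
    have h9 : κ * ε * 1 ≤ κ * 8 := by nlinarith
    nlinarith
  filter_upwards [ae_eventually_notMem_of_exp (by positivity) hev] with η hη using hη

lemma isAsymptoticVelocity_iff {P : Measure Environment} {v : ℝ} : IsAsymptoticVelocity P lam v ↔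
    ∀ᵐ p ∂(P.prod noiseLaw), Tendsto (envClock lam p) atTop atTop ∧
      Tendsto (fun t : ℝ => (envChain lam p (jumpCount (envClock lam p) t) : ℝ) / t) atTop
        (𝓝 v) := by
  unfold IsAsymptoticVelocity
  simp_rw [jumpTime_eq, walk_eq]
  rfl

/-- The upper bound on the walk in terms of the mean passage time. -/
lemma ae_eventually_walk_le (hP : Ergodic shift P) {c : ℝ} (hc0 : 0 < c)
    (hc : ENNReal.ofReal c < meanPassage P lam) : ∀ᵐ p ∂(P.prod noiseLaw), ∀ᶠ t : ℝ in atTop,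
      (envChain lam p (jumpCount (envClock lam p) t) : ℝ) ≤ t / c := by
  filter_upwards [ae_eventually_lt_envClock hP hc, ae_tendsto_envClock hP lam,
    ae_prod_of_ae_noise ae_noiseLaw_nonneg] with p h1 h2 h3
  exact eventually_apply_jumpCount_le (clock_mono (fun y => add_pos (biasedRateMinus_pos lam _ y)
      (biasedRatePlus_pos lam _ y)) h3) (clock_zero _ _) h2 hc0 h1

/-- Slow passage gives the upper bound, and the running maximum together with limited backtracking
the lower one. The null sets are collected over rational `q` only: a time constant below `T` in
`hup`, a backtracking fraction in `hlo`. -/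
theorem isAsymptoticVelocity_of_meanPassage_ne_top (hP : Ergodic shift P)
    (hfin : meanPassage P lam ≠ ∞) :
    IsAsymptoticVelocity P lam (meanPassage P lam)⁻¹.toReal := by
  rw [isAsymptoticVelocity_iff, ENNReal.toReal_inv]
  have hT : 0 < (meanPassage P lam).toReal := ENNReal.toReal_pos (meanPassage_pos lam).ne' hfin
  set T := (meanPassage P lam).toReal with hTdef
  have hup : ∀ᵐ p ∂(P.prod noiseLaw), ∀ q : ℚ, (0 : ℝ) < q → (q : ℝ) < T →
      ∀ᶠ t : ℝ in atTop, (envChain lam p (jumpCount (envClock lam p) t) : ℝ) ≤ t / q := by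
    refine ae_all_iff.2 fun q => ?_
    by_cases hq : (0 : ℝ) < q ∧ (q : ℝ) < T
    · filter_upwards [ae_eventually_walk_le hP hq.1
        ((ENNReal.ofReal_lt_iff_lt_toReal hq.1.le hfin).2 hq.2)] with p hp _ _ using hp
    · exact Eventually.of_forall fun p h1 h2 => absurd ⟨h1, h2⟩ hq
  have hlo : ∀ᵐ p ∂(P.prod noiseLaw), ∀ q : ℚ, (0 : ℝ) < q → (q : ℝ) < 1 → ∀ v : ℝ, 0 ≤ v →
      v * T < 1 - q →
      ∀ᶠ t : ℝ in atTop, v * t ≤ (envChain lam p (jumpCount (envClock lam p) t) : ℝ) := by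
    refine ae_all_iff.2 fun q => ?_
    by_cases hq : (0 : ℝ) < q ∧ (q : ℝ) < 1
    · obtain ⟨c, hc0, hc⟩ := exists_ae_eventually_not_recross hP lam hq.1 hq.2
      filter_upwards [hc, ae_tendsto_envClock hP lam, ae_prod_of_ae_noise ae_noiseLaw_nonneg,
        ae_tendsto_envClock_hitSum hP hfin] with p h1 h2 h3 h4 _ _ v hv0 hv
      have hspec := hitSum_spec h4.1
      exact eventually_le_apply_jumpCount
        (clock_mono (fun y => add_pos (biasedRateMinus_pos lam _ y)
          (biasedRatePlus_pos lam _ y)) h3) (clock_zero _ _) h2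
        (fun i j hij m h5 h6 => exists_chain_eq hij (Or.inr ⟨h5, h6⟩))
        (strictMono_hitSum h4.1) (fun n => (hspec n).1) (fun n l hl => ((hspec n).2 l hl).ne)
        rfl hT h4.2 hq.1 hq.2 hc0 h1 hv0 hv
    · exact Eventually.of_forall fun p h1 h2 => absurd ⟨h1, h2⟩ hq
  filter_upwards [hup, hlo, ae_tendsto_envClock hP lam] with p h1 h2 h3
  refine ⟨h3, ?_⟩
  rw [tendsto_order]
  constructor
  · intro a ha
    obtain ⟨v, hv1, hv2⟩ := exists_between (max_lt ha (inv_pos.2 hT))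
    have hvT : v * T < 1 := by rwa [← lt_div_iff₀ hT, one_div]
    obtain ⟨q, hq1, hq2⟩ := exists_rat_btwn (show 0 < min (1 - v * T) 1 from
      lt_min (by linarith) one_pos)
    have hv0 : 0 ≤ v := (le_max_right _ _).trans hv1.le
    filter_upwards [h2 q hq1 (hq2.trans_le (min_le_right _ _)) v hv0
      (by linarith [hq2.trans_le (min_le_left _ _)]), eventually_gt_atTop 0] with t ht ht0
    exact lt_of_lt_of_le (lt_of_le_of_lt (le_max_left _ _) hv1) ((le_div_iff₀ ht0).2 ht)
  · intro b hb
    have hb0 : 0 < b := (inv_pos.2 hT).trans hb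
    obtain ⟨q, hq1, hq2⟩ := exists_rat_btwn (inv_lt_of_inv_lt₀ hT hb)
    have hq0 : (0 : ℝ) < q := (inv_pos.2 hb0).trans hq1
    filter_upwards [h1 q hq0 hq2, eventually_gt_atTop 0] with t ht ht0
    rw [div_lt_iff₀ ht0]
    refine lt_of_le_of_lt ht ?_
    rw [div_eq_inv_mul]
    exact mul_lt_mul_of_pos_right (inv_lt_of_inv_lt₀ hb0 hq1) ht0

/-- With both means infinite, the slow-passage bound holds in both directions with every constant `i
+ 1`. -/
theorem isAsymptoticVelocity_zero (hP : Ergodic shift P) (hinf : meanPassage P lam = ∞)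
    (hinf' : meanPassage (P.map mirror) (-lam) = ∞) : IsAsymptoticVelocity P lam 0 := by
  rw [isAsymptoticVelocity_iff]
  have hprob := Measure.isProbabilityMeasure_map (μ := P) measurable_mirror.aemeasurable
  have h1 : ∀ᵐ p ∂(P.prod noiseLaw), ∀ i : ℕ, ∀ᶠ t : ℝ in atTop,
      (envChain lam p (jumpCount (envClock lam p) t) : ℝ) ≤ t / (i + 1 : ℕ) :=
    ae_all_iff.2 fun i => ae_eventually_walk_le hP (by positivity) (by rw [hinf]; simp)
  have h2 : ∀ᵐ p ∂((P.map mirror).prod noiseLaw), ∀ i : ℕ, ∀ᶠ t : ℝ in atTop,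
      (envChain (-lam) p (jumpCount (envClock (-lam) p) t) : ℝ) ≤ t / (i + 1 : ℕ) :=
    ae_all_iff.2 fun i => ae_eventually_walk_le (ergodic_mirror hP) (by positivity)
      (by rw [hinf']; simp)
  have h3 := (measurePreserving_mirrorBoth (P := P)).quasiMeasurePreserving.ae h2
  filter_upwards [h1, h3, ae_envChain_mirrorBoth lam, ae_tendsto_envClock hP lam]
    with p h1 h2 hm h4
  refine ⟨h4, ?_⟩
  have hc : envClock (-lam) (mirrorBoth p) = envClock lam p := funext (envClock_mirrorBoth hm)
  simp_rw [hc, hm] at h2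
  rw [Metric.tendsto_nhds]
  intro ε hε
  obtain ⟨i, hi⟩ := exists_nat_one_div_lt hε
  filter_upwards [h1 i, h2 i, eventually_gt_atTop 0] with t h5 h6 ht
  rw [Real.dist_eq, sub_zero, abs_div, abs_of_pos ht, div_lt_iff₀ ht]
  have h7 : t / ((i + 1 : ℕ) : ℝ) < ε * t := by
    rw [div_eq_mul_one_div, mul_comm]
    push_cast
    exact mul_lt_mul_of_pos_right hi ht
  rw [abs_lt]
  push_cast at h6 h7
  push_cast at h5
  constructor <;> linarith

end BiasedWalk
end

noncomputable section
namespace BiasedWalk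

open scoped ENNReal

/-! ### The mean passage time as a function of the bias -/

/-- The series `∑ e^{-(2k+1)λ} α_k`. -/
def expSeries (α : ℕ → ℝ≥0∞) (lam : ℝ) : ℝ≥0∞ :=
  ∑' k : ℕ, ENNReal.ofReal (Real.exp (-(2 * k + 1) * lam)) * α k

/-- The reciprocal of `expSeries`, which is `0` where the series diverges. -/
def recipSeries (α : ℕ → ℝ≥0∞) (lam : ℝ) : ℝ := (expSeries α lam)⁻¹.toReal

variable {α : ℕ → ℝ≥0∞}

lemma expSeries_term_le {lam mu : ℝ} (h : lam ≤ mu) (k : ℕ) :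
    ENNReal.ofReal (Real.exp (-(2 * k + 1) * mu)) * α k ≤
      ENNReal.ofReal (Real.exp (-(2 * k + 1) * lam)) * α k := by
  gcongr ?_ * _
  refine ENNReal.ofReal_le_ofReal (Real.exp_le_exp.2 ?_)
  have : (0 : ℝ) ≤ k := k.cast_nonneg
  nlinarith

lemma expSeries_antitone : Antitone (expSeries α) := fun _ _ h =>
  ENNReal.tsum_le_tsum fun k => expSeries_term_le h k

lemma expSeries_ne_zero (h0 : α 0 ≠ 0) (lam : ℝ) : expSeries α lam ≠ 0 := by
  intro h
  have := ENNReal.tsum_eq_zero.1 h 0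
  rw [mul_eq_zero, ENNReal.ofReal_eq_zero] at this
  exact this.elim (fun h => absurd h (not_le.2 (Real.exp_pos _))) h0

lemma expSeries_apply_ne_top {lam : ℝ} (h : expSeries α lam ≠ ∞) (k : ℕ) : α k ≠ ∞ := by
  intro hk
  have := ENNReal.ne_top_of_tsum_ne_top h k
  rw [hk, ENNReal.mul_top] at this
  · exact this rfl
  · exact (ENNReal.ofReal_pos.2 (Real.exp_pos _)).ne'

/-- All terms are nonincreasing in the bias, and the term `k = 0` decreases strictly. -/
lemma expSeries_lt (h0 : α 0 ≠ 0) {lam mu : ℝ} (h : lam < mu) (hfin : expSeries α lam ≠ ∞) :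
    expSeries α mu < expSeries α lam := by
  refine ENNReal.tsum_lt_tsum (i := 0) (ne_top_of_le_ne_top hfin (expSeries_antitone h.le))
    (fun k => expSeries_term_le h.le k) ?_
  refine ENNReal.mul_lt_mul_left h0 (expSeries_apply_ne_top hfin 0) ?_
  exact (ENNReal.ofReal_lt_ofReal_iff (Real.exp_pos _)).2 (Real.exp_lt_exp.2 (by
    push_cast; linarith))

lemma recipSeries_nonneg (lam : ℝ) : 0 ≤ recipSeries α lam := ENNReal.toReal_nonneg

lemma recipSeries_eq_zero {lam : ℝ} (h : expSeries α lam = ∞) : recipSeries α lam = 0 := by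
  simp [recipSeries, h]

lemma recipSeries_mono (h0 : α 0 ≠ 0) : Monotone (recipSeries α) := fun _ mu h =>
  ENNReal.toReal_mono (ENNReal.inv_ne_top.2 (expSeries_ne_zero h0 mu))
    (ENNReal.inv_le_inv.2 (expSeries_antitone h))

lemma recipSeries_lt (h0 : α 0 ≠ 0) {lam mu : ℝ} (h : lam < mu) (hfin : expSeries α lam ≠ ∞) :
    recipSeries α lam < recipSeries α mu :=
  ENNReal.toReal_strict_mono (ENNReal.inv_ne_top.2 (expSeries_ne_zero h0 mu))
    (ENNReal.inv_lt_inv.2 (expSeries_lt h0 h hfin))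

lemma expSeries_toReal {lam : ℝ} (hfin : expSeries α lam ≠ ∞) :
    Summable (fun k : ℕ => (α k).toReal * Real.exp (-2 * lam) ^ k) ∧ (expSeries α lam).toReal =
      Real.exp (-lam) * ∑' k : ℕ, (α k).toReal * Real.exp (-2 * lam) ^ k := by
  have hterm : ∀ k : ℕ, (ENNReal.ofReal (Real.exp (-(2 * k + 1) * lam)) * α k).toReal =
      Real.exp (-lam) * ((α k).toReal * Real.exp (-2 * lam) ^ k) := by
    intro k
    rw [ENNReal.toReal_mul, ENNReal.toReal_ofReal (Real.exp_pos _).le, ← Real.exp_nat_mul,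
      mul_left_comm, ← Real.exp_add, mul_comm]
    congr 2
    ring
  have hs := ENNReal.summable_toReal hfin
  simp_rw [hterm] at hs
  refine ⟨(summable_mul_left_iff (Real.exp_pos _).ne').1 hs, ?_⟩
  unfold expSeries
  rw [ENNReal.tsum_toReal_eq (ENNReal.ne_top_of_tsum_ne_top hfin), ← tsum_mul_left]
  exact tsum_congr hterm

/-- Summability at `r` makes the terms bounded there, so the radius of convergence is at least `r`.
-/
lemma analyticAt_tsum_mul_pow {c : ℕ → ℝ} {r : ℝ} (hr : 0 < r)
    (hs : Summable fun k => c k * r ^ k) {z : ℝ} (hz : |z| < r) :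
    AnalyticAt ℝ (fun z => ∑' k : ℕ, c k * z ^ k) z := by
  set q := FormalMultilinearSeries.ofScalars ℝ c
  have hrad : ENNReal.ofReal r ≤ q.radius := by
    refine q.le_radius_of_tendsto (r := ⟨r, hr.le⟩) (l := 0) ?_ |>.trans' (le_of_eq ?_)
    · have := hs.tendsto_atTop_zero.norm
      rw [norm_zero] at this
      refine this.congr fun k => ?_
      rw [FormalMultilinearSeries.ofScalars_norm, norm_mul, norm_pow, Real.norm_of_nonneg hr.le]
      rfl
    · rw [ENNReal.ofReal]
      congr 1
      exact NNReal.eq (max_eq_left hr.le)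
  have hpos : 0 < q.radius := (ENNReal.ofReal_pos.2 hr).trans_le hrad
  have hball := q.hasFPowerSeriesOnBall hpos
  have hsum : q.sum = fun z => ∑' k : ℕ, c k * z ^ k := by
    funext z
    exact FormalMultilinearSeries.ofScalars_sum_eq c z
  rw [← hsum]
  refine hball.analyticAt_of_mem ?_
  refine Metric.eball_subset_eball hrad ?_
  rw [Metric.mem_eball, edist_dist, Real.dist_eq, sub_zero]
  exact (ENNReal.ofReal_lt_ofReal_iff hr).2 hz

/-- In the variable `z = e^{-2λ}` the series is, up to the factor `e^{-λ}`, a power series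
converging at `e^{-2μ}`; since `μ < λ`, the point `z` lies inside the disc. The sum does not vanish
because `α 0 ≠ 0`. -/
lemma analyticAt_recipSeries (h0 : α 0 ≠ 0) {lam mu : ℝ} (h : mu < lam)
    (hfin : expSeries α mu ≠ ∞) : AnalyticAt ℝ (recipSeries α) lam := by
  have hfin' : ∀ l, mu < l → expSeries α l ≠ ∞ := fun l hl =>
    ne_top_of_le_ne_top hfin (expSeries_antitone hl.le)
  have hF : AnalyticAt ℝ (fun z => ∑' k : ℕ, (α k).toReal * z ^ k) (Real.exp (-2 * lam)) := by
    refine analyticAt_tsum_mul_pow (Real.exp_pos (-2 * mu)) (expSeries_toReal hfin).1 ?_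
    rw [abs_of_pos (Real.exp_pos _)]
    exact Real.exp_lt_exp.2 (by linarith)
  have hin : AnalyticAt ℝ (fun l : ℝ => Real.exp (-2 * l)) lam := by fun_prop
  have hA : AnalyticAt ℝ (fun l : ℝ => Real.exp (-l) *
      ∑' k : ℕ, (α k).toReal * Real.exp (-2 * l) ^ k) lam := by
    refine AnalyticAt.mul (by fun_prop) ?_
    exact AnalyticAt.fun_comp (g := fun z => ∑' k : ℕ, (α k).toReal * z ^ k) hF hin
  have hne : Real.exp (-lam) * ∑' k : ℕ, (α k).toReal * Real.exp (-2 * lam) ^ k ≠ 0 := by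
    rw [← (expSeries_toReal (hfin' lam h)).2]
    exact (ENNReal.toReal_pos (expSeries_ne_zero h0 _) (hfin' lam h)).ne'
  refine (hA.inv hne).congr ?_
  filter_upwards [lt_mem_nhds h] with l hl
  rw [recipSeries, ENNReal.toReal_inv, (expSeries_toReal (hfin' l hl)).2]
  rfl

/-! ### Series expansion of the mean passage time -/

/-- The terms of the series for the mean passage time from `x` to `x + 1`. -/
def passageWeight (a b : ℤ → ℝ) : ℕ → ℤ → ℝ
  | 0, x => 1 / b x
  | k + 1, x => a x / b x * passageWeight a b k (x - 1)

lemma meanIter_eq_sum (a b : ℤ → ℝ) (j : ℕ) (x : ℤ) :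
    meanIter a b j x = ∑ k ∈ Finset.range j, passageWeight a b k x := by
  induction j generalizing x with
  | zero => rfl
  | succ j ih =>
    rw [Finset.sum_range_succ', meanIter, ih]
    simp only [passageWeight]
    rw [← Finset.mul_sum]
    ring

/-- The `k`-th term has `k + 1` rates to the right in its denominator and `k` rates to the left in
its numerator, hence `2k + 1` factors `e^{-λ}`. -/
lemma passageWeight_biased (lam : ℝ) (ξ : Environment) (k : ℕ) (x : ℤ) :
    passageWeight (biasedRateMinus lam ξ) (biasedRatePlus lam ξ) k x =
      Real.exp (-(2 * k + 1) * lam) * passageWeight (rateMinus ξ) (ratePlus ξ) k x := by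
  induction k generalizing x with
  | zero =>
    simp only [passageWeight, biasedRatePlus, Nat.cast_zero, mul_zero, zero_add]
    rw [one_div, mul_inv, ← Real.exp_neg, one_div, mul_comm]
    congr 2; ring
  | succ k ih =>
    simp only [passageWeight]
    rw [ih, biasedRateMinus, biasedRatePlus, mul_div_mul_comm, ← Real.exp_sub, mul_mul_mul_comm,
      mul_comm (rateMinus ξ x / ratePlus ξ x), mul_mul_mul_comm, ← Real.exp_add]
    rw [mul_comm (rateMinus ξ x / ratePlus ξ x)]
    congr 2
    push_cast; ring

lemma passageWeight_pos (ξ : Environment) (k : ℕ) (x : ℤ) :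
    0 < passageWeight (rateMinus ξ) (ratePlus ξ) k x := by
  induction k generalizing x with
  | zero => exact one_div_pos.2 (ratePlus_pos ξ x)
  | succ k ih => exact mul_pos (div_pos (rateMinus_pos ξ x) (ratePlus_pos ξ x)) (ih _)

lemma measurable_passageWeight (k : ℕ) (x : ℤ) : Measurable fun ξ : Environment =>
    passageWeight (rateMinus ξ) (ratePlus ξ) k x := by
  induction k generalizing x with
  | zero => exact (measurable_ratePlus x).const_div 1
  | succ k ih => exact ((measurable_rateMinus x).div (measurable_ratePlus x)).mul (ih _)

/-- The coefficients of the mean passage time as a series in the bias. -/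
def passageCoeff (P : Measure Environment) (k : ℕ) : ℝ≥0∞ :=
  ∫⁻ ξ, ENNReal.ofReal (passageWeight (rateMinus ξ) (ratePlus ξ) k 0) ∂P

lemma meanPassage_eq (P : Measure Environment) (lam : ℝ) :
    meanPassage P lam = expSeries (passageCoeff P) lam := by
  unfold meanPassage expSeries
  rw [ENNReal.tsum_eq_iSup_nat]
  refine iSup_congr fun j => ?_
  have hm : ∀ k, Measurable fun ξ : Environment =>
      ENNReal.ofReal (passageWeight (rateMinus ξ) (ratePlus ξ) k 0) := fun k =>
    (measurable_passageWeight k 0).ennreal_ofReal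
  simp_rw [meanIter_eq_sum, passageWeight_biased, passageCoeff, ← lintegral_const_mul _ (hm _)]
  rw [← lintegral_finsetSum _ fun k _ => (hm k).const_mul _]
  refine lintegral_congr fun ξ => ?_
  rw [ENNReal.ofReal_sum_of_nonneg fun k _ =>
    mul_nonneg (Real.exp_pos _).le (passageWeight_pos ξ k 0).le]
  exact Finset.sum_congr rfl fun k _ => ENNReal.ofReal_mul (Real.exp_pos _).le

lemma passageCoeff_zero_ne_zero (P : Measure Environment) [IsProbabilityMeasure P] :
    passageCoeff P 0 ≠ 0 := by
  refine ((lintegral_pos_iff_support (measurable_passageWeight 0 0).ennreal_ofReal).2 ?_).ne'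
  have : (Function.support fun ξ : Environment => ENNReal.ofReal
      (passageWeight (rateMinus ξ) (ratePlus ξ) 0 0)) = Set.univ := by
    refine Set.eq_univ_of_forall fun ξ => ?_
    simp [passageWeight_pos]
  rw [this]
  exact NeZero.pos _

/-! ### The velocity as a function of the bias -/

variable {P : Measure Environment} [IsProbabilityMeasure P]

lemma IsAsymptoticVelocity.isAsymptoticVelocity_velocity {P : Measure Environment} {lam v : ℝ}
    (h : IsAsymptoticVelocity P lam v) : IsAsymptoticVelocity P lam (velocity P lam) := by
  have hex : ∃ v, IsAsymptoticVelocity P lam v := ⟨v, h⟩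
  rw [velocity, dif_pos hex]
  exact hex.choose_spec

lemma isAsymptoticVelocity_of_mirror_ne_top (hP : Ergodic shift P) {lam : ℝ}
    (h : meanPassage (P.map mirror) (-lam) ≠ ∞) :
    IsAsymptoticVelocity P lam (-(meanPassage (P.map mirror) (-lam))⁻¹.toReal) := by
  have hprob := Measure.isProbabilityMeasure_map (μ := P) measurable_mirror.aemeasurable
  exact (isAsymptoticVelocity_of_meanPassage_ne_top (ergodic_mirror hP) h).of_mirror

/-- The walk cannot have a positive and a negative velocity. -/
lemma meanPassage_eq_top_or (hP : Ergodic shift P) (lam : ℝ) :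
    meanPassage P lam = ∞ ∨ meanPassage (P.map mirror) (-lam) = ∞ := by
  have hprob := Measure.isProbabilityMeasure_map (μ := P) measurable_mirror.aemeasurable
  by_contra! h
  -- If both means were finite, the walk would have one velocity that is positive and equal to a
  -- nonpositive number.
  have h1 := (isAsymptoticVelocity_of_meanPassage_ne_top hP h.1).unique
    (isAsymptoticVelocity_of_mirror_ne_top hP h.2)
  have h2 : 0 < (meanPassage P lam)⁻¹.toReal := ENNReal.toReal_pos (ENNReal.inv_ne_zero.2 h.1)
    (ENNReal.inv_ne_top.2 (meanPassage_pos lam).ne')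
  have h3 : 0 ≤ (meanPassage (P.map mirror) (-lam))⁻¹.toReal := ENNReal.toReal_nonneg
  linarith

/-- One formula for all three regimes, since at most one of the two terms is nonzero. Both terms
push in the same direction as the bias grows, so monotonicity is immediate. -/
lemma isAsymptoticVelocity_sub (hP : Ergodic shift P) (lam : ℝ) :
    IsAsymptoticVelocity P lam (recipSeries (passageCoeff P) lam -
      recipSeries (passageCoeff (P.map mirror)) (-lam)) := by
  unfold recipSeries
  rw [← meanPassage_eq, ← meanPassage_eq]
  by_cases h : meanPassage P lam = ∞
  · by_cases h' : meanPassage (P.map mirror) (-lam) = ∞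
    · simpa [h, h'] using isAsymptoticVelocity_zero hP h h'
    · simpa [h] using isAsymptoticVelocity_of_mirror_ne_top hP h'
  · have h' := (meanPassage_eq_top_or hP lam).resolve_left h
    simpa [h'] using isAsymptoticVelocity_of_meanPassage_ne_top hP h

lemma velocity_eq_sub (hP : Ergodic shift P) (lam : ℝ) :
    velocity P lam = recipSeries (passageCoeff P) lam -
      recipSeries (passageCoeff (P.map mirror)) (-lam) :=
  (isAsymptoticVelocity_sub hP lam).isAsymptoticVelocity_velocity.unique
    (isAsymptoticVelocity_sub hP lam)

lemma velocity_mono (hP : Ergodic shift P) : Monotone (velocity P) := by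
  have hprob := Measure.isProbabilityMeasure_map (μ := P) measurable_mirror.aemeasurable
  intro lam mu h
  rw [velocity_eq_sub hP, velocity_eq_sub hP]
  exact sub_le_sub (recipSeries_mono (passageCoeff_zero_ne_zero _) h)
    (recipSeries_mono (passageCoeff_zero_ne_zero _) (neg_le_neg h))

/-- A positive velocity at `mu` makes the series finite at `mu`, hence to its right, and there the
reflected term must vanish. -/
lemma velocity_eq_of_pos (hP : Ergodic shift P) {mu : ℝ} (h : 0 < velocity P mu) :
    expSeries (passageCoeff P) mu ≠ ∞ ∧
      ∀ l, mu ≤ l → velocity P l = recipSeries (passageCoeff P) l := by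
  have h1 : expSeries (passageCoeff P) mu ≠ ∞ := by
    intro htop
    rw [velocity_eq_sub hP, recipSeries_eq_zero htop] at h
    linarith [recipSeries_nonneg (α := passageCoeff (P.map mirror)) (-mu)]
  refine ⟨h1, fun l hl => ?_⟩
  have h2 : expSeries (passageCoeff P) l ≠ ∞ := ne_top_of_le_ne_top h1 (expSeries_antitone hl)
  have h3 := meanPassage_eq_top_or hP l
  rw [meanPassage_eq, meanPassage_eq] at h3
  rw [velocity_eq_sub hP, recipSeries_eq_zero (h3.resolve_left h2), sub_zero]

lemma velocity_eq_of_neg (hP : Ergodic shift P) {mu : ℝ} (h : velocity P mu < 0) :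
    expSeries (passageCoeff (P.map mirror)) (-mu) ≠ ∞ ∧
      ∀ l, l ≤ mu → velocity P l = -recipSeries (passageCoeff (P.map mirror)) (-l) := by
  have h1 : expSeries (passageCoeff (P.map mirror)) (-mu) ≠ ∞ := by
    intro htop
    rw [velocity_eq_sub hP, recipSeries_eq_zero htop] at h
    linarith [recipSeries_nonneg (α := passageCoeff P) mu]
  refine ⟨h1, fun l hl => ?_⟩
  have h2 : expSeries (passageCoeff (P.map mirror)) (-l) ≠ ∞ :=
    ne_top_of_le_ne_top h1 (expSeries_antitone (neg_le_neg hl))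
  have h3 := meanPassage_eq_top_or hP l
  rw [meanPassage_eq, meanPassage_eq] at h3
  rw [velocity_eq_sub hP, recipSeries_eq_zero (h3.resolve_right h2), zero_sub]

lemma exists_velocity_pos_of_lambdaPlus_lt {P : Measure Environment} {lam : ℝ}
    (h : lambdaPlus P < lam) :
    ∃ mu < lam, 0 < velocity P mu := by
  obtain ⟨_, ⟨mu, hmu, rfl⟩, hlt⟩ := sInf_lt_iff.1 h
  exact ⟨mu, EReal.coe_lt_coe_iff.1 hlt, hmu⟩

lemma exists_velocity_neg_of_lt_lambdaMinus {P : Measure Environment} {lam : ℝ}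
    (h : (lam : EReal) < lambdaMinus P) :
    ∃ mu > lam, velocity P mu < 0 := by
  obtain ⟨_, ⟨mu, hmu, rfl⟩, hlt⟩ := lt_sSup_iff.1 h
  exact ⟨mu, EReal.coe_lt_coe_iff.1 hlt, hmu⟩

end BiasedWalk
end

/-! ### Conclusion -/

theorem proposition4p3 (P : Measure BiasedWalk.Environment) [IsProbabilityMeasure P]
    (hErgodic : Ergodic BiasedWalk.shift P)
    (hLog : BiasedWalk.LogRatioMeanWellDefined P) :
    (∀ lam : ℝ, BiasedWalk.IsAsymptoticVelocity P lam (BiasedWalk.velocity P lam)) ∧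
    Monotone (BiasedWalk.velocity P) ∧
    BiasedWalk.lambdaMinus P ≤ BiasedWalk.lambdaPlus P ∧
    StrictMonoOn (BiasedWalk.velocity P) {lam : ℝ | (lam : EReal) < BiasedWalk.lambdaMinus P} ∧
    AnalyticOnNhd ℝ (BiasedWalk.velocity P)
      {lam : ℝ | (lam : EReal) < BiasedWalk.lambdaMinus P} ∧
    StrictMonoOn (BiasedWalk.velocity P) {lam : ℝ | BiasedWalk.lambdaPlus P < (lam : EReal)} ∧
    AnalyticOnNhd ℝ (BiasedWalk.velocity P)
      {lam : ℝ | BiasedWalk.lambdaPlus P < (lam : EReal)} ∧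
    (∀ lam : ℝ, BiasedWalk.lambdaMinus P < (lam : EReal) →
      (lam : EReal) < BiasedWalk.lambdaPlus P → BiasedWalk.velocity P lam = 0) := by
  open BiasedWalk in
  have hprob := Measure.isProbabilityMeasure_map (μ := P) measurable_mirror.aemeasurable
  have hc := passageCoeff_zero_ne_zero P
  have hc' := passageCoeff_zero_ne_zero (P.map mirror)
  refine ⟨fun lam => (isAsymptoticVelocity_sub hErgodic lam).isAsymptoticVelocity_velocity,
    velocity_mono hErgodic, ?_, ?_, ?_, ?_, ?_, ?_⟩
  · refine sSup_le ?_
    rintro _ ⟨lam, hlam, rfl⟩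
    refine le_sInf ?_
    rintro _ ⟨mu, hmu, rfl⟩
    refine EReal.coe_le_coe_iff.2 (le_of_lt ((velocity_mono hErgodic).reflect_lt ?_))
    exact lt_trans hlam hmu
  · intro l _ m hm hlm
    obtain ⟨mu, hmu, hv⟩ := exists_velocity_neg_of_lt_lambdaMinus hm
    obtain ⟨hfin, heq⟩ := velocity_eq_of_neg hErgodic hv
    rw [heq l (hlm.trans hmu).le, heq m hmu.le]
    exact neg_lt_neg (recipSeries_lt hc' (neg_lt_neg hlm)
      (ne_top_of_le_ne_top hfin (expSeries_antitone (neg_le_neg hmu.le))))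
  · intro l hl
    obtain ⟨mu, hmu, hv⟩ := exists_velocity_neg_of_lt_lambdaMinus hl
    obtain ⟨hfin, heq⟩ := velocity_eq_of_neg hErgodic hv
    have han : AnalyticAt ℝ (recipSeries (passageCoeff (P.map mirror))) (-l) :=
      analyticAt_recipSeries hc' (neg_lt_neg hmu) hfin
    have hcomp : AnalyticAt ℝ (fun l => -recipSeries (passageCoeff (P.map mirror)) (-l)) l :=
      (AnalyticAt.fun_comp (g := recipSeries (passageCoeff (P.map mirror))) han
        (f := fun l : ℝ => -l) analyticAt_id.neg).neg
    refine hcomp.congr ?_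
    -- The point `mu` lies strictly beyond `l`, so the explicit formula holds on a neighbourhood of
    -- `l`.
    filter_upwards [gt_mem_nhds hmu] with x hx using (heq x (le_of_lt hx)).symm
  · intro l hl m _ hlm
    obtain ⟨mu, hmu, hv⟩ := exists_velocity_pos_of_lambdaPlus_lt hl
    obtain ⟨hfin, heq⟩ := velocity_eq_of_pos hErgodic hv
    rw [heq l hmu.le, heq m (hmu.trans hlm).le]
    exact recipSeries_lt hc hlm (ne_top_of_le_ne_top hfin (expSeries_antitone hmu.le))
  · intro l hl
    obtain ⟨mu, hmu, hv⟩ := exists_velocity_pos_of_lambdaPlus_lt hl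
    obtain ⟨hfin, heq⟩ := velocity_eq_of_pos hErgodic hv
    refine (analyticAt_recipSeries hc hmu hfin).congr ?_
    filter_upwards [lt_mem_nhds hmu] with x hx using (heq x (le_of_lt hx)).symm
  · intro lam h1 h2
    refine le_antisymm ?_ ?_
    · refine not_lt.1 fun h => ?_
      exact absurd (sInf_le (Set.mem_image_of_mem _ (show lam ∈ {l : ℝ | 0 < velocity P l} from h)))
        (not_le.2 h2)
    · refine not_lt.1 fun h => ?_
      exact absurd (le_sSup (Set.mem_image_of_mem _ (show lam ∈ {l : ℝ | velocity P l < 0} from h)))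
        (not_le.2 h1)
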